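/- Let $\Bbbk$ be a commutative artinian ring, let $\Lambda$ and $\Gamma$ be Artin $\Bbbk$-algebras (i.e. finitely generated as $\Bbbk$-modules), and let $Q$ be a finite acyclic quiver. Write $\operatorname{mod}\Lambda$ for the category of finitely generated right $\Lambda$-modules and $\overline{\operatorname{mod}}\,\Lambda$ for its quotient by the ideal of morphisms factoring through injective modules. Let $\operatorname{rep}(Q,\mathcal C)$ denote the category of representations of $Q$ in a category $\mathcal C$, and let $\operatorname{mono}_Q(\Lambda)\subseteq\operatorname{rep}(Q,\operatorname{mod}\Lambda)$ be the full subcategory of those $(M_i,M_\alpha)$ for which $M_{i,\mathrm{in}}=(M_\alpha)_\alpha\colon\bigoplus_{t(\alpha)=i}M_{s(\alpha)}\to M_i$ is injective for every vertex $i$. It is an exact category whose conflations are the short exact sequences of representations with all terms in $\operatorname{mono}_Q(\Lambda)$, and "injective object of $\operatorname{mono}_Q(\Lambda)$" refers to this exact structure. For $B\in\operatorname{rep}(Q,\operatorname{mod}\Lambda)$ choose maps $e_i\colon\bigoplus_{t(\alpha)=i}B_{s(\alpha)}\to J_i$ whose restrictions to $\ker B_{i,\mathrm{in}}$ are injective envelopes.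 Then $\operatorname{Mimo}B$ is the representation with $(\operatorname{Mimo}B)_k=B_k\oplus\bigoplus_{p}J_{s(p)}$, where $p$ runs through the paths with $t(p)=k$, and whose map for an arrow $\beta\colon i\to k$ is induced by $B_\beta$, by the identities from the summand $J_{s(p)}$ at $p$ to the summand $J_{s(p)}$ at $\beta p$, and by the composite $B_i\hookrightarrow\bigoplus_{t(\alpha)=k}B_{s(\alpha)}\xrightarrow{e_k}J_k$ into the summand of the trivial path at $k$. For $M\in\operatorname{rep}(Q,\overline{\operatorname{mod}}\,\Lambda)$ put $\operatorname{Mimo}M:=\operatorname{Mimo}B$, where $B\in\operatorname{rep}(Q,\operatorname{mod}\Lambda)$ is isomorphic to $M$ in $\operatorname{rep}(Q,\overline{\operatorname{mod}}\,\Lambda)$ and no $B_i$ has a nonzero injective summand. Let $K_0(\operatorname{mod}\Lambda)$ be the split Grothendieck group of $\operatorname{mod}\Lambda$ and let $G_\Lambda\subseteq K_0(\operatorname{mod}\Lambda)$ be the subgroup generated by all $[M]$ with $M$ indecomposable and not simple injective. Use the same notation for $\Gamma$. **Theorem.** Let $\Phi\colon\overline{\operatorname{mod}}\,\Lambda\xrightarrow{\cong}\overline{\operatorname{mod}}\,\Gamma$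 be an equivalence that restricts to an equivalence between the full subcategories of simple non-injective $\Lambda$- and $\Gamma$-modules. (a) There is a unique bijection $\phi_Q$ from the isomorphism classes of indecomposable non-injective objects of $\operatorname{mono}_Q(\Lambda)$ to those of $\operatorname{mono}_Q(\Gamma)$ that is induced by $\Phi$, in the sense that every indecomposable non-injective object of $\operatorname{mono}_Q(\Lambda)$ is isomorphic to $\operatorname{Mimo}M$ for some $M\in\operatorname{rep}(Q,\overline{\operatorname{mod}}\,\Lambda)$ with $\phi_Q(\operatorname{Mimo}M)=\operatorname{Mimo}(\Phi M)$. (b) There is a unique isomorphism $\phi\colon G_\Lambda\to G_\Gamma$ such that: $\phi([M])=[N]$ if $M$ is indecomposable non-injective, where $N$ is the indecomposable non-injective $\Gamma$-module isomorphic to $\Phi(M)$ in $\overline{\operatorname{mod}}\,\Gamma$; and $\phi([I])=[J]$ if $I$ is indecomposable, injective and not simple, where $J$ is the indecomposable injective $\Gamma$-module whose socle is isomorphic to $\Phi(\operatorname{soc}I)$ in $\overline{\operatorname{mod}}\,\Gamma$. (c) For every indecomposable non-injective $M\in\operatorname{mono}_Q(\Lambda)$ and every vertex $i$ of $Q$ we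 have $[M_i]\in G_\Lambda$ and $[\phi_Q(M)_i]=\phi([M_i])$. (d) Let $\psi$ be a bijection from the isomorphism classes of simple injective $\Lambda$-modules to those of simple injective $\Gamma$-modules. Then $\phi$ extends uniquely to an isomorphism $\phi\colon K_0(\operatorname{mod}\Lambda)\to K_0(\operatorname{mod}\Gamma)$ with $\phi([S])=[\psi(S)]$ for every simple injective $\Lambda$-module $S$, and $\phi_Q$ extends uniquely to a bijection from the isomorphism classes of all indecomposable objects of $\operatorname{mono}_Q(\Lambda)$ to those of $\operatorname{mono}_Q(\Gamma)$ such that $[\phi_Q(M)_i]=\phi([M_i])$ for every indecomposable $M\in\operatorname{mono}_Q(\Lambda)$ and every vertex $i$ of $Q$. -/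

import Mathlib

open CategoryTheory CategoryTheory.Limits

universe u w v u₁ u₂

namespace QuiverMono



noncomputable section

/-! ### Generalities on additive categories -/

section Additive

variable {C : Type u} [Category.{v} C]

/-- A nonzero object which is not a direct sum of two nonzero objects. -/
def IsIndec [HasZeroMorphisms C] (X : C) : Prop :=
  ¬ IsZero X ∧ ∀ (Y Z : C) (b : BinaryBicone Y Z), Nonempty b.IsBilimit →
    Nonempty (X ≅ b.pt) → IsZero Y ∨ IsZero Z

/-- `X` has no nonzero injective direct summand. -/
def NoInjSummand (X : C) : Prop :=
  ∀ I : C, Injective I → Nonempty (Retract I X) → IsZero I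

variable (C) in
/-- Two parallel morphisms are related if their difference factors through an injective object. -/
def injRel [Preadditive C] : HomRel C := fun X Y f g =>
  ∃ (I : C) (a : X ⟶ I) (b : I ⟶ Y), Injective I ∧ f - g = a ≫ b

variable (C) in
/-- The injectively stable category: the quotient of `C` by the ideal of all morphisms that factor
through an injective object. -/
abbrev StableCat [Preadditive C] := CategoryTheory.Quotient (injRel C)

variable (C) in
/-- The canonical functor from `C` to its injectively stable category. -/
abbrev toStable [Preadditive C] : C ⥤ StableCat C := CategoryTheory.Quotient.functor (injRel C)

/-- The isomorphism classes of the objects that satisfy `P`. -/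
def IsoClasses (P : ObjectProperty C) := _root_.Quotient (isIsomorphicSetoid P.FullSubcategory)

/-- The isomorphism class of an object that satisfies `P`. -/
def IsoClasses.mk {P : ObjectProperty C} (X : C) (hX : P X) : IsoClasses P :=
  _root_.Quotient.mk (isIsomorphicSetoid P.FullSubcategory) ⟨X, hX⟩

variable (C) in
/-- The relations `[A ⊕ B] = [A] + [B]`, where `A ⊕ B` runs through all choices of a direct sum
(in particular isomorphic objects get identified, as `X ≅ Y` is a direct sum of `Y` and `0`). -/
def splitRelations [HasZeroMorphisms C] : Set (FreeAbelianGroup C) :=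
  {x | ∃ (A B : C) (b : BinaryBicone A B), Nonempty b.IsBilimit ∧
    x = FreeAbelianGroup.of b.pt - (FreeAbelianGroup.of A + FreeAbelianGroup.of B)}

variable (C) in
/-- The split Grothendieck group. -/
abbrev SplitK₀ [HasZeroMorphisms C] : Type _ :=
  FreeAbelianGroup C ⧸ AddSubgroup.closure (splitRelations C)

/-- The class of an object in the split Grothendieck group. -/
def cls [HasZeroMorphisms C] (X : C) : SplitK₀ C :=
  QuotientAddGroup.mk (FreeAbelianGroup.of X)

end Additive

/-! ### Finitely generated modules -/

section Modules

variable (R : Type u) [Ring R]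

/-- The socle: the sum of all simple submodules. -/
def socle (M : Type v) [AddCommGroup M] [Module R M] : Submodule R M :=
  sSup {S : Submodule R M | IsSimpleModule R S}

/-- The category of finitely generated right `R`-modules, i.e. of finitely generated left modules
over the opposite ring. -/
abbrev RightMod : Type (u + 1) := FGModuleCat.{u} Rᵐᵒᵖ

/-- The simple injective modules. -/
def simpleInj : ObjectProperty (RightMod R) := fun M => IsSimpleModule Rᵐᵒᵖ M ∧ Injective M

/-- The simple non-injective modules. -/
def simpleNonInj : ObjectProperty (RightMod R) := fun M => IsSimpleModule Rᵐᵒᵖ M ∧ ¬ Injective M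

/-- The subgroup of the split Grothendieck group generated by the classes of all indecomposable
modules that are not simple injective. -/
def nonSimpleInjSubgroup : AddSubgroup (SplitK₀ (RightMod R)) :=
  AddSubgroup.closure {x | ∃ M : RightMod R, IsIndec M ∧ ¬ simpleInj R M ∧ x = cls M}

end Modules

/-! ### Representations of a quiver, the monomorphism category and the Mimo-construction -/

section Representations

/-- A quiver is acyclic if it has no oriented cycle. -/
def IsAcyclicQuiver (Q : Type w) [Quiver.{v + 1} Q] : Prop :=
  ∀ (i : Q) (p : Quiver.Path i i), p = Quiver.Path.nil

variable (Q : Type w) [Quiver.{v + 1} Q] (R : Type u) [Ring R]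

/-- Representations of `Q` in a category `C`. -/
abbrev Rep (C : Type u₁) [Category.{u₂} C] := Paths Q ⥤ C

variable {Q R}

/-- The module at a vertex. -/
abbrev Rep.at {C : Type u₁} [Category.{u₂} C] (M : Rep Q C) (i : Q) : C :=
  M.obj ((Paths.of Q).obj i)

/-- The linear map of an arrow. -/
def Rep.arrow (M : Rep Q (RightMod R)) {i j : Q} (a : i ⟶ j) : M.at i →ₗ[Rᵐᵒᵖ] M.at j :=
  (M.map ((Paths.of Q).map a)).hom.hom

/-- The direct sum of the modules `M_{s(α)}` over all arrows `α` with target `i`. -/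
abbrev Rep.InSum (M : Rep Q (RightMod R)) (i : Q) : Type _ :=
  DirectSum (Σ j : Q, (j ⟶ i)) (fun a => M.at a.1)

open Classical in
/-- The map `M_{i,in} : ⨁_{t(α) = i} M_{s(α)} → M_i` with components `M_α`. -/
def Rep.inMap (M : Rep Q (RightMod R)) (i : Q) : M.InSum i →ₗ[Rᵐᵒᵖ] M.at i :=
  DirectSum.toModule Rᵐᵒᵖ _ _ (fun a => M.arrow a.2)

variable (Q R) in
/-- The objects of the monomorphism category: all maps `M_{i,in}` are injective. -/
def isMonoRep : ObjectProperty (Rep Q (RightMod R)) :=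
  fun M => ∀ i : Q, Function.Injective (M.inMap i)

variable (Q R) in
/-- The monomorphism category, a full subcategory of the category of representations of `Q` in
finitely generated right `R`-modules. -/
abbrev MonoRep := (isMonoRep Q R).FullSubcategory

/-- The component at a vertex of a morphism of representations, as a linear map. -/
def MonoRep.homAt {X Y : MonoRep Q R} (f : X ⟶ Y) (i : Q) :
    X.obj.at i →ₗ[Rᵐᵒᵖ] Y.obj.at i :=
  (f.hom.app ((Paths.of Q).obj i)).hom.hom

/-- The conflations of the monomorphism category: the short exact sequences of representations all
of whose terms lie in it. -/
def IsConflation {X Y Z : MonoRep Q R} (f : X ⟶ Y) (g : Y ⟶ Z) : Prop :=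
  ∀ i : Q, Function.Injective (MonoRep.homAt f i) ∧
    Function.Exact (MonoRep.homAt f i) (MonoRep.homAt g i) ∧
    Function.Surjective (MonoRep.homAt g i)

/-- The injective objects of the exact category `MonoRep Q R`. -/
def IsInjMono (I : MonoRep Q R) : Prop :=
  ∀ ⦃X Y Z : MonoRep Q R⦄ (f : X ⟶ Y) (g : Y ⟶ Z), IsConflation f g →
    ∀ h : X ⟶ I, ∃ h' : Y ⟶ I, f ≫ h' = h

variable (Q R) in
/-- The indecomposable objects of the monomorphism category. -/
def indecMono : ObjectProperty (MonoRep Q R) := fun X => IsIndec X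

variable (Q R) in
/-- The indecomposable non-injective objects of the monomorphism category. -/
def nonInjIndecMono : ObjectProperty (MonoRep Q R) := fun X => IsIndec X ∧ ¬ IsInjMono X

/-- A linear map `j : K → J` is an injective envelope if it is injective, `J` is an injective
object, and `j` is left minimal. -/
def IsInjEnvelope {K : Type v} [AddCommGroup K] [Module Rᵐᵒᵖ K] {J : RightMod R}
    (j : K →ₗ[Rᵐᵒᵖ] J) : Prop :=
  Function.Injective j ∧ Injective J ∧
    ∀ g : J →ₗ[Rᵐᵒᵖ] J, g ∘ₗ j = j → Function.Bijective g

/-- The module `B_k ⊕ ⨁_{t(p) = k} J_{s(p)}`, where `p` runs through all paths ending in `k`. -/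
abbrev MoObj (B : Rep Q (RightMod R)) (J : Q → RightMod R) (k : Q) : Type _ :=
  B.at k × DirectSum (Σ j : Q, Quiver.Path j k) (fun p => J p.1)

open Classical in
/-- The map of an arrow `β : i ⟶ k` in the Mo-construction. It is induced by `B_β`, by the
identities from the summand of `p` to the summand of `βp`, and by the composite
`B_i → ⨁_{t(α) = k} B_{s(α)} → J_k` of the inclusion and `e_k`, where `J_k` is the summand of the
trivial path at `k`. -/
def moArrow (B : Rep Q (RightMod R)) (J : Q → RightMod R)
    (e : ∀ i : Q, B.InSum i →ₗ[Rᵐᵒᵖ] J i) {i k : Q} (β : i ⟶ k) :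
    MoObj B J i →ₗ[Rᵐᵒᵖ] MoObj B J k :=
  LinearMap.coprod
    (LinearMap.prod (B.arrow β)
      (DirectSum.lof Rᵐᵒᵖ (Σ j : Q, Quiver.Path j k) (fun p => J p.1) ⟨k, Quiver.Path.nil⟩ ∘ₗ
        e k ∘ₗ DirectSum.lof Rᵐᵒᵖ (Σ j : Q, (j ⟶ k)) (fun a => B.at a.1) ⟨i, β⟩))
    (LinearMap.inr Rᵐᵒᵖ _ _ ∘ₗ
      DirectSum.toModule Rᵐᵒᵖ (Σ j : Q, Quiver.Path j i) _ (fun p =>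
        DirectSum.lof Rᵐᵒᵖ (Σ j : Q, Quiver.Path j k) (fun q => J q.1) ⟨p.1, p.2.cons β⟩))

/-- `X` is isomorphic to the Mimo-construction of the representation `B`: for suitable maps
`e_i : ⨁_{t(α) = i} B_{s(α)} → J_i` whose restrictions to `ker B_{i,in}` are injective envelopes,
`X` is isomorphic to the representation formed by the `MoObj` and `moArrow`. -/
def IsMimo (B : Rep Q (RightMod R)) (X : MonoRep Q R) : Prop :=
  ∃ (J : Q → RightMod R) (e : ∀ i : Q, B.InSum i →ₗ[Rᵐᵒᵖ] J i),
    (∀ i : Q, IsInjEnvelope (e i ∘ₗ (LinearMap.ker (B.inMap i)).subtype)) ∧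
    ∃ θ : ∀ k : Q, X.obj.at k ≃ₗ[Rᵐᵒᵖ] MoObj B J k,
      ∀ ⦃i k : Q⦄ (β : i ⟶ k) (x : X.obj.at i),
        θ k (X.obj.arrow β x) = moArrow B J e β (θ i x)

/-- `X` is isomorphic to the Mimo-construction of a representation `M` in the stable category:
lift `M` to a representation whose modules have no nonzero injective summands, and apply the
Mimo-construction to the lift. -/
def IsStableMimo (M : Rep Q (StableCat (RightMod R))) (X : MonoRep Q R) : Prop :=
  ∃ B : Rep Q (RightMod R), (∀ i : Q, NoInjSummand (B.at i)) ∧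
    Nonempty (B ⋙ toStable (RightMod R) ≅ M) ∧ IsMimo B X

end Representations

/-! ### The data induced by a stable equivalence -/

section Induced

variable {Λ : Type u₁} {Γ : Type u₂} [Ring Λ] [Ring Γ]

/-- The two modules correspond to each other under `Φ`. -/
def Corresponds (Φ : StableCat (RightMod Λ) ≌ StableCat (RightMod Γ))
    (M : RightMod Λ) (N : RightMod Γ) : Prop :=
  Nonempty (Φ.functor.obj ((toStable (RightMod Λ)).obj M) ≅ (toStable (RightMod Γ)).obj N)

/-- `Φ` restricts to an equivalence between the full subcategories of the simple non-injective
modules. -/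
def RestrictsToSimples (Φ : StableCat (RightMod Λ) ≌ StableCat (RightMod Γ)) : Prop :=
  (∀ S, simpleNonInj Λ S → ∃ T, simpleNonInj Γ T ∧ Corresponds Φ S T) ∧
  (∀ T, simpleNonInj Γ T → ∃ S, simpleNonInj Λ S ∧ Corresponds Φ S T)

/-- The bijection `φQ` is induced by `Φ`: it sends the Mimo-construction of `M` to the
Mimo-construction of `Φ M`, for representations `M` of `Q` in the stable category. -/
def IsInducedBijection {Q : Type w} [Quiver.{v + 1} Q]
    (Φ : StableCat (RightMod Λ) ≌ StableCat (RightMod Γ))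
    (φQ : IsoClasses (nonInjIndecMono Q Λ) ≃ IsoClasses (nonInjIndecMono Q Γ)) : Prop :=
  ∀ (X : MonoRep Q Λ) (hX : nonInjIndecMono Q Λ X),
    ∃ (M : Rep Q (StableCat (RightMod Λ))) (Y : MonoRep Q Γ) (hY : nonInjIndecMono Q Γ Y),
      IsStableMimo M X ∧ IsStableMimo (M ⋙ Φ.functor) Y ∧
      φQ (IsoClasses.mk X hX) = IsoClasses.mk Y hY

/-- The isomorphism `φ` is induced by `Φ`: it sends an indecomposable non-injective module `M` to
the indecomposable non-injective module that corresponds to `M` under `Φ`, and an indecomposable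
injective non-simple module `I` to the indecomposable injective module whose socle corresponds to
the socle of `I` under `Φ`. -/
def IsInducedIso (Φ : StableCat (RightMod Λ) ≌ StableCat (RightMod Γ))
    (φ : nonSimpleInjSubgroup Λ ≃+ nonSimpleInjSubgroup Γ) : Prop :=
  (∀ (M : RightMod Λ) (hM : cls M ∈ nonSimpleInjSubgroup Λ), IsIndec M → ¬ Injective M →
    ∃ N : RightMod Γ, IsIndec N ∧ ¬ Injective N ∧ Corresponds Φ M N ∧
      (φ ⟨cls M, hM⟩ : SplitK₀ (RightMod Γ)) = cls N) ∧
  (∀ (I : RightMod Λ) (hI : cls I ∈ nonSimpleInjSubgroup Λ), IsIndec I → Injective I →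
    ¬ IsSimpleModule Λᵐᵒᵖ I →
    ∃ (J : RightMod Γ) (S : RightMod Λ) (T : RightMod Γ), IsIndec J ∧ Injective J ∧
      Nonempty (S ≃ₗ[Λᵐᵒᵖ] socle Λᵐᵒᵖ I) ∧ Nonempty (T ≃ₗ[Γᵐᵒᵖ] socle Γᵐᵒᵖ J) ∧
      Corresponds Φ S T ∧ (φ ⟨cls I, hI⟩ : SplitK₀ (RightMod Γ)) = cls J)

/-- `φ'` extends `φ` and is given by `ψ` on the simple injective modules. -/
def IsExtensionBy (φ : nonSimpleInjSubgroup Λ ≃+ nonSimpleInjSubgroup Γ)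
    (ψ : IsoClasses (simpleInj Λ) ≃ IsoClasses (simpleInj Γ))
    (φ' : SplitK₀ (RightMod Λ) ≃+ SplitK₀ (RightMod Γ)) : Prop :=
  (∀ x : nonSimpleInjSubgroup Λ, φ' x = φ x) ∧
  (∀ (S : RightMod Λ) (T : RightMod Γ) (hS : simpleInj Λ S) (hT : simpleInj Γ T),
    ψ (IsoClasses.mk S hS) = IsoClasses.mk T hT → φ' (cls S) = cls T)

/-- `φQ'` is an extension of `φQ` to all indecomposable objects. -/
def ExtendsBijection {Q : Type w} [Quiver.{v + 1} Q]
    (φQ : IsoClasses (nonInjIndecMono Q Λ) ≃ IsoClasses (nonInjIndecMono Q Γ))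
    (φQ' : IsoClasses (indecMono Q Λ) ≃ IsoClasses (indecMono Q Γ)) : Prop :=
  ∀ (X : MonoRep Q Λ) (Y : MonoRep Q Γ) (hX : nonInjIndecMono Q Λ X)
    (hY : nonInjIndecMono Q Γ Y), φQ (IsoClasses.mk X hX) = IsoClasses.mk Y hY →
    φQ' (IsoClasses.mk X hX.1) = IsoClasses.mk Y hY.1

end Induced

end

end QuiverMono

open QuiverMono

namespace QuiverMono

noncomputable section

set_option linter.unusedSectionVars false

/-! ### Drazin inverses and indecomposable objects -/

/-! The proof compares monic representations with representations in the stable category through the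
vertexwise functor `monoToStable`. Three facts make it behave like a projective cover. It is full
(`exists_lift_stable`): a morphism is lifted vertex by vertex, and the defect of commutativity
factors through an injective module, so it can be absorbed by extending along the monomorphism
`inMap`. An object is injective in the exact structure exactly when all its modules are injective,
that is, when the functor kills its identity (`isInjMono_iff`). Finally, endomorphisms have Drazin
inverses (Fitting's lemma), so on a minimal object, one without nonzero summands killed by the
functor, every endomorphism that the functor kills is nilpotent. Hence minimal objects with
isomorphic images are isomorphic (`IsMinimal.iso`), and indecomposability passes between such
objects, even across different categories (`IsIndec.transfer`). A Mimo-construction of a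
representation without injective summands is minimal (`IsMimo.isMinimal`) and is stably isomorphic
to that representation (`IsMimo.nonempty_stableIso`). Inserting the equivalence between the two
functors gives the bijection of (a).

For (b), the Krull-Schmidt theorem makes the split Grothendieck group free on indecomposable
classes, so it suffices to match indecomposables. Non-injective ones are matched by the stable
equivalence. Injective ones are determined by their simple socles, and the socle of a non-simple
indecomposable injective module is simple and non-injective, so the equivalence sees it.

For (c), the module of a Mimo-construction at a vertex is `B_k` plus copies of the envelopes `J_i`
of the kernels of `B.inMap i`, and `J_i` depends only on the socle of that kernel. A stably zero map
from a semisimple module to a module without injective summands is zero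
(`eq_zero_of_toStable_map_eq_zero`). Therefore this socle is a kernel relative to semisimple test
objects, formed entirely in the stable category (`isJointKernel_socle`). An equivalence that
preserves the simple non-injective modules preserves such relative kernels.

For (d), the indecomposable injective objects are the free representations on indecomposable
injective modules `J` at a vertex `j`. Their class at `k` is the number of paths from `j` to `k`
times `[J]`, and by acyclicity these classes determine both `j` and `J` (`nonempty_iso_of_cls_eq`),
so there is exactly one compatible way to extend the bijection. -/

/-- An element of a monoid with a Drazin inverse. -/
def IsDrazin {E : Type*} [Monoid E] (h : E) : Prop :=
  ∃ (c : E) (n : ℕ), Commute h c ∧ c * h * c = c ∧ h ^ (n + 1) * c = h ^ n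

/-- The product `h * c` is idempotent. If it is `0`, then `h ^ n = h ^ n * (h * c)` vanishes; if it
is `1`, then `c` inverts `h`. -/
lemma IsDrazin.nilpotent_or_isUnit {E : Type*} [Ring E] {h : E} (hh : IsDrazin h)
    (hE : ∀ e : E, e * e = e → e = 0 ∨ e = 1) : IsNilpotent h ∨ IsUnit h := by
  obtain ⟨c, n, h1, h2, h3⟩ := hh
  have he : (h * c) * (h * c) = h * c := by
    rw [mul_assoc, ← mul_assoc c h c, h2]
  rcases hE _ he with h0 | h0
  · left
    refine ⟨n, ?_⟩
    rw [← h3, pow_succ, mul_assoc, h0, mul_zero]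
  · right
    exact ⟨⟨h, c, h0, by rw [← h1.eq, h0]⟩, rfl⟩

lemma eq_zero_of_isNilpotent_idem {E : Type*} [Ring E] {e : E} (he : e * e = e)
    (hn : IsNilpotent e) : e = 0 := by
  obtain ⟨n, hn⟩ := hn
  have : ∀ m : ℕ, e ^ (m + 1) = e := by
    intro m
    induction m with
    | zero => simp
    | succ m ih => rw [pow_succ, ih, he]
  rw [← this n, pow_succ, hn, zero_mul]

/-- Every endomorphism has a Drazin inverse. -/
class HasDrazin (C : Type*) [Category C] [Preadditive C] : Prop where
  drazin : ∀ (X : C) (h : End X), IsDrazin h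

section Indec

variable {C : Type u₁} [Category.{u₂} C] [Preadditive C]

lemma exists_split [IsIdempotentComplete C] {X : C} (e : X ⟶ X) (he : e ≫ e = e) :
    ∃ (Y : C) (r : Retract Y X), r.r ≫ r.i = e := by
  obtain ⟨Y, i, p, h1, h2⟩ := IsIdempotentComplete.idempotents_split X e he
  exact ⟨Y, ⟨i, p, h1⟩, h2⟩

lemma isIndec_of_idem {X : C} (hX : ¬ IsZero X)
    (h : ∀ e : X ⟶ X, e ≫ e = e → e = 0 ∨ e = 𝟙 X) : IsIndec X := by
  refine ⟨hX, ?_⟩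
  rintro Y Z b - ⟨φ⟩
  rcases h (φ.hom ≫ b.fst ≫ b.inl ≫ φ.inv) (by simp) with h0 | h0
  · left
    rw [IsZero.iff_id_eq_zero]
    have := congrArg (fun t => b.inl ≫ φ.inv ≫ t ≫ φ.hom ≫ b.fst) h0
    simpa using this
  · right
    rw [IsZero.iff_id_eq_zero]
    have := congrArg (fun t => b.inr ≫ φ.inv ≫ t ≫ φ.hom ≫ b.snd) h0
    simpa using this.symm

/-- The direct sum decomposition attached to two complementary retracts. -/
def bicone_of_retracts {X Y Z : C} (r : Retract Y X) (s : Retract Z X)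
    (h : r.r ≫ r.i + s.r ≫ s.i = 𝟙 X) : BinaryBicone Y Z where
  pt := X
  fst := r.r
  snd := s.r
  inl := r.i
  inr := s.i
  inl_fst := r.retract
  inr_snd := s.retract
  inl_snd := by
    have h1 : r.i ≫ (r.r ≫ r.i + s.r ≫ s.i) ≫ s.r = r.i ≫ s.r := by rw [h, Category.id_comp]
    rw [Preadditive.add_comp, Preadditive.comp_add] at h1
    simp only [Category.assoc, s.retract, Category.comp_id] at h1
    rw [← Category.assoc r.i r.r, r.retract, Category.id_comp] at h1
    simpa using h1
  inr_fst := by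
    have h1 : s.i ≫ (r.r ≫ r.i + s.r ≫ s.i) ≫ r.r = s.i ≫ r.r := by rw [h, Category.id_comp]
    rw [Preadditive.add_comp, Preadditive.comp_add] at h1
    simp only [Category.assoc, r.retract, Category.comp_id] at h1
    rw [← Category.assoc s.i s.r, s.retract, Category.id_comp] at h1
    simpa using h1

lemma exists_complement [IsIdempotentComplete C] {X Y : C} (r : Retract Y X) :
    ∃ (Z : C) (s : Retract Z X), r.r ≫ r.i + s.r ≫ s.i = 𝟙 X := by
  have hr : r.r ≫ r.i ≫ r.r ≫ r.i = r.r ≫ r.i := by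
    rw [← Category.assoc r.i, r.retract, Category.id_comp]
  obtain ⟨Z, s, hs⟩ := exists_split (𝟙 X - r.r ≫ r.i) (by
    simp only [Preadditive.sub_comp, Preadditive.comp_sub, Category.id_comp, Category.comp_id,
      Category.assoc, hr, sub_self, sub_zero])
  exact ⟨Z, s, by rw [hs]; abel⟩

/-- The images of `e` and `𝟙 X - e` decompose `X`, and the vanishing of either one decides `e`.
Unlike the converse `isIndec_of_idem`, this direction needs idempotents to split. -/
lemma IsIndec.idem [IsIdempotentComplete C] {X : C} (hX : IsIndec X) (e : X ⟶ X)
    (he : e ≫ e = e) : e = 0 ∨ e = 𝟙 X := by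
  obtain ⟨Y, r, hr⟩ := exists_split e he
  obtain ⟨Z, s, hs⟩ := exists_complement r
  rcases hX.2 Y Z (bicone_of_retracts r s hs) ⟨isBinaryBilimitOfTotal _ hs⟩ ⟨Iso.refl _⟩ with h | h
  · left
    rw [← hr, h.eq_of_src r.i 0, comp_zero]
  · right
    rw [← hr, ← hs, h.eq_of_src s.i 0, comp_zero, add_zero]

lemma IsIndec.of_iso {X Y : C} (hX : IsIndec X) (φ : X ≅ Y) : IsIndec Y :=
  ⟨fun h => hX.1 (h.of_iso φ), fun A B b hb ⟨ψ⟩ => hX.2 A B b hb ⟨φ ≪≫ ψ⟩⟩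

lemma IsIndec.nilpotent_or_isUnit [IsIdempotentComplete C] [HasDrazin C] {X : C}
    (hX : IsIndec X) (h : End X) : IsNilpotent h ∨ IsUnit h :=
  (HasDrazin.drazin X h).nilpotent_or_isUnit (fun e he => hX.idem e he)

lemma IsIndec.isIso_of_not_nilpotent [IsIdempotentComplete C] [HasDrazin C] {X : C}
    (hX : IsIndec X) (h : X ⟶ X) (hn : ¬ IsNilpotent (R := End X) h) : IsIso h :=
  (isUnit_iff_isIso h).1 ((hX.nilpotent_or_isUnit h).resolve_left hn)

/-- The endomorphism ring of an indecomposable object is local. -/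
lemma IsIndec.isIso_or_isIso_of_add [IsIdempotentComplete C] [HasDrazin C] {X : C}
    (hX : IsIndec X) (f g : X ⟶ X) (h : f + g = 𝟙 X) : IsIso f ∨ IsIso g := by
  by_cases hn : IsNilpotent (R := End X) f
  · right
    have : IsUnit (1 - (show End X from f)) := hn.isUnit_one_sub
    have e : g = (1 - (show End X from f) : End X) := by
      change g = 𝟙 X - f
      rw [← h]; abel
    rw [e]
    exact (isUnit_iff_isIso _).1 this
  · exact Or.inl (hX.isIso_of_not_nilpotent f hn)

lemma IsIndec.retract_isZero_or_isIso [IsIdempotentComplete C] {X Y : C} (hX : IsIndec X)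
    (r : Retract Y X) : IsZero Y ∨ IsIso r.i := by
  have hr : (r.r ≫ r.i) ≫ r.r ≫ r.i = r.r ≫ r.i := by
    rw [Category.assoc, ← Category.assoc r.i, r.retract, Category.id_comp]
  rcases hX.idem _ hr with h | h
  · left
    rw [IsZero.iff_id_eq_zero]
    calc 𝟙 Y = r.i ≫ (r.r ≫ r.i) ≫ r.r := by simp
      _ = 0 := by rw [h]; simp
  · exact Or.inr ⟨r.r, r.retract, h⟩

/-- Nilpotency of `f ≫ g` and of `g ≫ f` are equivalent. -/
lemma isNilpotent_comp_comm {X Y : C} (f : X ⟶ Y) (g : Y ⟶ X)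
    (h : IsNilpotent (R := End X) (f ≫ g)) : IsNilpotent (R := End Y) (g ≫ f) := by
  obtain ⟨n, hn⟩ := h
  have key : ∀ m : ℕ, (show End Y from g ≫ f) ^ (m + 1) =
      g ≫ ((show End X from f ≫ g) ^ m : End X) ≫ f := by
    intro m
    induction m with
    | zero => change _ = g ≫ 𝟙 X ≫ f; simp
    | succ m ih =>
      rw [pow_succ, ih, pow_succ]
      change (g ≫ f) ≫ (g ≫ _ ≫ f) = g ≫ ((f ≫ g) ≫ _) ≫ f
      simp
  exact ⟨n + 1, by rw [key, hn]; simp⟩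

end Indec

/-! ### Minimal lifts along a full additive functor -/

section Minimal

variable {C : Type u₁} [Category.{u₂} C] [Preadditive C] {D : Type u} [Category.{v} D]
  [Preadditive D]

/-- `X` has no nonzero direct summand that is annihilated by `F`. -/
def IsMinimal (F : C ⥤ D) (X : C) : Prop :=
  ∀ Y : C, Nonempty (Retract Y X) → F.map (𝟙 Y) = 0 → IsZero Y

lemma IsMinimal.of_retract {F : C ⥤ D} {X Y : C} (hX : IsMinimal F X) (r : Retract Y X) :
    IsMinimal F Y :=
  fun Z ⟨s⟩ hZ => hX Z ⟨s.trans r⟩ hZ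

lemma IsIndec.isMinimal [IsIdempotentComplete C] (F : C ⥤ D) [F.PreservesZeroMorphisms] {X : C}
    (hX : IsIndec X) (h : F.map (𝟙 X) ≠ 0) : IsMinimal F X := by
  rintro Y ⟨r⟩ hY
  refine (hX.retract_isZero_or_isIso r).resolve_right fun hi => h ?_
  have : 𝟙 X = inv r.i ≫ 𝟙 Y ≫ r.i := by simp
  rw [this, F.map_comp, F.map_comp, hY]
  simp

lemma isIso_of_isIso_comps {X Y : C} (f : X ⟶ Y) (g : Y ⟶ X) (h1 : IsIso (f ≫ g))
    (h2 : IsIso (g ≫ f)) : IsIso f := by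
  refine ⟨g ≫ inv (f ≫ g), by rw [← Category.assoc, IsIso.hom_inv_id], ?_⟩
  have h3 : inv (g ≫ f) ≫ g ≫ f = 𝟙 Y := by simp
  have h4 : g ≫ inv (f ≫ g) = inv (g ≫ f) ≫ g := by
    rw [IsIso.comp_inv_eq]
    simp
  rw [h4, Category.assoc, h3]

variable (F : C ⥤ D) [F.Additive] [IsIdempotentComplete C] [HasDrazin C]

/-- The Drazin inverse isolates the summand on which `h` is invertible: it is the image of the
idempotent `c ≫ h`. Since `F` kills `h`, it kills this summand, so minimality leaves only the
nilpotent part. -/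
lemma IsMinimal.isNilpotent {F : C ⥤ D} [F.Additive] {X : C} (hX : IsMinimal F X) (h : X ⟶ X)
    (hh : F.map h = 0) : IsNilpotent (R := End X) h := by
  obtain ⟨c, n, h1, h2, h3⟩ := HasDrazin.drazin X h
  have he : (c ≫ h) ≫ (c ≫ h) = c ≫ h := by
    have : c ≫ h ≫ c = c := by
      change (c * (show End X from h)) * c = c
      exact h2
    rw [Category.assoc, ← Category.assoc h, ← Category.assoc c, this]
  obtain ⟨Y, r, hr⟩ := exists_split _ he
  have hY : IsZero Y := by
    refine hX Y ⟨r⟩ ?_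
    have : 𝟙 Y = r.i ≫ (c ≫ h) ≫ r.r := by rw [← hr]; simp
    rw [this]
    simp [hh]
  have h0 : c ≫ h = 0 := by rw [← hr, hY.eq_of_src r.i 0, comp_zero]
  -- Multiplication in `End X` is composition in reverse order.
  have h0' : (show End X from h) * c = 0 := h0
  exact ⟨n, by rw [← h3, pow_succ, mul_assoc, h0', mul_zero]⟩

lemma IsMinimal.isIso_of_map_eq_id {F : C ⥤ D} [F.Additive] {X : C} (hX : IsMinimal F X)
    (h : X ⟶ X) (hh : F.map h = 𝟙 _) : IsIso h := by
  have hn := hX.isNilpotent (𝟙 X - h) (by rw [F.map_sub, hh, F.map_id, sub_self])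
  have hu := hn.isUnit_one_sub
  have : (1 - (show End X from 𝟙 X - h) : End X) = h := by
    change 𝟙 X - (𝟙 X - h) = h
    abel
  rw [this] at hu
  exact (isUnit_iff_isIso h).1 hu

/-- Lifts of `φ` and its inverse compose to endomorphisms over the identity. These are units because
they differ from `𝟙` by nilpotent elements. -/
lemma IsMinimal.iso [F.Full] {X Y : C} (hX : IsMinimal F X) (hY : IsMinimal F Y)
    (φ : F.obj X ≅ F.obj Y) : Nonempty (X ≅ Y) := by
  obtain ⟨f, hf⟩ := F.map_surjective φ.hom
  obtain ⟨g, hg⟩ := F.map_surjective φ.inv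
  have h1 : IsIso (f ≫ g) := hX.isIso_of_map_eq_id _ (by simp [hf, hg])
  have h2 : IsIso (g ≫ f) := hY.isIso_of_map_eq_id _ (by simp [hf, hg])
  have := isIso_of_isIso_comps f g h1 h2
  exact ⟨asIso f⟩


/-- If `U` is a retract killed by `F`, its identity is the sum of an endomorphism through `X` and
one through `Y`. Rotated to `X` and `Y`, both are killed by `F`, hence nilpotent. So the second is
at once nilpotent and a unit, which forces `U = 0`. -/
lemma IsMinimal.biprod {F : C ⥤ D} [F.Additive] {X Y : C} (b : BinaryBicone X Y)
    (hb : b.IsBilimit) (hX : IsMinimal F X) (hY : IsMinimal F Y) : IsMinimal F b.pt := by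
  rintro U ⟨r⟩ hU
  have h0 : ∀ f : U ⟶ U, F.map f = 0 := fun f => by
    rw [← Category.id_comp f, F.map_comp, hU, zero_comp]
  have hx : IsNilpotent (R := End U) ((r.i ≫ b.fst) ≫ (b.inl ≫ r.r)) := by
    refine isNilpotent_comp_comm _ _ (hX.isNilpotent _ ?_)
    rw [Category.assoc, ← Category.id_comp (r.i ≫ b.fst), F.map_comp, F.map_comp, F.map_comp, hU]
    simp
  have hy : IsNilpotent (R := End U) ((r.i ≫ b.snd) ≫ (b.inr ≫ r.r)) := by
    refine isNilpotent_comp_comm _ _ (hY.isNilpotent _ ?_)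
    rw [Category.assoc, ← Category.id_comp (r.i ≫ b.snd), F.map_comp, F.map_comp, F.map_comp, hU]
    simp
  have hs : (r.i ≫ b.fst) ≫ (b.inl ≫ r.r) + (r.i ≫ b.snd) ≫ (b.inr ≫ r.r) = 𝟙 U := by
    have : b.fst ≫ b.inl + b.snd ≫ b.inr = 𝟙 b.pt := IsBilimit.binary_total hb
    calc _ = r.i ≫ (b.fst ≫ b.inl + b.snd ≫ b.inr) ≫ r.r := by simp
      _ = 𝟙 U := by rw [this]; simp
  have hu := hx.isUnit_one_sub
  have e : (1 - (show End U from (r.i ≫ b.fst) ≫ (b.inl ≫ r.r)) : End U) =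
      (r.i ≫ b.snd) ≫ (b.inr ≫ r.r) := by
    exact sub_eq_of_eq_add' hs.symm
  rw [e] at hu
  rw [IsZero.iff_id_eq_zero]
  obtain ⟨n, hn⟩ := hy
  have := hu.pow n
  rw [hn] at this
  exact (isUnit_zero_iff.1 this).symm

/-- Indecomposability is transferred between objects with isomorphic images. -/
lemma IsIndec.transfer {C' : Type*} [Category C'] [Preadditive C'] [IsIdempotentComplete C']
    [HasDrazin C'] {F : C ⥤ D} [F.Additive] [F.Full] (F' : C' ⥤ D) [F'.Additive] {X : C} {Y : C'}
    (hX : IsIndec X) (hX' : F.map (𝟙 X) ≠ 0) (hY : IsMinimal F' Y) (φ : F.obj X ≅ F'.obj Y) :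
    IsIndec Y ∧ F'.map (𝟙 Y) ≠ 0 := by
  have hY' : F'.map (𝟙 Y) ≠ 0 := by
    intro h
    apply hX'
    rw [F.map_id, ← φ.hom_inv_id, ← Category.id_comp φ.inv, ← F'.map_id, h]
    simp
  refine ⟨isIndec_of_idem ?_ ?_, hY'⟩
  · intro h
    rw [IsZero.iff_id_eq_zero] at h
    exact hY' (by rw [h, F'.map_zero])
  · intro e he
    -- The lift `h` of the conjugate of `e` need not be idempotent, but it is nilpotent or a unit
    -- since `X` is indecomposable. As its image is idempotent, that image is `0` or the identity.
    -- Minimality of `Y` then carries the conclusion back to `e` or to `𝟙 Y - e`.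
    obtain ⟨h, hh⟩ := F.map_surjective (φ.hom ≫ F'.map e ≫ φ.inv)
    have hid : F.map h ≫ F.map h = F.map h := by
      rw [hh]
      simp only [Category.assoc, Iso.inv_hom_id_assoc]
      rw [← Category.assoc (F'.map e), ← F'.map_comp, he]
    have hFe : F'.map e = φ.inv ≫ F.map h ≫ φ.hom := by rw [hh]; simp
    rcases hX.nilpotent_or_isUnit h with hn | hu
    · left
      refine eq_zero_of_isNilpotent_idem (E := End Y) he (hY.isNilpotent e ?_)
      have : F.map h = 0 := by
        refine eq_zero_of_isNilpotent_idem (E := End (F.obj X)) hid ?_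
        obtain ⟨n, hn⟩ := hn
        refine ⟨n, ?_⟩
        have := map_pow (Functor.mapEnd X F) (show End X from h) n
        rw [hn] at this
        exact this.symm.trans (F.map_zero X X)
      rw [hFe, this]; simp
    · right
      have hi : IsIso h := (isUnit_iff_isIso h).1 hu
      have h1 : F.map h = 𝟙 _ := by
        rw [← cancel_mono (F.map h), hid, Category.id_comp]
      have h2 : F'.map (𝟙 Y - e) = 0 := by
        rw [F'.map_sub, hFe, h1]
        simp
      have h3 : (𝟙 Y - e) ≫ (𝟙 Y - e) = 𝟙 Y - e := by
        simp [he]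
      have := eq_zero_of_isNilpotent_idem (E := End Y) h3 (hY.isNilpotent _ h2)
      exact (sub_eq_zero.1 this).symm

end Minimal

/-! ### Bijections of isomorphism classes -/

section IsoClasses

variable {C : Type u₁} [Category.{u₂} C] {C' : Type u} [Category.{v} C']

lemma isoClasses_mk_eq_iff {P : ObjectProperty C} {X Y : C} (hX : P X) (hY : P Y) :
    IsoClasses.mk X hX = IsoClasses.mk Y hY ↔ Nonempty (X ≅ Y) := by
  refine (Quotient.eq (r := isIsomorphicSetoid P.FullSubcategory)).trans ?_
  constructor
  · rintro ⟨φ⟩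
    exact ⟨P.ι.mapIso φ⟩
  · rintro ⟨φ⟩
    exact ⟨P.isoMk φ⟩

lemma IsoClasses.exists_rep {P : ObjectProperty C} (a : IsoClasses P) :
    ∃ (X : C) (hX : P X), a = IsoClasses.mk X hX := by
  induction a using Quotient.inductionOn with
  | h X => exact ⟨X.obj, X.property, rfl⟩

/-- By `h3` the relation descends to a one-to-one relation between isomorphism classes, and `h1`,
`h2` make it total on both sides. The invariance `h4`, `h5` serves only to recover `R` for arbitrary
representatives, which is what uniqueness arguments compare with. -/
lemma exists_isoClasses_equiv {P : ObjectProperty C} {P' : ObjectProperty C'} (R : C → C' → Prop)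
    (h1 : ∀ X, P X → ∃ Y, P' Y ∧ R X Y) (h2 : ∀ Y, P' Y → ∃ X, P X ∧ R X Y)
    (h3 : ∀ X X' Y Y', P X → P X' → P' Y → P' Y' → R X Y → R X' Y' →
      (Nonempty (X ≅ X') ↔ Nonempty (Y ≅ Y')))
    (h4 : ∀ X X' Y, P X → P X' → P' Y → Nonempty (X ≅ X') → R X Y → R X' Y)
    (h5 : ∀ X Y Y', P X → P' Y → P' Y' → Nonempty (Y ≅ Y') → R X Y → R X Y') :
    ∃ e : IsoClasses P ≃ IsoClasses P', ∀ X Y (hX : P X) (hY : P' Y),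
      e (IsoClasses.mk X hX) = IsoClasses.mk Y hY ↔ R X Y := by
  let S : IsoClasses P → IsoClasses P' → Prop := fun a b =>
    ∃ X Y, ∃ (hX : P X) (hY : P' Y), a = IsoClasses.mk X hX ∧ b = IsoClasses.mk Y hY ∧ R X Y
  have s1 : ∀ a, ∃ b, S a b := by
    intro a
    obtain ⟨X, hX, rfl⟩ := a.exists_rep
    obtain ⟨Y, hY, hR⟩ := h1 X hX
    exact ⟨_, X, Y, hX, hY, rfl, rfl, hR⟩
  have s2 : ∀ b, ∃ a, S a b := by
    intro b
    obtain ⟨Y, hY, rfl⟩ := b.exists_rep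
    obtain ⟨X, hX, hR⟩ := h2 Y hY
    exact ⟨_, X, Y, hX, hY, rfl, rfl, hR⟩
  have s3 : ∀ a a' b b', S a b → S a' b' → (a = a' ↔ b = b') := by
    rintro _ _ _ _ ⟨X, Y, hX, hY, rfl, rfl, hR⟩ ⟨X', Y', hX', hY', rfl, rfl, hR'⟩
    rw [isoClasses_mk_eq_iff, isoClasses_mk_eq_iff]
    exact h3 X X' Y Y' hX hX' hY hY' hR hR'
  choose f hf using s1
  choose g hg using s2
  refine ⟨⟨f, g, fun a => ?_, fun b => ?_⟩, fun X Y hX hY => ?_⟩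
  · exact (s3 _ _ _ _ (hg (f a)) (hf a)).2 rfl
  · exact (s3 _ _ _ _ (hf (g b)) (hg b)).1 rfl
  · change f _ = _ ↔ _
    constructor
    · intro h
      have := hf (IsoClasses.mk X hX)
      rw [h] at this
      obtain ⟨X', Y', hX', hY', e1, e2, hR⟩ := this
      rw [isoClasses_mk_eq_iff] at e1 e2
      exact h4 X' X Y hX' hX hY ⟨e1.some.symm⟩ (h5 X' Y' Y hX' hY' hY ⟨e2.some.symm⟩ hR)
    · intro hR
      exact (s3 _ _ _ _ (hf _) ⟨X, Y, hX, hY, rfl, rfl, hR⟩).1 rfl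

end IsoClasses

end

end QuiverMono

namespace QuiverMono

noncomputable section

open scoped ZeroObject

/-! ### The split Grothendieck group -/

section SplitGrothendieck

variable {C : Type u₁} [Category.{u₂} C] [Preadditive C]

lemma cls_bicone {A B : C} (b : BinaryBicone A B) (hb : b.IsBilimit) :
    cls b.pt = cls A + cls B := by
  unfold cls
  rw [← QuotientAddGroup.mk_add, QuotientAddGroup.eq]
  have : FreeAbelianGroup.of b.pt - (FreeAbelianGroup.of A + FreeAbelianGroup.of B) ∈
      AddSubgroup.closure (splitRelations C) :=
    AddSubgroup.subset_closure ⟨A, B, b, ⟨hb⟩, rfl⟩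
  have h2 := AddSubgroup.neg_mem _ this
  rwa [neg_sub, sub_eq_add_neg, add_comm] at h2

lemma cls_biprod (A B : C) [HasBinaryBiproduct A B] : cls (A ⊞ B) = cls A + cls B :=
  cls_bicone (BinaryBiproduct.bicone A B) (BinaryBiproduct.isBilimit A B)

/-- A zero object is the direct sum of two copies of itself, so its class equals twice itself. -/
lemma cls_zero {Z : C} (hZ : IsZero Z) : cls Z = 0 := by
  have h := cls_bicone (A := Z) (B := Z) ⟨Z, 𝟙 Z, 𝟙 Z, 𝟙 Z, 𝟙 Z, by simp, hZ.eq_of_src _ _,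
    hZ.eq_of_src _ _, by simp⟩ (isBinaryBilimitOfTotal _ (hZ.eq_of_src _ _))
  simpa using h

lemma cls_iso [HasZeroObject C] {X Y : C} (φ : X ≅ Y) : cls X = cls Y := by
  have h := cls_bicone (A := Y) (B := (0 : C)) ⟨X, φ.hom, 0, φ.inv, 0, by simp, by simp,
    by simp, (isZero_zero C).eq_of_src _ _⟩ (isBinaryBilimitOfTotal _ (by simp))
  rwa [cls_zero (isZero_zero C), add_zero] at h

lemma cls_hom_ext {A : Type*} [AddCommGroup A] {f g : SplitK₀ C →+ A}
    (h : ∀ X : C, f (cls X) = g (cls X)) : f = g :=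
  QuotientAddGroup.addMonoidHom_ext _ (FreeAbelianGroup.lift_ext _ _ fun X => h X)

lemma exists_cls_lift {A : Type*} [AddCommGroup A] (f : C → A)
    (hf : ∀ (X Y : C) (b : BinaryBicone X Y), b.IsBilimit → f b.pt = f X + f Y) :
    ∃ T : SplitK₀ C →+ A, ∀ X, T (cls X) = f X := by
  refine ⟨QuotientAddGroup.lift _ (FreeAbelianGroup.lift f) ?_, fun X => ?_⟩
  · rw [AddSubgroup.closure_le]
    rintro _ ⟨X, Y, b, ⟨hb⟩, rfl⟩
    simp [hf X Y b hb]
  · exact (QuotientAddGroup.lift_mk _ _ _).trans (FreeAbelianGroup.lift_apply_of f X)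

end SplitGrothendieck

/-! ### The Krull-Schmidt theorem -/

section KrullSchmidt

variable (C : Type u₁) [Category.{u₂} C] [Preadditive C]

/-- There is an additive length function on the objects, which only vanishes at zero objects. -/
class HasSize : Prop where
  exists_size : ∃ l : C → ℕ, (∀ X, l X = 0 → IsZero X) ∧
    ∀ A B (b : BinaryBicone A B) X, b.IsBilimit → Nonempty (X ≅ b.pt) → l X = l A + l B

/-- The indecomposable objects. -/
def indecProp : ObjectProperty C := fun X => IsIndec X

variable {C}

/-- The isomorphism class of an indecomposable object. -/
def indecClass (X : C) (hX : IsIndec X) : IsoClasses (indecProp C) :=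
  IsoClasses.mk (P := indecProp C) X hX

lemma indecClass_eq_iff {X Y : C} (hX : IsIndec X) (hY : IsIndec Y) :
    indecClass X hX = indecClass Y hY ↔ Nonempty (X ≅ Y) :=
  isoClasses_mk_eq_iff (P := indecProp C) hX hY

/-- `M` is the direct sum of indecomposable objects with the given isomorphism classes. -/
inductive Decomp : C → Multiset (IsoClasses (indecProp C)) → Prop
  | zero (M : C) (hM : IsZero M) : Decomp M 0
  | cons (M X A : C) (s : Multiset (IsoClasses (indecProp C))) (b : BinaryBicone X A)
      (hb : b.IsBilimit) (φ : M ≅ b.pt) (hX : IsIndec X) (hA : Decomp A s) :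
      Decomp M (indecClass X hX ::ₘ s)

lemma Decomp.of_iso {M N : C} {s : Multiset (IsoClasses (indecProp C))} (h : Decomp M s)
    (φ : M ≅ N) : Decomp N s := by
  cases h with
  | zero _ hM => exact .zero N (hM.of_iso φ.symm)
  | cons _ X A s b hb ψ hX hA => exact .cons N X A s b hb (φ.symm ≪≫ ψ) hX hA

variable [HasBinaryBiproducts C]

/-- A bilimit bicone is isomorphic to the chosen biproduct. -/
def biconeIso {A B : C} (b : BinaryBicone A B) (hb : b.IsBilimit) : b.pt ≅ A ⊞ B :=
  biprod.uniqueUpToIso A B hb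

lemma Decomp.cons' {M X A : C} {s : Multiset (IsoClasses (indecProp C))} (φ : M ≅ X ⊞ A)
    (hX : IsIndec X) (hA : Decomp A s) : Decomp M (indecClass X hX ::ₘ s) :=
  .cons M X A s (BinaryBiproduct.bicone X A) (BinaryBiproduct.isBilimit X A) φ hX hA

/-- Induction over direct sums of indecomposable objects. -/
lemma indec_induction [HasSize C] {P : C → Prop} (hiso : ∀ X Y : C, (X ≅ Y) → P X → P Y)
    (hzero : ∀ Z : C, IsZero Z → P Z) (hindec : ∀ X : C, IsIndec X → P X)
    (hadd : ∀ X Y : C, P X → P Y → P (X ⊞ Y)) (X : C) : P X := by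
  obtain ⟨l, h1, h2⟩ := HasSize.exists_size (C := C)
  induction hn : l X using Nat.strong_induction_on generalizing X with
  | _ n ih =>
    by_cases hz : IsZero X
    · exact hzero X hz
    by_cases hi : IsIndec X
    · exact hindec X hi
    have : ∃ Y Z : C, ∃ b : BinaryBicone Y Z, Nonempty b.IsBilimit ∧ Nonempty (X ≅ b.pt) ∧
        ¬ IsZero Y ∧ ¬ IsZero Z := by
      by_contra hcon
      refine hi ⟨hz, fun Y Z b hb hφ => ?_⟩
      by_contra h
      rw [not_or] at h
      exact hcon ⟨Y, Z, b, hb, hφ, h.1, h.2⟩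
    obtain ⟨Y, Z, b, ⟨hb⟩, ⟨φ⟩, hY, hZ⟩ := this
    have hl := h2 Y Z b X hb ⟨φ⟩
    have hY' : l Y ≠ 0 := fun h => hY (h1 _ h)
    have hZ' : l Z ≠ 0 := fun h => hZ (h1 _ h)
    exact hiso _ _ (φ ≪≫ biconeIso b hb).symm
      (hadd Y Z (ih (l Y) (by omega) Y rfl) (ih (l Z) (by omega) Z rfl))

lemma Decomp.add {M N : C} {s t : Multiset (IsoClasses (indecProp C))} (hM : Decomp M s)
    (hN : Decomp N t) : Decomp (M ⊞ N) (s + t) := by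
  induction hM with
  | zero M hM =>
    rw [zero_add]
    refine hN.of_iso ⟨biprod.inr, biprod.snd, by simp, ?_⟩
    rw [← biprod.total, hM.eq_of_tgt (biprod.fst : M ⊞ N ⟶ M) 0]
    simp
  | cons M X A s b hb φ hX hA ih =>
    rw [Multiset.cons_add]
    exact Decomp.cons' (biprod.mapIso (φ ≪≫ biconeIso b hb) (Iso.refl N) ≪≫
      biprod.associator X A N) hX ih

lemma exists_decomp [HasZeroObject C] [HasSize C] (M : C) : ∃ s, Decomp M s := by
  refine indec_induction (P := fun M : C => ∃ s, Decomp M s) ?_ ?_ ?_ ?_ M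
  · rintro X Y φ ⟨s, hs⟩
    exact ⟨s, hs.of_iso φ⟩
  · exact fun Z hZ => ⟨0, .zero Z hZ⟩
  · intro X hX
    refine ⟨_, Decomp.cons' (A := (0 : C)) ⟨biprod.inl, biprod.fst, by simp, ?_⟩ hX
      (.zero _ (isZero_zero C))⟩
    rw [← biprod.total, (isZero_zero C).eq_of_tgt (biprod.snd : X ⊞ (0 : C) ⟶ 0) 0]
    simp
  · rintro X Y ⟨s, hs⟩ ⟨t, ht⟩
    exact ⟨_, hs.add ht⟩

/-- Gaussian elimination: an invertible entry of the matrix of `φ` can be split off. -/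
lemma biprod_cancel {X A Y B : C} (φ : X ⊞ A ≅ Y ⊞ B)
    (h : IsIso (biprod.inl ≫ φ.hom ≫ biprod.fst)) : Nonempty (A ≅ B) :=
  ⟨Biprod.isoElim φ⟩

/-- Write `M ≅ X ⊞ A ≅ Y ⊞ B` with `Y` the head of the decomposition. The identity of `X` is a sum
of an endomorphism through `Y` and one through `B`; as `End X` is local, one of them is invertible.
In the first case `X ≅ Y`, and cancellation gives `A ≅ B`. In the second `B ≅ X ⊞ B'`, induction
applies to `B`, and `A ≅ Y ⊞ B'`. -/
lemma Decomp.exchange [IsIdempotentComplete C] [HasDrazin C] {M X A : C}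
    {s : Multiset (IsoClasses (indecProp C))} (hM : Decomp M s) (hX : IsIndec X)
    (φ : M ≅ X ⊞ A) : ∃ t, s = indecClass X hX ::ₘ t ∧ Decomp A t := by
  induction hM generalizing A with
  | zero M hM =>
    exfalso
    apply hX.1
    rw [IsZero.iff_id_eq_zero]
    have : (biprod.inl ≫ φ.inv) ≫ (φ.hom ≫ biprod.fst) = 𝟙 X := by simp
    rw [← this, hM.eq_of_src (φ.hom ≫ biprod.fst) 0, comp_zero]
  | cons M Y B t b hb ψ hY hB ih =>
    let χ : X ⊞ A ≅ Y ⊞ B := φ.symm ≪≫ ψ ≪≫ biconeIso b hb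
    have hsum : (biprod.inl ≫ χ.hom ≫ biprod.fst) ≫ (biprod.inl ≫ χ.inv ≫ biprod.fst) +
        (biprod.inl ≫ χ.hom ≫ biprod.snd) ≫ (biprod.inr ≫ χ.inv ≫ biprod.fst) = 𝟙 X := by
      calc _ = biprod.inl ≫ χ.hom ≫ (biprod.fst ≫ biprod.inl + biprod.snd ≫ biprod.inr) ≫
            χ.inv ≫ biprod.fst := by simp only [Preadditive.add_comp, Preadditive.comp_add,
              Category.assoc]
        _ = 𝟙 X := by simp
    rcases hX.isIso_or_isIso_of_add _ _ hsum with h | h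
    · let r : Retract X Y := ⟨biprod.inl ≫ χ.hom ≫ biprod.fst,
        (biprod.inl ≫ χ.inv ≫ biprod.fst) ≫ inv ((biprod.inl ≫ χ.hom ≫ biprod.fst) ≫
          (biprod.inl ≫ χ.inv ≫ biprod.fst)), by rw [← Category.assoc, IsIso.hom_inv_id]⟩
      have hr : IsIso r.i := (hY.retract_isZero_or_isIso r).resolve_left hX.1
      have e : indecClass X hX = indecClass Y hY :=
        (indecClass_eq_iff _ _).2 ⟨asIso r.i⟩
      exact ⟨t, by rw [e], hB.of_iso (biprod_cancel χ hr).some.symm⟩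
    · let r : Retract X B := ⟨biprod.inl ≫ χ.hom ≫ biprod.snd,
        (biprod.inr ≫ χ.inv ≫ biprod.fst) ≫ inv ((biprod.inl ≫ χ.hom ≫ biprod.snd) ≫
          (biprod.inr ≫ χ.inv ≫ biprod.fst)), by rw [← Category.assoc, IsIso.hom_inv_id]⟩
      obtain ⟨B', r', hr'⟩ := exists_complement r
      let β : B ≅ X ⊞ B' := biconeIso (bicone_of_retracts r r' hr') (isBinaryBilimitOfTotal _ hr')
      obtain ⟨t', rfl, ht'⟩ := ih β
      have hβ : β.hom ≫ biprod.fst = r.r := by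
        have : β.hom = biprod.lift r.r r'.r := rfl
        rw [this, biprod.lift_fst]
      refine ⟨indecClass Y hY ::ₘ t', Multiset.cons_swap _ _ _, ?_⟩
      -- This reordering brings `X` to the front, so that the `X`-entry of `χ ≪≫ ω` is the identity
      -- and can be cancelled.
      let ω : Y ⊞ B ≅ X ⊞ (Y ⊞ B') := biprod.mapIso (Iso.refl Y) β ≪≫
        (biprod.associator Y X B').symm ≪≫ biprod.mapIso (biprod.braiding Y X) (Iso.refl B') ≪≫
        biprod.associator X Y B'
      have hω : ω.hom ≫ biprod.fst = biprod.snd ≫ r.r := by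
        rw [← hβ]
        simp [ω]
      have hi : IsIso (biprod.inl ≫ (χ ≪≫ ω).hom ≫ biprod.fst) := by
        have : biprod.inl ≫ (χ ≪≫ ω).hom ≫ biprod.fst = 𝟙 X := by
          rw [Iso.trans_hom, Category.assoc, hω, ← r.retract]
          simp [r]
        rw [this]
        infer_instance
      exact Decomp.cons' (biprod_cancel (χ ≪≫ ω) hi).some hY ht'

lemma Decomp.unique [IsIdempotentComplete C] [HasDrazin C] {M : C}
    {s t : Multiset (IsoClasses (indecProp C))} (hs : Decomp M s) (ht : Decomp M t) : s = t := by
  induction hs generalizing t with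
  | zero M hM =>
    cases ht with
    | zero => rfl
    | cons _ Y B t b hb ψ hY hB =>
      exfalso
      obtain ⟨u, hu, -⟩ := (Decomp.zero M hM).exchange hY (ψ ≪≫ biconeIso b hb)
      exact Multiset.cons_ne_zero hu.symm
  | cons M Y B s b hb ψ hY hB ih =>
    obtain ⟨u, rfl, hu⟩ := ht.exchange hY (ψ ≪≫ biconeIso b hb)
    rw [ih hu]

/-- Functions on the isomorphism classes of indecomposable objects extend to the split
Grothendieck group. -/
lemma exists_lift_of_indec [HasZeroObject C] [IsIdempotentComplete C] [HasDrazin C] [HasSize C]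
    {A : Type*} [AddCommGroup A] (f : IsoClasses (indecProp C) → A) :
    ∃ T : SplitK₀ C →+ A, ∀ (X : C) (hX : IsIndec X), T (cls X) = f (indecClass X hX) := by
  choose d hd using exists_decomp (C := C)
  obtain ⟨T, hT⟩ := exists_cls_lift (C := C) (fun X => ((d X).map f).sum) (by
    intro X Y b hb
    rw [(hd b.pt).unique (((hd X).add (hd Y)).of_iso (biconeIso b hb).symm), Multiset.map_add,
      Multiset.sum_add])
  refine ⟨T, fun X hX => ?_⟩
  have h : Decomp X (indecClass X hX ::ₘ 0) :=
    Decomp.cons' (A := (0 : C)) ⟨biprod.inl, biprod.fst, by simp, by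
      rw [← biprod.total, (isZero_zero C).eq_of_tgt (biprod.snd : X ⊞ (0 : C) ⟶ 0) 0]; simp⟩ hX
      (.zero _ (isZero_zero C))
  rw [hT, (hd X).unique h]
  simp

lemma cls_hom_ext_indec [HasZeroObject C] [HasSize C] {A : Type*} [AddCommGroup A]
    {f g : SplitK₀ C →+ A} (h : ∀ X : C, IsIndec X → f (cls X) = g (cls X)) : f = g := by
  refine cls_hom_ext fun X => ?_
  refine indec_induction (P := fun X : C => f (cls X) = g (cls X)) ?_ ?_ h ?_ X
  · intro X Y φ hX
    rwa [← cls_iso φ]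
  · intro Z hZ
    simp [cls_zero hZ]
  · intro X Y hX hY
    rw [cls_biprod, map_add, map_add, hX, hY]

/-- The multiplicity of an indecomposable object as an additive function. -/
lemma exists_multiplicity [HasZeroObject C] [IsIdempotentComplete C] [HasDrazin C] [HasSize C]
    {X : C} (hX : IsIndec X) : ∃ T : SplitK₀ C →+ ℤ, T (cls X) = 1 ∧
      ∀ Y : C, IsIndec Y → T (cls Y) ≠ 0 → Nonempty (X ≅ Y) := by
  classical
  obtain ⟨T, hT⟩ := exists_lift_of_indec (C := C)
    (fun a => if a = indecClass X hX then (1 : ℤ) else 0)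
  refine ⟨T, by simp [hT X hX], fun Y hY h => ?_⟩
  rw [hT Y hY] at h
  have := (indecClass_eq_iff _ _).1 (of_not_not fun h' => h (if_neg h'))
  exact ⟨this.some.symm⟩

/-- The multiplicity of `X` takes the value `n ≠ 0` on the left, so it cannot vanish on `cls Y`. -/
lemma IsIndec.iso_of_cls_eq [HasZeroObject C] [IsIdempotentComplete C] [HasDrazin C] [HasSize C]
    {X Y : C} (hX : IsIndec X) (hY : IsIndec Y) {n m : ℕ} (hn : n ≠ 0)
    (h : n • cls X = m • cls Y) : Nonempty (X ≅ Y) := by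
  obtain ⟨T, h1, h2⟩ := exists_multiplicity hX
  refine h2 Y hY fun h0 => hn ?_
  have := congrArg T h
  rw [map_nsmul, map_nsmul, h1, h0] at this
  simpa using this

end KrullSchmidt

end

end QuiverMono

namespace QuiverMono

noncomputable section

/-! ### Essential extensions and injective modules -/

section Essential

variable {A : Type*} [Ring A] {M N : Type*} [AddCommGroup M] [Module A M] [AddCommGroup N]
  [Module A N]

/-- Every submodule of `E` that meets `N` trivially is trivial. -/
def IsEssentialIn (N E : Submodule A M) : Prop :=
  ∀ L : Submodule A M, L ≤ E → L ⊓ N = ⊥ → L = ⊥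

lemma exists_maximal_essential (N : Submodule A M) :
    ∃ E : Submodule A M, N ≤ E ∧ IsEssentialIn N E ∧
      ∀ E' : Submodule A M, E ≤ E' → IsEssentialIn N E' → E' = E := by
  obtain ⟨E, hNE, hE⟩ := zorn_le_nonempty₀ {E : Submodule A M | N ≤ E ∧ IsEssentialIn N E} (by
    intro c hc hchain y hy
    refine ⟨sSup c, ⟨(hc hy).1.trans (le_sSup hy), ?_⟩, fun z hz => le_sSup hz⟩
    intro L hL hLN
    rw [Submodule.eq_bot_iff]
    intro x hx
    obtain ⟨E, hE, hxE⟩ := (Submodule.mem_sSup_of_directed ⟨y, hy⟩ hchain.directedOn).1 (hL hx)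
    -- Essentiality of the union is tested on cyclic submodules, each of which lies in one member of
    -- the chain.
    have := (hc hE).2 (Submodule.span A {x}) (by simpa using hxE) (by
      rw [eq_bot_iff, ← hLN]
      exact inf_le_inf_right _ (by simpa using hx))
    simpa using this) N ⟨le_rfl, fun L hL h => by rwa [inf_eq_left.2 hL] at h⟩
  exact ⟨E, hE.prop.1, hE.prop.2, fun E' hE' h => (hE.eq_of_le ⟨hNE.trans hE', h⟩ hE').symm⟩

lemma exists_maximal_disjoint (E : Submodule A M) :
    ∃ C : Submodule A M, C ⊓ E = ⊥ ∧ ∀ C' : Submodule A M, C ≤ C' → C' ⊓ E = ⊥ → C' = C := by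
  obtain ⟨C, -, hC⟩ := zorn_le_nonempty₀ {C : Submodule A M | C ⊓ E = ⊥} (by
    intro c hc hchain y hy
    refine ⟨sSup c, ?_, fun z hz => le_sSup hz⟩
    change sSup c ⊓ E = ⊥
    rw [Submodule.eq_bot_iff]
    rintro x ⟨hx, hxE⟩
    obtain ⟨C, hC, hxC⟩ := (Submodule.mem_sSup_of_directed ⟨y, hy⟩ hchain.directedOn).1 hx
    have : x ∈ C ⊓ E := ⟨hxC, hxE⟩
    rw [show C ⊓ E = ⊥ from hc hC] at this
    simpa using this) ⊥ (by simp)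
  exact ⟨C, hC.prop, fun C' h1 h2 => (hC.eq_of_le h2 h1).symm⟩

lemma baer_of_isCompl (hM : Module.Baer A M) {E C : Submodule A M} (h : IsCompl E C) :
    Module.Baer A E := by
  intro I g
  obtain ⟨g', hg'⟩ := hM I (E.subtype ∘ₗ g)
  refine ⟨E.projectionOnto C h ∘ₗ g', fun x hx => ?_⟩
  rw [LinearMap.comp_apply, hg' x hx]
  simp

/-- A maximal essential extension inside an injective module is injective. -/
lemma baer_of_maximal_essential (hM : Module.Baer A M) {N E : Submodule A M}
    (hNE : N ≤ E) (hE : IsEssentialIn N E)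
    (hmax : ∀ E' : Submodule A M, E ≤ E' → IsEssentialIn N E' → E' = E) : Module.Baer A E := by
  -- Maximality of `C` makes `E` essential in `M ⧸ C`. The inclusion of `E` extends to a map `g`
  -- from `M ⧸ C` to the injective module `M`. It is injective by essentiality, and its range is an
  -- essential extension of `N`, hence equal to `E`. Thus `M` is the direct sum of `E` and `C`, and
  -- `E` inherits injectivity.
  obtain ⟨C, hC, hCmax⟩ := exists_maximal_disjoint E
  have hinj : Function.Injective (C.mkQ ∘ₗ E.subtype) := by
    rw [← LinearMap.ker_eq_bot, Submodule.eq_bot_iff]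
    intro x hx
    have : (x : M) ∈ C ⊓ E := ⟨by simpa using hx, x.2⟩
    rw [hC] at this
    simpa using this
  obtain ⟨g, hg⟩ := hM.extension_property _ hinj E.subtype
  have hg' : ∀ x ∈ E, g (C.mkQ x) = x := fun x hx => LinearMap.congr_fun hg ⟨x, hx⟩
  have hess : ∀ L : Submodule A (M ⧸ C), (∀ x ∈ E, C.mkQ x ∈ L → x = 0) → L = ⊥ := by
    intro L hL
    have h1 := hCmax (L.comap C.mkQ) (Submodule.le_comap_mkQ C L) (by
      rw [Submodule.eq_bot_iff]
      rintro x ⟨hx, hxE⟩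
      exact hL x hxE hx)
    rw [Submodule.eq_bot_iff]
    intro y hy
    obtain ⟨x, rfl⟩ := C.mkQ_surjective y
    have : x ∈ L.comap C.mkQ := hy
    rw [h1] at this
    simpa using this
  have hgker : LinearMap.ker g = ⊥ := hess _ fun x hx h => by
    rw [LinearMap.mem_ker, hg' x hx] at h
    exact h
  have hrange : LinearMap.range g = E := by
    refine hmax _ (fun x hx => ⟨C.mkQ x, hg' x hx⟩) ?_
    intro L hL hLN
    have hLE : L ⊓ E = ⊥ := hE _ inf_le_right (by
      rw [inf_assoc, inf_eq_right.2 hNE, hLN])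
    have h1 : L.comap g = ⊥ := hess _ fun x hx h => by
      have : x ∈ L ⊓ E := ⟨by rw [← hg' x hx]; exact h, hx⟩
      rw [hLE] at this
      simpa using this
    rw [← inf_eq_left.2 hL, inf_comm, ← Submodule.map_comap_eq, h1, Submodule.map_bot]
  refine baer_of_isCompl hM (C := C) ⟨disjoint_iff.2 (by rw [inf_comm, hC]), ?_⟩
  rw [codisjoint_iff, eq_top_iff]
  intro x _
  have hy : g (C.mkQ x) ∈ E := hrange ▸ LinearMap.mem_range_self g _
  have : C.mkQ x = C.mkQ (g (C.mkQ x)) := by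
    apply LinearMap.ker_eq_bot.1 hgker
    rw [hg' _ hy]
  have h2 : x - g (C.mkQ x) ∈ C := by
    rw [← Submodule.Quotient.mk_eq_zero C, Submodule.Quotient.mk_sub, sub_eq_zero]
    exact this
  rw [← add_sub_cancel (g (C.mkQ x)) x]
  exact Submodule.add_mem_sup hy h2

/-- A nonzero map from a simple module to `E` has simple image, which meets `P` and therefore lies
in it. So the maps into `E` embed into the `K`-linear maps from `V` to `P`, and both `V` and `P` are
finite over `K`. -/
lemma isNoetherian_hom_of_simple (K : Type*) [CommRing K] [IsNoetherianRing K] [Algebra K A]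
    [Module.Finite K A] [Module K M] [IsScalarTower K A M] {P E : Submodule A M}
    (hE : IsEssentialIn P E) [Module.Finite A P] {V : Type*} [AddCommGroup V] [Module A V]
    [Module K V] [IsScalarTower K A V] [IsSimpleModule A V] : IsNoetherian K (V →ₗ[A] E) := by
  have hle : ∀ f : V →ₗ[A] E, ∀ x, (f x : M) ∈ P := by
    intro f x
    by_cases hf : f = 0
    · simp [hf]
    have hinj : Function.Injective f := LinearMap.injective_of_ne_zero hf
    have hS : IsSimpleModule A (LinearMap.range (E.subtype ∘ₗ f)) :=
      IsSimpleModule.congr (LinearEquiv.ofInjective (E.subtype ∘ₗ f)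
        (Subtype.val_injective.comp hinj)).symm
    have hat := isSimpleModule_iff_isAtom.1 hS
    have h1 : LinearMap.range (E.subtype ∘ₗ f) ⊓ P ≠ ⊥ := fun h => hat.1 (hE _ (by
      rintro _ ⟨y, rfl⟩
      exact (f y).2) h)
    have h2 : LinearMap.range (E.subtype ∘ₗ f) ⊓ P = LinearMap.range (E.subtype ∘ₗ f) :=
      (hat.le_iff.1 inf_le_left).resolve_left h1
    exact (inf_eq_left.1 h2) ⟨x, rfl⟩
  have : Module.Finite K P := Module.Finite.trans A P
  have : Module.Finite K V := Module.Finite.trans A V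
  have hnoeth : IsNoetherian K (V →ₗ[K] P) := inferInstance
  let F : (V →ₗ[A] E) →ₗ[K] (V →ₗ[K] P) :=
    { toFun := fun f => (LinearMap.codRestrict P (E.subtype ∘ₗ f) (hle f)).restrictScalars K
      map_add' := fun f g => by ext x; rfl
      map_smul' := fun c f => by ext x; rfl }
  refine isNoetherian_of_injective F ?_
  intro f g h
  ext x
  exact congrArg (fun t : V →ₗ[K] P => (t x : M)) h

/-- Induction along a composition series of `V`, using left exactness of `Hom(-, E)`. -/
lemma isNoetherian_hom_of_isFiniteLength (K : Type*) [CommRing K] [IsNoetherianRing K]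
    [Algebra K A] [Module.Finite K A] [Module K M] [IsScalarTower K A M] {P E : Submodule A M}
    (hE : IsEssentialIn P E) [Module.Finite A P] {V : Type*} [AddCommGroup V] [Module A V]
    (hV : IsFiniteLength A V) :
    ∀ [Module K V] [IsScalarTower K A V], IsNoetherian K (V →ₗ[A] E) := by
  induction hV with
  | @of_subsingleton V =>
    intro _ _
    have : Subsingleton (V →ₗ[A] E) := ⟨fun f g => by
      ext x; rw [Subsingleton.elim x 0, map_zero, map_zero]⟩
    infer_instance
  | @of_simple_quotient V _ _ W hs hW ih =>
    intro _ _
    have hW' : IsNoetherian K (W →ₗ[A] E) := ih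
    have hQ : IsNoetherian K ((V ⧸ W) →ₗ[A] E) := isNoetherian_hom_of_simple K hE
    let r : (V →ₗ[A] E) →ₗ[K] (W →ₗ[A] E) := LinearMap.lcomp K E W.subtype
    let q : ((V ⧸ W) →ₗ[A] E) →ₗ[K] (V →ₗ[A] E) := LinearMap.lcomp K E W.mkQ
    refine isNoetherian_of_range_eq_ker q r (le_antisymm ?_ ?_)
    · rintro _ ⟨f, rfl⟩
      rw [LinearMap.mem_ker]
      refine LinearMap.ext fun x => ?_
      change f (Submodule.Quotient.mk (x : V)) = 0
      rw [(Submodule.Quotient.mk_eq_zero W).2 x.2, map_zero]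
    · intro f hf
      refine ⟨W.liftQ f fun x hx => ?_, ?_⟩
      · exact LinearMap.congr_fun hf ⟨x, hx⟩
      · exact LinearMap.ext fun x => rfl

/-- Over a finite algebra over an artinian commutative ring, essential extensions of finitely
generated modules are finitely generated. -/
lemma finite_of_essential (K : Type*) [CommRing K] [IsArtinianRing K] [Algebra K A]
    [Module.Finite K A] {P E : Submodule A M} (hE : IsEssentialIn P E)
    [Module.Finite A P] : Module.Finite A E := by
  let _ : Module K M := Module.compHom M (algebraMap K A)
  have : IsScalarTower K A M := ⟨fun x y z => by
    rw [Algebra.smul_def, mul_smul]; rfl⟩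
  have hArt : IsArtinianRing A := IsArtinianRing.of_finite K A
  have hA : IsFiniteLength A A :=
    isFiniteLength_iff_isNoetherian_isArtinian.2 ⟨inferInstance, inferInstance⟩
  -- The ring `A` has finite length over itself, and `E` is the module of maps from `A` to `E`.
  have h1 : IsNoetherian K (A →ₗ[A] E) := isNoetherian_hom_of_isFiniteLength K hE hA
  have h2 : IsNoetherian K E := isNoetherian_of_linearEquiv (LinearMap.ringLmapEquivSelf A K E)
  exact Module.Finite.of_restrictScalars_finite K A E

end Essential

/-! ### The socle -/

section Socle

variable {A : Type*} [Ring A] {M N : Type*} [AddCommGroup M] [Module A M] [AddCommGroup N]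
  [Module A N]

lemma le_socle (S : Submodule A M) [IsSimpleModule A S] : S ≤ socle A M :=
  le_sSup ‹_›

lemma range_le_socle (f : N →ₗ[A] M) [IsSimpleModule A N] : LinearMap.range f ≤ socle A M := by
  by_cases hf : f = 0
  · simp [hf]
  · have : IsSimpleModule A (LinearMap.range f) :=
      IsSimpleModule.congr (LinearEquiv.ofInjective f (LinearMap.injective_of_ne_zero hf)).symm
    exact le_socle _

lemma map_socle_le (f : M →ₗ[A] N) : (socle A M).map f ≤ socle A N := by
  rw [Submodule.map_le_iff_le_comap]
  refine sSup_le fun S hS => ?_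
  have : IsSimpleModule A S := hS
  intro x hx
  exact range_le_socle (f ∘ₗ S.subtype) ⟨⟨x, hx⟩, rfl⟩

instance : IsSemisimpleModule A (socle A M) := by
  unfold socle
  rw [sSup_eq_iSup]
  exact isSemisimpleModule_biSup_of_isSemisimpleModule_submodule fun S hS => by
    have : IsSimpleModule A S := hS
    infer_instance

lemma exists_simple_le [IsArtinian A M] {L : Submodule A M} (hL : L ≠ ⊥) :
    ∃ S ≤ L, IsSimpleModule A S := by
  obtain ⟨S, hS, hle⟩ := (IsAtomic.eq_bot_or_exists_atom_le L).resolve_left hL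
  exact ⟨S, hle, isSimpleModule_iff_isAtom.2 hS⟩

/-- A nonzero kernel would contain a simple submodule, and this lies in the socle. -/
lemma injective_of_socle [IsArtinian A M] (f : M →ₗ[A] N)
    (h : ∀ x ∈ socle A M, f x = 0 → x = 0) : Function.Injective f := by
  rw [← LinearMap.ker_eq_bot]
  by_contra hne
  obtain ⟨S, hS, hsimple⟩ := exists_simple_le hne
  refine (isSimpleModule_iff_isAtom.1 hsimple).1 ?_
  rw [Submodule.eq_bot_iff]
  exact fun x hx => h x (le_socle S hx) (hS hx)

lemma socle_eq_top [IsSemisimpleModule A M] : socle A M = ⊤ :=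
  IsSemisimpleModule.sSup_simples_eq_top A M

lemma range_le_socle_of_semisimple (f : N →ₗ[A] M) [IsSemisimpleModule A N] :
    LinearMap.range f ≤ socle A M := by
  rw [LinearMap.range_eq_map, ← socle_eq_top (A := A)]
  exact map_socle_le f

/-- Linear equivalences identify socles. -/
def socleEquiv (e : M ≃ₗ[A] N) : socle A M ≃ₗ[A] socle A N :=
  LinearEquiv.ofLinearMap
    ((e.toLinearMap ∘ₗ (socle A M).subtype).codRestrict _ fun x =>
      map_socle_le e.toLinearMap ⟨x, x.2, rfl⟩)
    ((e.symm.toLinearMap ∘ₗ (socle A N).subtype).codRestrict _ fun x =>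
      map_socle_le e.symm.toLinearMap ⟨x, x.2, rfl⟩)
    (by ext x; simp) (by ext x; simp)

/-- The socle of a direct sum. -/
def socleProdEquiv : socle A (M × N) ≃ₗ[A] socle A M × socle A N :=
  LinearEquiv.ofLinearMap
    (((LinearMap.fst A M N ∘ₗ (socle A (M × N)).subtype).codRestrict _ fun x =>
      map_socle_le (LinearMap.fst A M N) ⟨x, x.2, rfl⟩).prod
      ((LinearMap.snd A M N ∘ₗ (socle A (M × N)).subtype).codRestrict _ fun x =>
      map_socle_le (LinearMap.snd A M N) ⟨x, x.2, rfl⟩))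
    (((LinearMap.inl A M N ∘ₗ (socle A M).subtype).codRestrict _ fun x =>
      map_socle_le (LinearMap.inl A M N) ⟨x, x.2, rfl⟩).coprod
      ((LinearMap.inr A M N ∘ₗ (socle A N).subtype).codRestrict _ fun x =>
      map_socle_le (LinearMap.inr A M N) ⟨x, x.2, rfl⟩))
    (by ext x <;> simp) (by ext x <;> simp)

/-- Injective modules of finite length with isomorphic socles are isomorphic. -/
lemma nonempty_equiv_of_socle [IsArtinian A M] [IsArtinian A N] (hM : Module.Baer A M)
    (hN : Module.Baer A N) (e : socle A M ≃ₗ[A] socle A N) : Nonempty (M ≃ₗ[A] N) := by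
  -- Extensions of `e` and `e.symm` need not be inverse to each other, but both are injective
  -- because they are so on socles. An injective endomorphism of an artinian module is onto, so `f`
  -- is onto.
  obtain ⟨f, hf⟩ := hN.extension_property (socle A M).subtype Subtype.val_injective
    ((socle A N).subtype ∘ₗ e.toLinearMap)
  obtain ⟨g, hg⟩ := hM.extension_property (socle A N).subtype Subtype.val_injective
    ((socle A M).subtype ∘ₗ e.symm.toLinearMap)
  have hf' : Function.Injective f := injective_of_socle f fun x hx h => by
    have := LinearMap.congr_fun hf ⟨x, hx⟩
    simp only [LinearMap.comp_apply, Submodule.subtype_apply] at this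
    rw [h] at this
    simpa using this.symm
  have hg' : Function.Injective g := injective_of_socle g fun x hx h => by
    have := LinearMap.congr_fun hg ⟨x, hx⟩
    simp only [LinearMap.comp_apply, Submodule.subtype_apply] at this
    rw [h] at this
    simpa using this.symm
  have h1 := IsArtinian.surjective_of_injective_endomorphism (f ∘ₗ g) (hf'.comp hg')
  exact ⟨LinearEquiv.ofBijective f ⟨hf', fun y => by
    obtain ⟨x, hx⟩ := h1 y
    exact ⟨g x, hx⟩⟩⟩

end Socle

end

end QuiverMono

namespace QuiverMono

noncomputable section

set_option linter.unusedSectionVars false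

/-! ### The injectively stable category -/

section Stable

variable {C : Type u₁} [Category.{u₂} C] [Preadditive C] [HasBinaryBiproducts C]

lemma injective_biprod {I J : C} (hI : Injective I) (hJ : Injective J) : Injective (I ⊞ J) where
  factors f g hg := ⟨biprod.lift (Injective.factorThru (f ≫ biprod.fst) g)
    (Injective.factorThru (f ≫ biprod.snd) g), by ext <;> simp⟩

variable [HasZeroObject C]

instance : HomRel.IsStableUnderPrecomp (injRel C) where
  comp_left f g g' h := by
    obtain ⟨I, a, b, hI, hab⟩ := h
    exact ⟨I, f ≫ a, b, hI, by rw [← Preadditive.comp_sub, hab, Category.assoc]⟩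

instance : HomRel.IsStableUnderPostcomp (injRel C) where
  comp_right f h := by
    obtain ⟨I, a, b, hI, hab⟩ := h
    exact ⟨I, a, b ≫ f, hI, by rw [← Preadditive.sub_comp, hab, Category.assoc]⟩

lemma injRel_add {X Y : C} {f₁ f₂ g₁ g₂ : X ⟶ Y} (h₁ : injRel C f₁ f₂) (h₂ : injRel C g₁ g₂) :
    injRel C (f₁ + g₁) (f₂ + g₂) := by
  obtain ⟨I, a, b, hI, hab⟩ := h₁
  obtain ⟨J, c, d, hJ, hcd⟩ := h₂
  exact ⟨I ⊞ J, biprod.lift a c, biprod.desc b d, injective_biprod hI hJ, by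
    rw [biprod.lift_desc, ← hab, ← hcd]; abel⟩

open scoped ZeroObject in
lemma injRel_refl {X Y : C} (f : X ⟶ Y) : injRel C f f :=
  ⟨0, 0, 0, inferInstance, by simp⟩

instance : Congruence (injRel C) where
  equivalence :=
    { refl := injRel_refl
      symm := by
        rintro f g ⟨I, a, b, hI, hab⟩
        exact ⟨I, -a, b, hI, by rw [Preadditive.neg_comp, ← hab]; abel⟩
      trans := by
        intro f g h h₁ h₂
        obtain ⟨I, a, b, hI, hab⟩ := injRel_add h₁ h₂
        exact ⟨I, a, b, hI, by rw [← hab]; abel⟩ }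

instance : Preadditive (StableCat C) :=
  CategoryTheory.Quotient.preadditive (injRel C) fun _ _ _ _ _ _ h₁ h₂ => injRel_add h₁ h₂

instance : (toStable C).Additive :=
  CategoryTheory.Quotient.functor_additive (injRel C) fun _ _ _ _ _ _ h₁ h₂ => injRel_add h₁ h₂

lemma toStable_map_eq_iff {X Y : C} (f g : X ⟶ Y) :
    (toStable C).map f = (toStable C).map g ↔ injRel C f g :=
  CategoryTheory.Quotient.functor_map_eq_iff _ _ _

lemma toStable_map_eq_zero_iff {X Y : C} (f : X ⟶ Y) :
    (toStable C).map f = 0 ↔ ∃ (I : C) (a : X ⟶ I) (b : I ⟶ Y), Injective I ∧ f = a ≫ b := by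
  rw [← (toStable C).map_zero, toStable_map_eq_iff]
  simp only [injRel, sub_zero]

lemma toStable_map_eq_zero_of_injective {X Y : C} (f : X ⟶ Y) (h : Injective X ∨ Injective Y) :
    (toStable C).map f = 0 := by
  rw [toStable_map_eq_zero_iff]
  rcases h with h | h
  · exact ⟨X, 𝟙 X, f, h, by simp⟩
  · exact ⟨Y, f, 𝟙 Y, h, by simp⟩

lemma injective_of_retract {X I : C} (hI : Injective I) (r : Retract X I) : Injective X where
  factors f g hg := ⟨Injective.factorThru (f ≫ r.i) g ≫ r.r, by
    rw [← Category.assoc, Injective.comp_factorThru, Category.assoc, r.retract, Category.comp_id]⟩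

lemma toStable_map_id_eq_zero_iff (X : C) : (toStable C).map (𝟙 X) = 0 ↔ Injective X := by
  refine ⟨fun h => ?_, fun h => toStable_map_eq_zero_of_injective _ (Or.inl h)⟩
  obtain ⟨I, a, b, hI, hab⟩ := (toStable_map_eq_zero_iff _).1 h
  exact injective_of_retract hI ⟨a, b, hab.symm⟩

/-- This makes the theory of minimal objects available for the functor `toStable`. -/
lemma noInjSummand_iff {X : C} : NoInjSummand X ↔ IsMinimal (toStable C) X := by
  unfold NoInjSummand IsMinimal
  simp only [toStable_map_id_eq_zero_iff]
  exact ⟨fun h Y hr hY => h Y hY hr, fun h Y hY hr => h Y hr hY⟩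

instance : PreservesBinaryBiproducts (toStable C) :=
  preservesBinaryBiproducts_of_preservesBiproducts _

instance : HasBinaryBiproducts (StableCat C) where
  has_binary_biproduct X Y :=
    let h : HasBinaryBiproduct ((toStable C).obj X.as) ((toStable C).obj Y.as) :=
      HasBinaryBiproduct.mk ⟨(toStable C).mapBinaryBicone (BinaryBiproduct.bicone X.as Y.as),
        isBinaryBilimitOfPreserves (toStable C) (BinaryBiproduct.isBilimit X.as Y.as)⟩
    h

/-- Additivity of an equivalence is automatic: it preserves products, hence biproducts, and these
determine the addition of morphisms. -/
lemma additive_of_isEquivalence {C' : Type u} [Category.{v} C'] [Preadditive C']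
    [HasBinaryBiproducts C'] [HasZeroObject C'] (Φ : StableCat C ≌ StableCat C') :
    Φ.functor.Additive := by
  have : PreservesBinaryBiproducts Φ.functor := preservesBinaryBiproducts_of_preservesBinaryProducts _
  exact Functor.additive_of_preservesBinaryBiproducts _

variable [IsIdempotentComplete C] [HasDrazin C]

lemma NoInjSummand.iso {X Y : C} (hX : NoInjSummand X) (hY : NoInjSummand Y)
    (φ : (toStable C).obj X ≅ (toStable C).obj Y) : Nonempty (X ≅ Y) :=
  (noInjSummand_iff.1 hX).iso _ (noInjSummand_iff.1 hY) φ

lemma NoInjSummand.biprod {X Y : C} (hX : NoInjSummand X) (hY : NoInjSummand Y) :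
    NoInjSummand (X ⊞ Y) :=
  noInjSummand_iff.2 (IsMinimal.biprod _ (BinaryBiproduct.isBilimit X Y)
    (noInjSummand_iff.1 hX) (noInjSummand_iff.1 hY))

lemma IsIndec.noInjSummand {X : C} (hX : IsIndec X) (h : ¬ Injective X) : NoInjSummand X :=
  noInjSummand_iff.2 (hX.isMinimal (toStable C) fun h' => h ((toStable_map_id_eq_zero_iff X).1 h'))

lemma NoInjSummand.of_iso {X Y : C} (hX : NoInjSummand X) (φ : X ≅ Y) : NoInjSummand Y :=
  fun I hI ⟨r⟩ => hX I hI ⟨r.trans ⟨φ.inv, φ.hom, by simp⟩⟩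

-- Induction over indecomposable summands: the injective ones become zero in the stable category and
-- are discarded.
open scoped ZeroObject in
lemma exists_noInjSummand_iso [HasSize C] (X : C) :
    ∃ Y : C, NoInjSummand Y ∧ Nonempty ((toStable C).obj X ≅ (toStable C).obj Y) := by
  have hzero : NoInjSummand (0 : C) := fun I _ ⟨r⟩ => by
    rw [IsZero.iff_id_eq_zero, ← r.retract, (isZero_zero C).eq_of_tgt r.i 0, zero_comp]
  have hinj : ∀ Z : C, Injective Z → Nonempty ((toStable C).obj Z ≅ (toStable C).obj (0 : C)) :=
    fun Z hZ => ⟨⟨(toStable C).map 0, (toStable C).map 0, by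
      rw [← (toStable C).map_comp, ← (toStable C).map_id]
      simp [toStable_map_eq_zero_of_injective (𝟙 Z) (Or.inl hZ)], by
      rw [← (toStable C).map_comp, ← (toStable C).map_id]
      congr 1
      exact (isZero_zero C).eq_of_src _ _⟩⟩
  refine indec_induction (P := fun X : C => ∃ Y : C, NoInjSummand Y ∧
    Nonempty ((toStable C).obj X ≅ (toStable C).obj Y)) ?_ ?_ ?_ ?_ X
  · rintro X X' φ ⟨Y, hY, ⟨ψ⟩⟩
    exact ⟨Y, hY, ⟨(toStable C).mapIso φ.symm ≪≫ ψ⟩⟩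
  · intro Z hZ
    exact ⟨0, hzero, ⟨(toStable C).mapIso (hZ.iso (isZero_zero C))⟩⟩
  · intro X hX
    by_cases h : Injective X
    · exact ⟨0, hzero, hinj X h⟩
    · exact ⟨X, hX.noInjSummand h, ⟨Iso.refl _⟩⟩
  · rintro X X' ⟨Y, hY, ⟨φ⟩⟩ ⟨Y', hY', ⟨φ'⟩⟩
    exact ⟨Y ⊞ Y', hY.biprod hY', ⟨(toStable C).mapBiprod X X' ≪≫ biprod.mapIso φ φ' ≪≫
      ((toStable C).mapBiprod Y Y').symm⟩⟩

end Stable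

end

end QuiverMono

namespace QuiverMono

noncomputable section

set_option linter.unusedSectionVars false

/-! ### Finitely generated modules over an artin algebra -/

section ArtinAlgebra

/-- The properties of artin algebras that we need: they are artinian, and essential extensions of
finitely generated modules are finitely generated. -/
class IsArtinAlg (R : Type u) [Ring R] : Prop where
  isArtinianRing : IsArtinianRing Rᵐᵒᵖ
  finite_of_essential : ∀ {M : Type u} [AddCommGroup M] [Module Rᵐᵒᵖ M] (P E : Submodule Rᵐᵒᵖ M),
    IsEssentialIn P E → Module.Finite Rᵐᵒᵖ P → Module.Finite Rᵐᵒᵖ E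

lemma isArtinAlg_of_finite (K : Type*) [CommRing K] [IsArtinianRing K] (R : Type u) [Ring R]
    [Algebra K R] [Module.Finite K R] : IsArtinAlg R := by
  have : Module.Finite K Rᵐᵒᵖ := Module.Finite.equiv (MulOpposite.opLinearEquiv K)
  exact ⟨IsArtinianRing.of_finite K Rᵐᵒᵖ, fun P E h _ => finite_of_essential K h⟩

variable {R : Type u} [Ring R]

instance [IsArtinAlg R] : IsArtinianRing Rᵐᵒᵖ := IsArtinAlg.isArtinianRing

instance [IsArtinAlg R] : IsNoetherianRing Rᵐᵒᵖ := inferInstance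

/-- The morphism given by a linear map. -/
def homOf {M N : RightMod R} (f : M →ₗ[Rᵐᵒᵖ] N) : M ⟶ N := ⟨ModuleCat.ofHom f⟩

/-- The linear map underlying a morphism. -/
abbrev linOf {M N : RightMod R} (f : M ⟶ N) : M →ₗ[Rᵐᵒᵖ] N := f.hom.hom

@[simp] lemma linOf_homOf {M N : RightMod R} (f : M →ₗ[Rᵐᵒᵖ] N) : linOf (homOf f) = f := rfl

lemma linOf_comp {M N P : RightMod R} (f : M ⟶ N) (g : N ⟶ P) :
    linOf (f ≫ g) = linOf g ∘ₗ linOf f := rfl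

lemma linOf_id (M : RightMod R) : linOf (𝟙 M) = LinearMap.id := rfl

lemma linOf_zero {M N : RightMod R} : linOf (0 : M ⟶ N) = 0 := rfl

lemma linOf_add {M N : RightMod R} (f g : M ⟶ N) : linOf (f + g) = linOf f + linOf g := rfl

lemma linOf_injective {M N : RightMod R} {f g : M ⟶ N} (h : linOf f = linOf g) : f = g :=
  FGModuleCat.hom_ext h

/-- Linear equivalences are isomorphisms. -/
def isoOf {M N : RightMod R} (e : M ≃ₗ[Rᵐᵒᵖ] N) : M ≅ N where
  hom := homOf e.toLinearMap
  inv := homOf e.symm.toLinearMap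
  hom_inv_id := linOf_injective (LinearMap.ext fun x => e.symm_apply_apply x)
  inv_hom_id := linOf_injective (LinearMap.ext fun x => e.apply_symm_apply x)

/-- Isomorphisms are linear equivalences. -/
def equivOf {M N : RightMod R} (φ : M ≅ N) : M ≃ₗ[Rᵐᵒᵖ] N :=
  FGModuleCat.isoToLinearEquiv φ

/-- Every finitely generated module is isomorphic to an object of `RightMod R`. -/
lemma exists_rightMod (R : Type u) [Ring R] (N : Type*) [AddCommGroup N] [Module Rᵐᵒᵖ N]
    [Module.Finite Rᵐᵒᵖ N] : ∃ N' : RightMod R, Nonempty (N ≃ₗ[Rᵐᵒᵖ] N') := by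
  obtain ⟨n, f, hf⟩ := Module.Finite.exists_fin' Rᵐᵒᵖ N
  have : Small.{u} N := small_of_surjective hf
  let e := (Shrink.linearEquiv.{u} Rᵐᵒᵖ N).symm
  have : Module.Finite Rᵐᵒᵖ (Shrink.{u} N) := Module.Finite.equiv e
  exact ⟨FGModuleCat.of Rᵐᵒᵖ (Shrink.{u} N), ⟨e⟩⟩

lemma isZero_iff_subsingleton (M : RightMod R) : IsZero M ↔ Subsingleton M := by
  rw [IsZero.iff_id_eq_zero]
  constructor
  · intro h
    refine ⟨fun x y => ?_⟩
    have : ∀ x : M, x = 0 := fun x => LinearMap.congr_fun (congrArg linOf h) x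
    rw [this x, this y]
  · intro h
    exact linOf_injective (LinearMap.ext fun x => Subsingleton.elim _ _)

/-- A direct sum decomposition of modules gives a direct sum in the category. -/
def biconeOf {N A B : RightMod R} (e : N ≃ₗ[Rᵐᵒᵖ] A × B) : BinaryBicone A B where
  pt := N
  fst := homOf (LinearMap.fst _ _ _ ∘ₗ e.toLinearMap)
  snd := homOf (LinearMap.snd _ _ _ ∘ₗ e.toLinearMap)
  inl := homOf (e.symm.toLinearMap ∘ₗ LinearMap.inl _ _ _)
  inr := homOf (e.symm.toLinearMap ∘ₗ LinearMap.inr _ _ _)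
  inl_fst := linOf_injective (LinearMap.ext fun x => by simp)
  inl_snd := linOf_injective (LinearMap.ext fun x => by simp [linOf_zero])
  inr_fst := linOf_injective (LinearMap.ext fun x => by simp [linOf_zero])
  inr_snd := linOf_injective (LinearMap.ext fun x => by simp)

lemma biconeOf_isBilimit {N A B : RightMod R} (e : N ≃ₗ[Rᵐᵒᵖ] A × B) :
    Nonempty (biconeOf e).IsBilimit := by
  refine ⟨isBinaryBilimitOfTotal _ (linOf_injective (LinearMap.ext fun x => ?_))⟩
  change e.symm ((e x).1, 0) + e.symm (0, (e x).2) = x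
  rw [← map_add]
  simpa using e.symm_apply_apply x

/-- A direct sum in the category is a product of modules. -/
def equivOfBicone {A B : RightMod R} (b : BinaryBicone A B) (hb : b.IsBilimit) :
    b.pt ≃ₗ[Rᵐᵒᵖ] A × B :=
  LinearEquiv.ofLinearMap ((linOf b.fst).prod (linOf b.snd)) ((linOf b.inl).coprod (linOf b.inr))
    (by
      have h1 := fun x => LinearMap.congr_fun (congrArg linOf b.inl_fst) x
      have h2 := fun x => LinearMap.congr_fun (congrArg linOf b.inl_snd) x
      have h3 := fun x => LinearMap.congr_fun (congrArg linOf b.inr_fst) x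
      have h4 := fun x => LinearMap.congr_fun (congrArg linOf b.inr_snd) x
      simp only [linOf_comp, linOf_id, linOf_zero, LinearMap.comp_apply] at h1 h2 h3 h4
      ext x <;> simp [h1, h2, h3, h4])
    (by
      have h1 := fun x => LinearMap.congr_fun (congrArg linOf (IsBilimit.binary_total hb)) x
      ext x
      exact h1 x)

variable [IsArtinAlg R]

instance : HasZeroObject (RightMod R) := inferInstance

instance : HasBinaryBiproducts (RightMod R) := Abelian.hasBinaryBiproducts

instance : IsIdempotentComplete (RightMod R) := inferInstance

lemma length_toNat_prod (M N : RightMod R) : (Module.length Rᵐᵒᵖ (M × N)).toNat =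
    (Module.length Rᵐᵒᵖ M).toNat + (Module.length Rᵐᵒᵖ N).toNat := by
  rw [Module.length_prod, ENat.toNat_add Module.length_ne_top Module.length_ne_top]

instance : HasSize (RightMod R) where
  exists_size := by
    refine ⟨fun M => (Module.length Rᵐᵒᵖ M).toNat, fun M h => ?_, ?_⟩
    · rw [isZero_iff_subsingleton, ← Module.length_eq_zero_iff (R := Rᵐᵒᵖ)]
      rcases (ENat.toNat_eq_zero).1 h with h | h
      · exact h
      · exact absurd h Module.length_ne_top
    · rintro A B b X hb ⟨φ⟩
      change (Module.length Rᵐᵒᵖ X).toNat = _ + _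
      rw [← length_toNat_prod, (equivOf φ ≪≫ₗ equivOfBicone b hb).length_eq]

/-- Fitting's lemma. -/
lemma isDrazin_end {M : Type*} [AddCommGroup M] [Module Rᵐᵒᵖ M] [IsArtinian Rᵐᵒᵖ M]
    [IsNoetherian Rᵐᵒᵖ M] (h : Module.End Rᵐᵒᵖ M) : IsDrazin h := by
  obtain ⟨n, hn⟩ := Filter.eventually_atTop.1 h.eventually_isCompl_ker_pow_range_pow
  -- Fitting decomposition into the kernel `P` and the range `Q` of a power. The exponent is made
  -- positive so that `P` contains the kernel of `h`. Then `h` is bijective on `Q`, and the Drazin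
  -- inverse is its inverse there and zero on `P`.
  have hc := hn (n + 1) (Nat.le_succ n)
  set P := LinearMap.ker (h ^ (n + 1)) with hP
  set Q := LinearMap.range (h ^ (n + 1)) with hQ
  have hPh : ∀ x ∈ P, h x ∈ P := fun x hx => by
    rw [hP, LinearMap.mem_ker] at hx ⊢
    rw [← Module.End.mul_apply, ← pow_succ, pow_succ', Module.End.mul_apply, hx, map_zero]
  have hQh : ∀ x ∈ Q, h x ∈ Q := by
    rintro _ ⟨y, rfl⟩
    exact ⟨h y, by rw [← Module.End.mul_apply, ← Module.End.mul_apply, ← pow_succ, pow_succ']⟩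
  have hinj : Function.Injective (h.restrict hQh) := by
    rw [← LinearMap.ker_eq_bot, Submodule.eq_bot_iff]
    rintro ⟨x, hx⟩ hx0
    have h0 : h x = 0 := congrArg Subtype.val (LinearMap.mem_ker.1 hx0)
    have hxP : x ∈ P := by
      rw [hP, LinearMap.mem_ker, pow_succ, Module.End.mul_apply, h0, map_zero]
    exact Subtype.ext ((Submodule.disjoint_def.1 hc.disjoint) x hxP hx)
  let e := LinearEquiv.ofBijective (h.restrict hQh)
    (IsArtinian.bijective_of_injective_endomorphism _ hinj)
  let c : Module.End Rᵐᵒᵖ M := Q.subtype ∘ₗ e.symm.toLinearMap ∘ₗ Q.projectionOnto P hc.symm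
  have hcP : ∀ x ∈ P, c x = 0 := fun x hx => by
    change ((e.symm (Q.projectionOnto P hc.symm x) : Q) : M) = 0
    rw [Submodule.projectionOnto_apply_right hc.symm ⟨x, hx⟩]
    simp
  have hcQ : ∀ x (hx : x ∈ Q), c x = e.symm ⟨x, hx⟩ := fun x hx => by
    change ((e.symm (Q.projectionOnto P hc.symm x) : Q) : M) = _
    rw [Submodule.projectionOnto_apply_left hc.symm ⟨x, hx⟩]
  have hcQm : ∀ x ∈ Q, c x ∈ Q := fun x hx => by
    rw [hcQ x hx]
    exact Subtype.property _
  have hhc : ∀ x ∈ Q, h (c x) = x := fun x hx => by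
    rw [hcQ x hx]
    exact congrArg Subtype.val (e.apply_symm_apply ⟨x, hx⟩)
  have hch : ∀ x ∈ Q, c (h x) = x := fun x hx => by
    rw [hcQ _ (hQh x hx)]
    exact congrArg Subtype.val (e.symm_apply_apply ⟨x, hx⟩)
  have hdec : ∀ x : M, ∃ p ∈ P, ∃ q ∈ Q, p + q = x := fun x =>
    Submodule.mem_sup.1 (hc.sup_eq_top ▸ Submodule.mem_top)
  refine ⟨c, n + 1, ?_, ?_, ?_⟩
  · refine LinearMap.ext fun x => ?_
    obtain ⟨p, hp, q, hq, rfl⟩ := hdec x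
    simp only [Module.End.mul_apply, map_add, hcP p hp, hcP _ (hPh p hp), hhc q hq, hch q hq,
      map_zero]
  · refine LinearMap.ext fun x => ?_
    obtain ⟨p, hp, q, hq, rfl⟩ := hdec x
    simp only [Module.End.mul_apply, map_add, hcP p hp, hhc q hq, map_zero]
  · refine LinearMap.ext fun x => ?_
    obtain ⟨p, hp, q, hq, rfl⟩ := hdec x
    rw [pow_succ h (n + 1)]
    simp only [Module.End.mul_apply, map_add, hcP p hp, hhc q hq, map_zero, zero_add]
    rw [LinearMap.mem_ker.1 hp, zero_add]

instance : HasDrazin (RightMod R) where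
  drazin M h := by
    obtain ⟨c, n, h1, h2, h3⟩ := isDrazin_end (linOf (show M ⟶ M from h))
    let F : Module.End Rᵐᵒᵖ M →* End M :=
      { toFun := fun f => homOf f
        map_one' := rfl
        map_mul' := fun _ _ => rfl }
    refine ⟨F c, n, ?_, ?_, ?_⟩
    · exact (congrArg F h1.eq)
    · exact (congrArg F h2)
    · have := congrArg F h3
      rw [map_mul, map_pow, map_pow] at this
      exact this

/-! ### Injective modules -/

lemma injective_linOf_iff_mono {M N : RightMod R} (f : M ⟶ N) :
    Function.Injective (linOf f) ↔ Mono f := by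
  constructor
  · intro h
    refine ⟨fun g g' hg => linOf_injective (LinearMap.ext fun x => h ?_)⟩
    exact LinearMap.congr_fun (congrArg linOf hg) x
  · intro h
    have : Mono ((forget₂ (FGModuleCat Rᵐᵒᵖ) (ModuleCat Rᵐᵒᵖ)).map f) := inferInstance
    exact (ModuleCat.mono_iff_injective _).1 this

/-- The categorical notion tests only finitely generated modules. Since the ring is noetherian its
ideals are among them, so Baer's criterion gives injectivity among all modules. -/
lemma injective_iff_baer (I : RightMod R) : Injective I ↔ Module.Baer Rᵐᵒᵖ I := by
  constructor
  · intro hI J g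
    let J' : RightMod R := FGModuleCat.of Rᵐᵒᵖ J
    let A' : RightMod R := FGModuleCat.of Rᵐᵒᵖ Rᵐᵒᵖ
    let i : J' ⟶ A' := homOf (M := J') (N := A') J.subtype
    have hi : Mono i := (injective_linOf_iff_mono i).1 Subtype.val_injective
    let g' : J' ⟶ I := homOf (M := J') g
    refine ⟨linOf (Injective.factorThru g' i), fun x hx => ?_⟩
    exact LinearMap.congr_fun (congrArg linOf (Injective.comp_factorThru g' i)) ⟨x, hx⟩
  · intro h
    refine ⟨fun {X Y} g f hf => ?_⟩
    obtain ⟨k, hk⟩ := h.extension_property (linOf f) ((injective_linOf_iff_mono f).2 hf) (linOf g)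
    exact ⟨homOf k, linOf_injective hk⟩

/-- Linear maps into an injective module extend along arbitrary linear maps, provided that the
kernels are compatible. -/
lemma exists_extension_of_ker_le {I : RightMod R} (hI : Injective I) {U V : Type*}
    [AddCommGroup U] [Module Rᵐᵒᵖ U] [AddCommGroup V] [Module Rᵐᵒᵖ V] (a : U →ₗ[Rᵐᵒᵖ] V)
    (b : U →ₗ[Rᵐᵒᵖ] I) (h : ∀ x, a x = 0 → b x = 0) : ∃ c : V →ₗ[Rᵐᵒᵖ] I, ∀ x, c (a x) = b x := by
  have hle : LinearMap.ker a ≤ LinearMap.ker b := fun x hx => h x hx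
  have hinj : Function.Injective ((LinearMap.ker a).liftQ a le_rfl) := by
    rw [← LinearMap.ker_eq_bot]
    exact Submodule.ker_liftQ_eq_bot _ _ _ le_rfl
  obtain ⟨c, hc⟩ := ((injective_iff_baer I).1 hI).extension_property _ hinj
    ((LinearMap.ker a).liftQ b hle)
  exact ⟨c, fun x => LinearMap.congr_fun hc (Submodule.Quotient.mk x)⟩

lemma exists_extension {I : RightMod R} (hI : Injective I) {U V : Type*}
    [AddCommGroup U] [Module Rᵐᵒᵖ U] [AddCommGroup V] [Module Rᵐᵒᵖ V] (a : U →ₗ[Rᵐᵒᵖ] V)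
    (ha : Function.Injective a) (b : U →ₗ[Rᵐᵒᵖ] I) : ∃ c : V →ₗ[Rᵐᵒᵖ] I, ∀ x, c (a x) = b x :=
  exists_extension_of_ker_le hI a b fun x hx => by
    rw [ha (hx.trans (map_zero a).symm), map_zero]

/-- Existence of injective envelopes. -/
lemma exists_injEnvelope (M : Type*) [AddCommGroup M] [Module Rᵐᵒᵖ M] [Module.Finite Rᵐᵒᵖ M] :
    ∃ (J : RightMod R) (j : M →ₗ[Rᵐᵒᵖ] J), IsInjEnvelope j := by
  obtain ⟨M', ⟨e⟩⟩ := exists_rightMod R M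
  let I : ModuleCat Rᵐᵒᵖ := Injective.under (ModuleCat.of Rᵐᵒᵖ M')
  let i : M' →ₗ[Rᵐᵒᵖ] I := (Injective.ι (ModuleCat.of Rᵐᵒᵖ M')).hom
  have hi : Function.Injective i := (ModuleCat.mono_iff_injective _).1
    (inferInstanceAs (Mono (Injective.ι (ModuleCat.of Rᵐᵒᵖ M'))))
  have hI : Module.Baer Rᵐᵒᵖ I := Module.Baer.of_injective
    ((Module.injective_iff_injective_object Rᵐᵒᵖ I).2
      (inferInstanceAs (Injective (Injective.under (ModuleCat.of Rᵐᵒᵖ M')))))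
  -- The ambient injective module need not be finitely generated, but a maximal essential extension
  -- of `M` inside it is injective and finitely generated.
  obtain ⟨E, hE, hess, hmax⟩ := exists_maximal_essential (LinearMap.range i)
  have hfin : Module.Finite Rᵐᵒᵖ E := IsArtinAlg.finite_of_essential _ _ hess inferInstance
  let J : RightMod R := FGModuleCat.of Rᵐᵒᵖ E
  let j : M →ₗ[Rᵐᵒᵖ] J := (i ∘ₗ e.toLinearMap).codRestrict E fun x => hE ⟨e x, rfl⟩
  refine ⟨J, j, ?_, (injective_iff_baer J).2 (baer_of_maximal_essential hI hE hess hmax), ?_⟩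
  · intro x y hxy
    exact e.injective (hi (congrArg Subtype.val hxy))
  · intro g hg
    have hinj : Function.Injective g := by
      rw [← LinearMap.ker_eq_bot]
      -- An endomorphism fixing `M` has a kernel that meets `M` trivially, so the kernel vanishes by
      -- essentiality.
      have h1 : (LinearMap.ker g).map E.subtype = ⊥ := by
        refine hess _ (by rintro _ ⟨y, -, rfl⟩; exact y.2) ?_
        rw [Submodule.eq_bot_iff]
        rintro _ ⟨⟨y, hy, rfl⟩, z, hz⟩
        have : y = j (e.symm z) := Subtype.ext (by
          change E.subtype y = i (e (e.symm z))
          rw [← hz, e.apply_symm_apply])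
        have h0 : g y = y := by
          rw [this]
          exact LinearMap.congr_fun hg _
        rw [← h0, LinearMap.mem_ker.1 hy]
        rfl
      exact Submodule.map_injective_of_injective E.injective_subtype (h1.trans (Submodule.map_bot _).symm)
    exact IsArtinian.bijective_of_injective_endomorphism _ hinj

/-- An injective envelope contains the socle. -/
lemma IsInjEnvelope.socle_le {M : Type*} [AddCommGroup M] [Module Rᵐᵒᵖ M] {J : RightMod R}
    {j : M →ₗ[Rᵐᵒᵖ] J} (hj : IsInjEnvelope j) : socle Rᵐᵒᵖ J ≤ LinearMap.range j := by
  refine sSup_le fun S hS => ?_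
  have hS' : IsSimpleModule Rᵐᵒᵖ S := hS
  have hat := isSimpleModule_iff_isAtom.1 hS'
  by_contra hne
  have hdis : S ⊓ LinearMap.range j = ⊥ :=
    (hat.le_iff.1 inf_le_left).resolve_right fun h => hne (inf_eq_left.1 h)
  -- If `S` misses the image of `j`, the assignment `j x + s ↦ j x` is well defined and extends to
  -- `J`. The extension fixes `j` but kills `S`, against left minimality.
  obtain ⟨g, hg⟩ := exists_extension_of_ker_le hj.2.1 (j.coprod S.subtype)
    (j ∘ₗ LinearMap.fst Rᵐᵒᵖ M S) (by
      rintro ⟨x, s⟩ hx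
      have hx' : j x + s = 0 := hx
      have hs : (s : J) ∈ S ⊓ LinearMap.range j :=
        ⟨s.2, -x, by rw [map_neg]; exact neg_eq_of_add_eq_zero_right hx'⟩
      rw [hdis, Submodule.mem_bot] at hs
      rw [hs, add_zero] at hx'
      exact hx')
  have h1 := hj.2.2 g (LinearMap.ext fun x => by simpa using hg (x, 0))
  refine hat.1 ((Submodule.eq_bot_iff _).2 fun s hs => h1.1 ?_)
  rw [map_zero]
  simpa using hg (0, ⟨s, hs⟩)

/-- The socle of an injective envelope. -/
lemma IsInjEnvelope.nonempty_socleEquiv {M : Type*} [AddCommGroup M] [Module Rᵐᵒᵖ M]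
    {J : RightMod R} {j : M →ₗ[Rᵐᵒᵖ] J} (hj : IsInjEnvelope j) :
    Nonempty (socle Rᵐᵒᵖ M ≃ₗ[Rᵐᵒᵖ] socle Rᵐᵒᵖ J) := by
  let f : socle Rᵐᵒᵖ M →ₗ[Rᵐᵒᵖ] socle Rᵐᵒᵖ J :=
    (j ∘ₗ (socle Rᵐᵒᵖ M).subtype).codRestrict _ fun x => map_socle_le j ⟨x, x.2, rfl⟩
  refine ⟨LinearEquiv.ofBijective f ⟨fun x y h => Subtype.ext (hj.1 (congrArg Subtype.val h)), ?_⟩⟩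
  let e := LinearEquiv.ofInjective j hj.1
  let k : socle Rᵐᵒᵖ J →ₗ[Rᵐᵒᵖ] M :=
    e.symm.toLinearMap ∘ₗ Submodule.inclusion hj.socle_le
  intro y
  have hk : k y ∈ socle Rᵐᵒᵖ M := range_le_socle_of_semisimple k ⟨y, rfl⟩
  refine ⟨⟨k y, hk⟩, Subtype.ext ?_⟩
  change ((e (k y) : LinearMap.range j) : J) = y
  exact congrArg Subtype.val (e.apply_symm_apply (Submodule.inclusion hj.socle_le y))

end ArtinAlgebra

end

end QuiverMono

namespace QuiverMono

noncomputable section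

set_option linter.unusedSectionVars false

/-! ### Injective modules, simple modules and their classes -/

section Injectives

variable {R : Type u} [Ring R] [IsArtinAlg R]

lemma nonempty_iso_of_socle {I J : RightMod R} (hI : Injective I) (hJ : Injective J)
    (e : socle Rᵐᵒᵖ I ≃ₗ[Rᵐᵒᵖ] socle Rᵐᵒᵖ J) : Nonempty (I ≅ J) := by
  obtain ⟨f⟩ := nonempty_equiv_of_socle ((injective_iff_baer I).1 hI)
    ((injective_iff_baer J).1 hJ) e
  exact ⟨isoOf f⟩

/-- An injective linear map out of an injective module is a split monomorphism. -/
lemma nonempty_retract_of_injective {I M : RightMod R} (hI : Injective I) (f : I →ₗ[Rᵐᵒᵖ] M)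
    (hf : Function.Injective f) : Nonempty (Retract I M) := by
  obtain ⟨g, hg⟩ := exists_extension hI f hf LinearMap.id
  exact ⟨homOf f, homOf g, linOf_injective (LinearMap.ext hg)⟩

/-- Socles are compatible with direct sums, and the socle here has length one. So one summand has
zero socle, and a finitely generated module with zero socle is zero. -/
lemma isIndec_of_simple_socle {J : RightMod R} [hs : IsSimpleModule Rᵐᵒᵖ (socle Rᵐᵒᵖ J)] :
    IsIndec J := by
  refine ⟨fun h => ?_, ?_⟩
  · rw [isZero_iff_subsingleton] at h
    have := IsSimpleModule.nontrivial Rᵐᵒᵖ (socle Rᵐᵒᵖ J)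
    exact not_subsingleton (socle Rᵐᵒᵖ J) inferInstance
  · rintro Y Z b ⟨hb⟩ ⟨φ⟩
    have e : socle Rᵐᵒᵖ J ≃ₗ[Rᵐᵒᵖ] socle Rᵐᵒᵖ Y × socle Rᵐᵒᵖ Z :=
      socleEquiv (equivOf φ ≪≫ₗ equivOfBicone b hb) ≪≫ₗ socleProdEquiv
    have hl : Module.length Rᵐᵒᵖ (socle Rᵐᵒᵖ Y) + Module.length Rᵐᵒᵖ (socle Rᵐᵒᵖ Z) = 1 := by
      rw [← Module.length_prod, ← e.length_eq, Module.length_eq_one]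
    have hz : ∀ M : RightMod R, Module.length Rᵐᵒᵖ (socle Rᵐᵒᵖ M) = 0 → IsZero M := by
      intro M h
      rw [isZero_iff_subsingleton]
      have h0 : Subsingleton (socle Rᵐᵒᵖ M) := Module.length_eq_zero_iff.1 h
      have hinj := injective_of_socle (0 : M →ₗ[Rᵐᵒᵖ] M) fun x hx _ =>
        congrArg Subtype.val (Subsingleton.elim (⟨x, hx⟩ : socle Rᵐᵒᵖ M) 0)
      exact ⟨fun x y => hinj rfl⟩
    by_cases h : Module.length Rᵐᵒᵖ (socle Rᵐᵒᵖ Y) = 0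
    · exact Or.inl (hz Y h)
    · right
      refine hz Z ?_
      have h1 := Module.length_ne_top (R := Rᵐᵒᵖ) (M := socle Rᵐᵒᵖ Y)
      have h2 := Module.length_ne_top (R := Rᵐᵒᵖ) (M := socle Rᵐᵒᵖ Z)
      lift Module.length Rᵐᵒᵖ (socle Rᵐᵒᵖ Y) to ℕ using h1 with a
      lift Module.length Rᵐᵒᵖ (socle Rᵐᵒᵖ Z) to ℕ using h2 with b
      norm_cast at hl h ⊢
      omega

/-- The injective envelope of a simple module. -/
lemma exists_injective_with_socle (S : Type*) [AddCommGroup S] [Module Rᵐᵒᵖ S]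
    [IsSimpleModule Rᵐᵒᵖ S] : ∃ J : RightMod R, IsIndec J ∧ Injective J ∧
      Nonempty (S ≃ₗ[Rᵐᵒᵖ] socle Rᵐᵒᵖ J) := by
  obtain ⟨J, j, hj⟩ := exists_injEnvelope (R := R) S
  obtain ⟨e⟩ := hj.nonempty_socleEquiv
  have e' : S ≃ₗ[Rᵐᵒᵖ] socle Rᵐᵒᵖ J :=
    (LinearEquiv.ofTop _ socle_eq_top).symm ≪≫ₗ e
  have : IsSimpleModule Rᵐᵒᵖ (socle Rᵐᵒᵖ J) := IsSimpleModule.congr e'.symm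
  exact ⟨J, isIndec_of_simple_socle, hj.2.1, ⟨e'⟩⟩

/-- The envelope of a simple submodule embeds into the injective module `I`, hence splits off and is
all of `I`. -/
lemma IsIndec.isSimpleModule_socle {I : RightMod R} (hI : IsIndec I) (hI' : Injective I) :
    IsSimpleModule Rᵐᵒᵖ (socle Rᵐᵒᵖ I) := by
  have hne : (⊤ : Submodule Rᵐᵒᵖ I) ≠ ⊥ := fun h => hI.1 ((isZero_iff_subsingleton I).2
    ((Submodule.subsingleton_iff Rᵐᵒᵖ).1 (subsingleton_of_bot_eq_top h.symm)))
  obtain ⟨S, -, hS⟩ := exists_simple_le hne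
  obtain ⟨J, j, hj⟩ := exists_injEnvelope (R := R) S
  obtain ⟨g, hg⟩ := exists_extension hI' j hj.1 S.subtype
  obtain ⟨e⟩ := hj.nonempty_socleEquiv
  have hinj : Function.Injective g := injective_of_socle g fun x hx h0 => by
    obtain ⟨s, rfl⟩ := hj.socle_le hx
    rw [hg] at h0
    rw [Subtype.ext (a2 := (0 : S)) h0, map_zero]
  obtain ⟨r⟩ := nonempty_retract_of_injective hj.2.1 g hinj
  have e' : S ≃ₗ[Rᵐᵒᵖ] socle Rᵐᵒᵖ J := (LinearEquiv.ofTop _ socle_eq_top).symm ≪≫ₗ e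
  rcases hI.retract_isZero_or_isIso r with h | h
  · exfalso
    rw [isZero_iff_subsingleton] at h
    have := IsSimpleModule.nontrivial Rᵐᵒᵖ S
    exact not_subsingleton S (hj.1.subsingleton)
  · exact IsSimpleModule.congr (e' ≪≫ₗ socleEquiv (equivOf (asIso r.i))).symm

lemma isIndec_of_simple {S : RightMod R} [IsSimpleModule Rᵐᵒᵖ S] : IsIndec S := by
  have e : socle Rᵐᵒᵖ S ≃ₗ[Rᵐᵒᵖ] S := LinearEquiv.ofTop _ socle_eq_top
  have : IsSimpleModule Rᵐᵒᵖ (socle Rᵐᵒᵖ S) := IsSimpleModule.congr e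
  exact isIndec_of_simple_socle

lemma IsIndec.isSimpleModule_of_semisimple {S : RightMod R} (hS : IsIndec S)
    [IsSemisimpleModule Rᵐᵒᵖ S] : IsSimpleModule Rᵐᵒᵖ S := by
  have hne : (⊤ : Submodule Rᵐᵒᵖ S) ≠ ⊥ := fun h => hS.1 ((isZero_iff_subsingleton S).2
    ((Submodule.subsingleton_iff Rᵐᵒᵖ).1 (subsingleton_of_bot_eq_top h.symm)))
  obtain ⟨T, -, hT⟩ := exists_simple_le hne
  obtain ⟨T', hT'⟩ := exists_isCompl T
  let T₀ : RightMod R := FGModuleCat.of Rᵐᵒᵖ T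
  let r : Retract T₀ S := ⟨homOf (M := T₀) T.subtype, homOf (N := T₀) (T.projectionOnto T' hT'),
    linOf_injective (LinearMap.ext fun x => Submodule.projectionOnto_apply_left hT' x)⟩
  rcases hS.retract_isZero_or_isIso r with h | h
  · exfalso
    rw [isZero_iff_subsingleton] at h
    have := IsSimpleModule.nontrivial Rᵐᵒᵖ T
    exact not_subsingleton T h
  · have e : T ≃ₗ[Rᵐᵒᵖ] S := equivOf (asIso r.i)
    exact IsSimpleModule.congr e.symm

lemma simpleNonInj.noInjSummand {S : RightMod R} (hS : simpleNonInj R S) : NoInjSummand S := by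
  have := hS.1
  exact isIndec_of_simple.noInjSummand hS.2

/-- A nonzero indecomposable injective module that is not simple has a non-injective socle. -/
lemma IsIndec.not_injective_of_socle {I S : RightMod R} (hI : IsIndec I) (hI' : Injective I)
    (hns : ¬ IsSimpleModule Rᵐᵒᵖ I) (e : S ≃ₗ[Rᵐᵒᵖ] socle Rᵐᵒᵖ I) : simpleNonInj R S := by
  have h1 := hI.isSimpleModule_socle hI'
  have hS : IsSimpleModule Rᵐᵒᵖ S := IsSimpleModule.congr e
  refine ⟨hS, fun hinj => hns ?_⟩
  obtain ⟨r⟩ := nonempty_retract_of_injective hinj ((socle Rᵐᵒᵖ I).subtype ∘ₗ e.toLinearMap)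
    (Subtype.val_injective.comp e.injective)
  rcases hI.retract_isZero_or_isIso r with h | h
  · exact absurd h (isIndec_of_simple (S := S)).1
  · exact IsSimpleModule.congr (equivOf (asIso r.i)).symm

/-- Morphisms from semisimple modules to modules without injective summands are determined by
their stable class. -/
lemma eq_zero_of_toStable_map_eq_zero {S B : RightMod R} [IsSemisimpleModule Rᵐᵒᵖ S]
    (hB : NoInjSummand B) (f : S ⟶ B) (hf : (toStable (RightMod R)).map f = 0) : f = 0 := by
  obtain ⟨I, a, b, hI, rfl⟩ := (toStable_map_eq_zero_iff f).1 hf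
  refine linOf_injective (LinearMap.ext fun x => ?_)
  suffices h : (⊤ : Submodule Rᵐᵒᵖ S) ≤ LinearMap.ker (linOf (a ≫ b)) from h trivial
  rw [← socle_eq_top]
  refine sSup_le fun T hT => ?_
  have hT' : IsSimpleModule Rᵐᵒᵖ T := hT
  by_contra hne
  have hne' : linOf (a ≫ b) ∘ₗ T.subtype ≠ 0 := fun h0 => hne fun x hx =>
    LinearMap.congr_fun h0 ⟨x, hx⟩
  have hinj := LinearMap.injective_of_ne_zero hne'
  -- Suppose `a ≫ b` is nonzero on the simple module `T`. Extend `a` from `T` to its envelope `J`.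
  -- The composite with `b` is injective on the socle of `J`, hence injective, so `J` would be a
  -- nonzero injective summand of `B`.
  obtain ⟨J, j, hj⟩ := exists_injEnvelope (R := R) T
  obtain ⟨g, hg⟩ := exists_extension hI j hj.1 (linOf a ∘ₗ T.subtype)
  have hginj : Function.Injective (linOf b ∘ₗ g) := injective_of_socle _ fun x hx h0 => by
    obtain ⟨s, rfl⟩ := hj.socle_le hx
    rw [LinearMap.comp_apply, hg] at h0
    rw [hinj (a₁ := s) (a₂ := 0) (h0.trans (map_zero _).symm), map_zero]
  obtain ⟨r⟩ := nonempty_retract_of_injective hj.2.1 _ hginj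
  have hJ := hB J hj.2.1 ⟨r⟩
  rw [isZero_iff_subsingleton] at hJ
  have := IsSimpleModule.nontrivial Rᵐᵒᵖ T
  exact not_subsingleton T (hj.1.subsingleton)

lemma eq_of_toStable_map_eq {S B : RightMod R} [IsSemisimpleModule Rᵐᵒᵖ S]
    (hB : NoInjSummand B) (f g : S ⟶ B)
    (h : (toStable (RightMod R)).map f = (toStable (RightMod R)).map g) : f = g := by
  rw [← sub_eq_zero]
  exact eq_zero_of_toStable_map_eq_zero hB _ (by rw [Functor.map_sub, h, sub_self])

lemma cls_prod {N A B : RightMod R} (e : N ≃ₗ[Rᵐᵒᵖ] A × B) : cls N = cls A + cls B := by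
  obtain ⟨hb⟩ := biconeOf_isBilimit e
  exact cls_bicone (biconeOf e) hb

lemma cls_pi {ι : Type*} [Finite ι] : ∀ (J : ι → RightMod R) (N : RightMod R),
    (N ≃ₗ[Rᵐᵒᵖ] (∀ i, J i)) → cls N = ∑ᶠ i, cls (J i) := by
  induction ι using Finite.induction_empty_option with
  | of_equiv e ih =>
    intro J N φ
    rw [ih (fun i => J (e i)) N (φ ≪≫ₗ (LinearEquiv.piCongrLeft Rᵐᵒᵖ (fun i => J i) e).symm)]
    exact finsum_comp_equiv e (f := fun i => cls (J i))
  | h_empty =>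
    intro J N φ
    rw [finsum_of_isEmpty, cls_zero]
    rw [isZero_iff_subsingleton]
    exact φ.injective.subsingleton
  | h_option ih =>
    rename_i α _
    intro J N φ
    obtain ⟨N', ⟨ψ⟩⟩ := exists_rightMod R (∀ i : α, J (some i))
    let χ : (∀ i, J i) ≃ₗ[Rᵐᵒᵖ] J none × (∀ i : α, J (some i)) :=
      { toFun := fun f => (f none, fun i => f (some i))
        invFun := fun p i => Option.rec p.1 p.2 i
        left_inv := fun f => by ext i; cases i <;> rfl
        right_inv := fun p => rfl
        map_add' := fun f g => rfl
        map_smul' := fun c f => rfl }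
    rw [cls_prod (φ ≪≫ₗ χ ≪≫ₗ LinearEquiv.prodCongr (LinearEquiv.refl _ _) ψ),
      ih (fun i => J (some i)) N' ψ.symm]
    have : Fintype α := Fintype.ofFinite α
    rw [finsum_eq_sum_of_fintype, finsum_eq_sum_of_fintype, Fintype.sum_option]

open Classical in
lemma cls_directSum {ι : Type*} [Finite ι] (J : ι → RightMod R) (N : RightMod R)
    (e : N ≃ₗ[Rᵐᵒᵖ] DirectSum ι fun i => J i) : cls N = ∑ᶠ i, cls (J i) := by
  have : Fintype ι := Fintype.ofFinite ι
  exact cls_pi J N (e ≪≫ₗ DirectSum.linearEquivFunOnFintype Rᵐᵒᵖ ι fun i => J i)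

end Injectives

end

end QuiverMono

namespace QuiverMono

noncomputable section

set_option linter.unusedSectionVars false

/-! ### Representations of acyclic quivers -/

section Quivers

variable {Q : Type w} [Quiver.{v + 1} Q]

/-- In a finite acyclic quiver, the relation of being joined by an arrow is well-founded. -/
lemma IsAcyclicQuiver.wellFounded [Finite Q] (hQ : IsAcyclicQuiver Q) :
    WellFounded fun i k : Q => Nonempty (i ⟶ k) := by
  let r : Q → Q → Prop := fun i k => ∃ p : Quiver.Path i k, 0 < p.length
  have : IsTrans Q r := ⟨fun a b c ⟨p, hp⟩ ⟨q, hq⟩ => ⟨p.comp q, by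
    rw [Quiver.Path.length_comp]; omega⟩⟩
  have : Std.Irrefl r := ⟨fun a ⟨p, hp⟩ => by
    rw [hQ a p] at hp
    exact absurd hp (by simp)⟩
  exact Subrelation.wf (r := r) (fun {i k} ⟨a⟩ => ⟨a.toPath, by simp⟩)
    (Finite.wellFounded_of_trans_of_irrefl r)

/-- A path to `k` is trivial or ends with one of finitely many arrows into `k`. Acyclicity makes
this recursion terminate. -/
lemma IsAcyclicQuiver.finite_path [Finite Q] [∀ i j : Q, Finite (i ⟶ j)] (hQ : IsAcyclicQuiver Q)
    (j k : Q) : Finite (Quiver.Path j k) := by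
  induction k using hQ.wellFounded.induction with
  | _ k ih =>
    have : ∀ a : (Σ i : Q, (i ⟶ k)), Finite (Quiver.Path j a.1) := fun a => ih a.1 ⟨a.2⟩
    have : Finite (j = k) := inferInstance
    let f : (Σ a : (Σ i : Q, (i ⟶ k)), Quiver.Path j a.1) ⊕ PLift (j = k) → Quiver.Path j k :=
      fun x => match x with
        | Sum.inl x => x.2.cons x.1.2
        | Sum.inr h => h.down ▸ Quiver.Path.nil
    refine Finite.of_surjective f fun p => ?_
    cases p with
    | nil => exact ⟨Sum.inr ⟨rfl⟩, rfl⟩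
    | cons p a => exact ⟨Sum.inl ⟨⟨_, a⟩, p⟩, rfl⟩

variable {D : Type u₁} [Category.{u₂} D]

/-- A family of morphisms compatible with the arrows is a morphism of representations. -/
def repHom {X Y : Rep Q D} (r : ∀ i : Q, X.at i ⟶ Y.at i)
    (h : ∀ ⦃i k : Q⦄ (a : i ⟶ k), X.map ((Paths.of Q).map a) ≫ r k =
      r i ≫ Y.map ((Paths.of Q).map a)) : X ⟶ Y where
  app i := r i
  naturality i k p := by
    induction p using Paths.induction_fixed_source with
    | id =>
      rw [X.map_id, Y.map_id]
      exact (Category.id_comp _).trans (Category.comp_id _).symm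
    | comp p a ih =>
      rw [X.map_comp, Y.map_comp]
      exact (Category.assoc _ _ _).trans ((congrArg _ (h a)).trans
        ((Category.assoc _ _ _).symm.trans ((congrArg (fun t => t ≫ _) ih).trans
          (Category.assoc _ _ _))))

/-- A family of isomorphisms compatible with the arrows is an isomorphism of representations. -/
def repIso {X Y : Rep Q D} (r : ∀ i : Q, X.at i ≅ Y.at i)
    (h : ∀ ⦃i k : Q⦄ (a : i ⟶ k), X.map ((Paths.of Q).map a) ≫ (r k).hom =
      (r i).hom ≫ Y.map ((Paths.of Q).map a)) : X ≅ Y where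
  hom := repHom (fun i => (r i).hom) h
  inv := repHom (fun i => (r i).inv) fun i k a => by
    rw [Iso.comp_inv_eq, Category.assoc, h a, Iso.inv_hom_id_assoc]
  hom_inv_id := by
    ext i
    exact (r i).hom_inv_id
  inv_hom_id := by
    ext i
    exact (r i).inv_hom_id

/-- The representation given by objects at the vertices and morphisms at the arrows. -/
def mkRep (N : Q → D) (φ : ∀ ⦃i k : Q⦄, (i ⟶ k) → (N i ⟶ N k)) : Rep Q D :=
  Paths.lift { obj := N, map := fun a => φ a }

lemma mkRep_map (N : Q → D) (φ : ∀ ⦃i k : Q⦄, (i ⟶ k) → (N i ⟶ N k)) {i k : Q} (a : i ⟶ k) :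
    (mkRep N φ).map ((Paths.of Q).map a) = φ a :=
  Paths.lift_toPath _ a

end Quivers

section Reps

variable {Q : Type w} [Quiver.{v + 1} Q] {R : Type u} [Ring R]

/-- The component of a morphism of representations at a vertex, as a linear map. -/
abbrev repLin {X Y : Rep Q (RightMod R)} (f : X ⟶ Y) (i : Q) : X.at i →ₗ[Rᵐᵒᵖ] Y.at i :=
  linOf (f.app ((Paths.of Q).obj i))

lemma repLin_arrow {X Y : Rep Q (RightMod R)} (f : X ⟶ Y) {i k : Q} (a : i ⟶ k) (x : X.at i) :
    repLin f k (X.arrow a x) = Y.arrow a (repLin f i x) :=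
  LinearMap.congr_fun (congrArg linOf (f.naturality ((Paths.of Q).map a))) x

open Classical in
lemma inMap_lof (M : Rep Q (RightMod R)) {i k : Q} (a : i ⟶ k) (x : M.at i) :
    M.inMap k (DirectSum.lof Rᵐᵒᵖ (Σ j : Q, (j ⟶ k)) (fun a => M.at a.1) ⟨i, a⟩ x) =
      M.arrow a x :=
  DirectSum.toModule_lof (R := Rᵐᵒᵖ) (ι := Σ j : Q, (j ⟶ k)) (M := fun a => M.at a.1)
    (φ := fun a => M.arrow a.2) ⟨i, a⟩ x

/-- The map on the sums over incoming arrows induced by a family of maps. -/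
def inSumMap {X Y : Rep Q (RightMod R)} (r : ∀ i : Q, X.at i →ₗ[Rᵐᵒᵖ] Y.at i) (k : Q) :
    X.InSum k →ₗ[Rᵐᵒᵖ] Y.InSum k :=
  DirectSum.lmap fun a : (Σ j : Q, (j ⟶ k)) => r a.1

open Classical in
lemma inSumMap_lof {X Y : Rep Q (RightMod R)} (r : ∀ i : Q, X.at i →ₗ[Rᵐᵒᵖ] Y.at i) {i k : Q}
    (a : i ⟶ k) (x : X.at i) :
    inSumMap r k (DirectSum.lof Rᵐᵒᵖ (Σ j : Q, (j ⟶ k)) (fun a => X.at a.1) ⟨i, a⟩ x) =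
      DirectSum.lof Rᵐᵒᵖ (Σ j : Q, (j ⟶ k)) (fun a => Y.at a.1) ⟨i, a⟩ (r i x) :=
  DirectSum.lmap_lof _ _ _

lemma inSumMap_apply {X Y : Rep Q (RightMod R)} (r : ∀ i : Q, X.at i →ₗ[Rᵐᵒᵖ] Y.at i) (k : Q)
    (x : X.InSum k) (a : Σ j : Q, (j ⟶ k)) : inSumMap r k x a = r a.1 (x a) := by
  simp [inSumMap, DirectSum.lmap_apply]

open Classical in
lemma inSum_ext {X : Rep Q (RightMod R)} {k : Q} {N : Type*} [AddCommGroup N] [Module Rᵐᵒᵖ N]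
    {f g : X.InSum k →ₗ[Rᵐᵒᵖ] N}
    (h : ∀ (i : Q) (a : i ⟶ k) (x : X.at i),
      f (DirectSum.lof Rᵐᵒᵖ (Σ j : Q, (j ⟶ k)) (fun a => X.at a.1) ⟨i, a⟩ x) =
      g (DirectSum.lof Rᵐᵒᵖ (Σ j : Q, (j ⟶ k)) (fun a => X.at a.1) ⟨i, a⟩ x)) : f = g :=
  DirectSum.linearMap_ext Rᵐᵒᵖ fun a => LinearMap.ext fun x => h a.1 a.2 x

lemma repLin_inMap {X Y : Rep Q (RightMod R)} (f : X ⟶ Y) (k : Q) (x : X.InSum k) :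
    repLin f k (X.inMap k x) = Y.inMap k (inSumMap (fun i => repLin f i) k x) := by
  have : repLin f k ∘ₗ X.inMap k = Y.inMap k ∘ₗ inSumMap (fun i => repLin f i) k :=
    inSum_ext fun i a x =>
      (congrArg (repLin f k) (inMap_lof X a x)).trans ((repLin_arrow f a x).trans
        ((congrArg (Y.inMap k) (inSumMap_lof _ a x)).trans (inMap_lof Y a _)).symm)
  exact LinearMap.congr_fun this x

/-- A family of linear maps compatible with the arrows is a morphism of representations. -/
def repHomOf {X Y : Rep Q (RightMod R)} (r : ∀ i : Q, X.at i →ₗ[Rᵐᵒᵖ] Y.at i)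
    (h : ∀ ⦃i k : Q⦄ (a : i ⟶ k) (x : X.at i), r k (X.arrow a x) = Y.arrow a (r i x)) : X ⟶ Y :=
  repHom (fun i => homOf (r i)) fun _ _ a => linOf_injective (LinearMap.ext fun x => h a x)

lemma repHom_ext {X Y : Rep Q (RightMod R)} {f g : X ⟶ Y}
    (h : ∀ i x, repLin f i x = repLin g i x) : f = g := by
  ext i : 2
  exact linOf_injective (LinearMap.ext fun x => h i x)

/-- Construction of morphisms of representations by recursion over the vertices. -/
lemma exists_repHom [Finite Q] (hQ : IsAcyclicQuiver Q) {X Y : Rep Q (RightMod R)}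
    (P : ∀ k : Q, (X.at k →ₗ[Rᵐᵒᵖ] Y.at k) → Prop)
    (step : ∀ (k : Q) (r : ∀ i : Q, X.at i →ₗ[Rᵐᵒᵖ] Y.at i),
      (∀ (i : Q) (_ : i ⟶ k), P i (r i)) →
      ∃ s, P k s ∧ ∀ (i : Q) (a : i ⟶ k) (x : X.at i), s (X.arrow a x) = Y.arrow a (r i x)) :
    ∃ f : X ⟶ Y, ∀ k, P k (repLin f k) := by
  classical
  have step' : ∀ (k : Q) (r : ∀ i : Q, Nonempty (i ⟶ k) → {s : X.at i →ₗ[Rᵐᵒᵖ] Y.at i // P i s}),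
      ∃ s : {s : X.at k →ₗ[Rᵐᵒᵖ] Y.at k // P k s}, ∀ (i : Q) (a : i ⟶ k) (x : X.at i),
        s.1 (X.arrow a x) = Y.arrow a ((r i ⟨a⟩).1 x) := by
    intro k r
    -- Away from the sources of arrows into `k` the family is padded with zero; nothing that is used
    -- of `step` depends on those values.
    obtain ⟨s, hs, hs'⟩ := step k (fun i => if h : Nonempty (i ⟶ k) then (r i h).1 else 0)
      (fun i a => by
        rw [dif_pos ⟨a⟩]
        exact (r i ⟨a⟩).2)
    refine ⟨⟨s, hs⟩, fun i a x => ?_⟩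
    rw [hs' i a x, dif_pos ⟨a⟩]
  choose F hF using step'
  let s : ∀ k : Q, {s : X.at k →ₗ[Rᵐᵒᵖ] Y.at k // P k s} := hQ.wellFounded.fix F
  have hs : ∀ k, s k = F k (fun i _ => s i) := fun k => hQ.wellFounded.fix_eq F k
  refine ⟨repHomOf (fun k => (s k).1) fun i k a x => ?_, fun k => (s k).2⟩
  rw [hs k]
  exact hF k (fun i _ => s i) i a x

/-- Every system of finitely generated modules and linear maps is isomorphic to a
representation. -/
lemma exists_rep (N : Q → Type*) [∀ k, AddCommGroup (N k)] [∀ k, Module Rᵐᵒᵖ (N k)]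
    [∀ k, Module.Finite Rᵐᵒᵖ (N k)] (φ : ∀ ⦃i k : Q⦄, (i ⟶ k) → (N i →ₗ[Rᵐᵒᵖ] N k)) :
    ∃ (X : Rep Q (RightMod R)) (θ : ∀ k, X.at k ≃ₗ[Rᵐᵒᵖ] N k),
      ∀ ⦃i k : Q⦄ (a : i ⟶ k) (x : X.at i), θ k (X.arrow a x) = φ a (θ i x) := by
  choose N' e using fun k => exists_rightMod R (N k)
  let e' := fun k => (e k).some
  refine ⟨mkRep N' fun i k a => homOf ((e' k).toLinearMap ∘ₗ φ a ∘ₗ (e' i).symm.toLinearMap),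
    fun k => (e' k).symm, fun i k a x => ?_⟩
  unfold Rep.arrow
  rw [mkRep_map]
  exact (e' k).symm_apply_apply _

instance {ι : Type*} [Finite ι] (M : ι → Type*) [∀ i, AddCommGroup (M i)]
    [∀ i, Module Rᵐᵒᵖ (M i)] [∀ i, Module.Finite Rᵐᵒᵖ (M i)] :
    Module.Finite Rᵐᵒᵖ (DirectSum ι M) := by
  classical
  have : Fintype ι := Fintype.ofFinite ι
  exact Module.Finite.equiv (DirectSum.linearEquivFunOnFintype Rᵐᵒᵖ ι M).symm

end Reps

/-! ### The functor from the monomorphism category to stable representations -/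

section MonoFunctor

variable {Q : Type w} [Quiver.{v + 1} Q] {R : Type u} [Ring R]

/-- The map `inMap` of a retract is a retract of `inMap`. Consequently idempotents split inside the
monomorphism category. -/
lemma isMonoRep_of_retract {X Y : Rep Q (RightMod R)} (hX : isMonoRep Q R X) (r : Retract Y X) :
    isMonoRep Q R Y := by
  intro k
  rw [← LinearMap.ker_eq_bot, Submodule.eq_bot_iff]
  intro y hy
  have h1 : X.inMap k (inSumMap (fun i => repLin r.i i) k y) = 0 := by
    rw [← repLin_inMap, LinearMap.mem_ker.1 hy, map_zero]
  have h2 : inSumMap (fun i => repLin r.i i) k y = 0 := hX k (h1.trans (map_zero _).symm)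
  have h3 : inSumMap (fun i => repLin r.r i) k (inSumMap (fun i => repLin r.i i) k y) = y := by
    refine DFinsupp.ext fun a => ?_
    erw [inSumMap_apply, inSumMap_apply]
    have := congrArg (fun f : Y ⟶ Y => repLin f a.1 (y a)) r.retract
    exact this
  rw [← h3, h2, map_zero]

instance {C D : Type*} [Category C] [Category D] [Preadditive D] [IsIdempotentComplete D] :
    IsIdempotentComplete (C ⥤ D) := inferInstance

instance [IsArtinAlg R] : IsIdempotentComplete (MonoRep Q R) where
  idempotents_split X e he := by
    obtain ⟨Y, i, p, h1, h2⟩ := IsIdempotentComplete.idempotents_split X.obj e.hom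
      (congrArg (fun f : X ⟶ X => f.hom) he)
    let Y' : MonoRep Q R := ⟨Y, isMonoRep_of_retract X.property ⟨i, p, h1⟩⟩
    exact ⟨Y', ObjectProperty.homMk (P := isMonoRep Q R) (X := Y') (Y := X) i,
      ObjectProperty.homMk (P := isMonoRep Q R) (X := X) (Y := Y') p,
      ObjectProperty.hom_ext _ h1, ObjectProperty.hom_ext _ h2⟩

end MonoFunctor

end

end QuiverMono

namespace QuiverMono

noncomputable section

set_option linter.unusedSectionVars false

/-! ### Drazin inverses of endomorphisms of representations -/

section Drazin

/-- The Drazin inverse commutes with everything that commutes with the element. -/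
lemma drazin_commute {E : Type*} [Monoid E] {h c x : E} {n : ℕ} (h1 : Commute h c)
    (h2 : c * h * c = c) (h3 : h ^ (n + 1) * c = h ^ n) (hx : Commute x h) : Commute x c := by
  have e1 : ∀ m, c ^ (m + 1) * h ^ m = c := by
    intro m
    induction m with
    | zero => simp
    | succ m ih =>
      rw [pow_succ' c, pow_succ h, mul_assoc, ← mul_assoc (c ^ (m + 1)), ih, h1.symm.eq,
        ← mul_assoc, h2]
  have e1' : ∀ m, h ^ m * c ^ (m + 1) = c := fun m => by
    rw [(h1.pow_pow m (m + 1)).eq, e1 m]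
  have e2 : ∀ m, h ^ (m + 1) * c ^ (m + 1) = h * c := fun m => by
    rw [pow_succ' h, mul_assoc, e1']
  have e2' : c ^ (n + 1) * h ^ (n + 1) = h * c := by
    rw [← (h1.pow_pow (n + 1) (n + 1)).eq, e2]
  have h3' : c * h ^ (n + 1) = h ^ n := by rw [← (h1.pow_left (n + 1)).eq, h3]
  -- Both `x * c` and `c * x` are brought to the common form `c * x * (h * c)`.
  have a1 : x * c = c * x * (h * c) := by
    calc x * c = x * (h ^ n * c ^ (n + 1)) := by rw [e1']
      _ = h ^ n * x * c ^ (n + 1) := by rw [← mul_assoc, (hx.pow_right n).eq]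
      _ = c * (h ^ (n + 1) * x) * c ^ (n + 1) := by rw [← h3', mul_assoc c]
      _ = c * x * (h * c) := by rw [← (hx.pow_right (n + 1)).eq, ← e2 n]; simp only [mul_assoc]
  have a2 : c * x = c * x * (h * c) := by
    calc c * x = c ^ (n + 1) * h ^ n * x := by rw [e1]
      _ = c ^ (n + 1) * (x * h ^ n) := by rw [mul_assoc, (hx.pow_right n).eq]
      _ = c ^ (n + 1) * (x * h ^ (n + 1)) * c := by rw [← h3]; simp only [mul_assoc]
      _ = c ^ (n + 1) * h ^ (n + 1) * x * c := by
        rw [(hx.pow_right (n + 1)).eq]; simp only [mul_assoc]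
      _ = c * (h * x) * c := by rw [e2', h1.eq]; simp only [mul_assoc]
      _ = c * x * (h * c) := by rw [← hx.eq]; simp only [mul_assoc]
  exact a1.trans a2.symm

/-- Drazin inverses are natural. -/
lemma drazin_natural {A M N : Type*} [Ring A] [AddCommGroup M] [Module A M] [AddCommGroup N]
    [Module A N] {h c : Module.End A M} {h' c' : Module.End A N} {n : ℕ} (h1 : Commute h c)
    (h2 : c * h * c = c) (h3 : h ^ (n + 1) * c = h ^ n) (h1' : Commute h' c')
    (h2' : c' * h' * c' = c') (h3' : h' ^ (n + 1) * c' = h' ^ n) (x : M →ₗ[A] N)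
    (hx : ∀ m, x (h m) = h' (x m)) (m : M) : x (c m) = c' (x m) := by
  let F := LinearMap.prodMapRingHom A M N
  -- A map between two modules becomes the endomorphism `(m, n) ↦ (0, x m)` of their product, to
  -- which `drazin_commute` applies.
  have key : Commute (LinearMap.inr A M N ∘ₗ x ∘ₗ LinearMap.fst A M N : Module.End A (M × N))
      (F (c, c')) := by
    refine drazin_commute (h := F (h, h')) (n := n) ?_ ?_ ?_ ?_
    · exact (show Commute (h, h') (c, c') from Prod.ext h1 h1').map F
    · rw [← map_mul, ← map_mul]
      exact congrArg F (Prod.ext h2 h2')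
    · rw [← map_pow, ← map_pow, ← map_mul]
      exact congrArg F (Prod.ext h3 h3')
    · refine LinearMap.ext fun p => Prod.ext ?_ (hx p.1)
      exact (map_zero h).symm
  exact congrArg Prod.snd (LinearMap.congr_fun key (m, 0))

variable {Q : Type w} [Quiver.{v + 1} Q] {R : Type u} [Ring R] [IsArtinAlg R] [Finite Q]

/-- The action of endomorphisms of a monic representation at a vertex. -/
def repEndHom (X : MonoRep Q R) (i : Q) : End X →* Module.End Rᵐᵒᵖ (X.obj.at i) where
  toFun f := repLin (show X ⟶ X from f).hom i
  map_one' := rfl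
  map_mul' _ _ := rfl

lemma repEndHom_ext {X : MonoRep Q R} {f g : End X}
    (h : ∀ i, repEndHom X i f = repEndHom X i g) : f = g :=
  ObjectProperty.hom_ext _ (repHom_ext fun i x => LinearMap.congr_fun (h i) x)

/-- The Drazin inverses at the vertices commute with the arrows by `drazin_natural`. Finiteness of
`Q` provides the common exponent this requires. -/
instance : HasDrazin (MonoRep Q R) where
  drazin X f := by
    choose c n h1 h2 h3 using fun i => isDrazin_end (R := R) (repEndHom X i f)
    obtain ⟨m, hm⟩ := (Set.finite_range n).bddAbove
    have h3' : ∀ i, repEndHom X i f ^ (m + 1) * c i = repEndHom X i f ^ m := by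
      intro i
      obtain ⟨t, ht⟩ := Nat.exists_eq_add_of_le (hm ⟨i, rfl⟩)
      rw [ht, add_comm (n i) t, add_assoc, pow_add, mul_assoc, h3, ← pow_add]
    let c' : X ⟶ X := ObjectProperty.homMk (repHomOf c fun i k a x =>
      (drazin_natural (h1 i) (h2 i) (h3' i) (h1 k) (h2 k) (h3' k) (X.obj.arrow a)
        (fun y => (repLin_arrow (show X ⟶ X from f).hom a y).symm) x).symm)
    have hc : ∀ i, repEndHom X i c' = c i := fun i => rfl
    refine ⟨c', m, ?_, ?_, ?_⟩
    · exact repEndHom_ext fun i => by rw [map_mul, map_mul, hc]; exact h1 i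
    · exact repEndHom_ext fun i => by rw [map_mul, map_mul, hc]; exact h2 i
    · exact repEndHom_ext fun i => by rw [map_mul, map_pow, map_pow, hc]; exact h3' i

end Drazin

/-! ### The functor to stable representations is full -/

section Full

variable {Q : Type w} [Quiver.{v + 1} Q] {R : Type u} [Ring R] [IsArtinAlg R]

lemma toStable_map_directSum_eq_zero {ι : Type*} [Finite ι] [DecidableEq ι] (J : ι → RightMod R)
    (N Y : RightMod R) (e : (DirectSum ι fun i => J i) ≃ₗ[Rᵐᵒᵖ] N) (d : N →ₗ[Rᵐᵒᵖ] Y)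
    (h : ∀ i, (toStable (RightMod R)).map
      (homOf (d ∘ₗ e.toLinearMap ∘ₗ DirectSum.lof Rᵐᵒᵖ ι (fun i => J i) i)) = 0) :
    (toStable (RightMod R)).map (homOf d) = 0 := by
  have : Fintype ι := Fintype.ofFinite ι
  have hd : homOf d = ∑ i, homOf (DirectSum.component Rᵐᵒᵖ ι (fun i => J i) i ∘ₗ
      e.symm.toLinearMap) ≫
      homOf (d ∘ₗ e.toLinearMap ∘ₗ DirectSum.lof Rᵐᵒᵖ ι (fun i => J i) i) := by
    refine linOf_injective (LinearMap.ext fun x => ?_)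
    have hsum : ∀ s : Finset ι, linOf (∑ i ∈ s, homOf (DirectSum.component Rᵐᵒᵖ ι (fun i => J i) i ∘ₗ
      e.symm.toLinearMap) ≫
      homOf (d ∘ₗ e.toLinearMap ∘ₗ DirectSum.lof Rᵐᵒᵖ ι (fun i => J i) i)) x =
        ∑ i ∈ s, d (e (DirectSum.lof Rᵐᵒᵖ ι (fun i => J i) i (e.symm x i))) := by
      intro s
      induction s using Finset.induction_on with
      | empty => rfl
      | insert a s ha ih =>
        rw [Finset.sum_insert ha, Finset.sum_insert ha, linOf_add, LinearMap.add_apply, ih]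
        rfl
    rw [hsum, ← map_sum, ← map_sum]
    have := DirectSum.sum_univ_of (e.symm x)
    change d x = d (e (∑ i, DirectSum.of (fun i => (J i : Type _)) i (e.symm x i)))
    rw [this, e.apply_symm_apply]
  rw [hd, Functor.map_sum]
  exact Finset.sum_eq_zero fun i _ => by rw [Functor.map_comp, h i, comp_zero]

variable (Q R) in
/-- The functor from the monomorphism category to representations in the stable category. -/
abbrev monoToStable : MonoRep Q R ⥤ Rep Q (StableCat (RightMod R)) :=
  (isMonoRep Q R).ι ⋙ (Functor.whiskeringRight (Paths Q) _ _).obj (toStable (RightMod R))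

instance : (monoToStable Q R).Additive where
  map_add {X Y f g} := by
    ext i
    exact (toStable (RightMod R)).map_add

lemma monoToStable_map_eq_zero_iff {X Y : MonoRep Q R} (f : X ⟶ Y) :
    (monoToStable Q R).map f = 0 ↔
      ∀ i : Q, (toStable (RightMod R)).map (homOf (repLin f.hom i)) = 0 := by
  constructor
  · exact fun h i => congrArg (fun t => NatTrans.app t ((Paths.of Q).obj i)) h
  · intro h
    ext i
    exact h i

lemma monoToStable_map_id_eq_zero_iff (X : MonoRep Q R) :
    (monoToStable Q R).map (𝟙 X) = 0 ↔ ∀ i : Q, Injective (X.obj.at i) := by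
  rw [monoToStable_map_eq_zero_iff]
  exact forall_congr' fun i => toStable_map_id_eq_zero_iff (X.obj.at i)

open Classical in
/-- Every morphism of stable representations out of a monic representation can be lifted. -/
lemma exists_lift_stable [Finite Q] [∀ i j : Q, Finite (i ⟶ j)] (hQ : IsAcyclicQuiver Q)
    {X Y : Rep Q (RightMod R)} (hX : isMonoRep Q R X)
    (f : X ⋙ toStable (RightMod R) ⟶ Y ⋙ toStable (RightMod R)) :
    ∃ g : X ⟶ Y, Functor.whiskerRight g (toStable (RightMod R)) = f := by
  have hf : ∀ k : Q, ∃ g : X.at k ⟶ Y.at k, (toStable (RightMod R)).map g =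
      f.app ((Paths.of Q).obj k) := fun k => (toStable (RightMod R)).map_surjective _
  choose f' hf' using hf
  obtain ⟨g, hg⟩ := exists_repHom hQ (X := X) (Y := Y)
    (fun k s => (toStable (RightMod R)).map (homOf s) = f.app ((Paths.of Q).obj k)) (by
    intro k r hr
    obtain ⟨N, ⟨e⟩⟩ := exists_rightMod R (X.InSum k)
    -- The map `d` measures how far the lift `f' k` is from commuting with the components already
    -- constructed. It is stably zero, so it factors through an injective `I`; since `X.inMap k` is
    -- injective, the map to `I` extends to `X_k`. Adding the resulting map corrects `f' k` without
    -- changing its stable class.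
    let d : X.InSum k →ₗ[Rᵐᵒᵖ] Y.at k :=
      Y.inMap k ∘ₗ inSumMap r k - linOf (f' k) ∘ₗ X.inMap k
    have hdx : ∀ x, d x = Y.inMap k (inSumMap r k x) - linOf (f' k) (X.inMap k x) := fun _ => rfl
    have hd : (toStable (RightMod R)).map (homOf (d ∘ₗ e.symm.toLinearMap)) = 0 := by
      refine toStable_map_directSum_eq_zero (fun a : (Σ j : Q, (j ⟶ k)) => X.at a.1) N _ e _ ?_
      rintro ⟨i, a⟩
      have h1 : homOf ((d ∘ₗ e.symm.toLinearMap) ∘ₗ e.toLinearMap ∘ₗ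
          DirectSum.lof Rᵐᵒᵖ (Σ j : Q, (j ⟶ k)) (fun a => X.at a.1) ⟨i, a⟩) =
          homOf (r i) ≫ Y.map ((Paths.of Q).map a) - X.map ((Paths.of Q).map a) ≫ f' k := by
        refine linOf_injective (LinearMap.ext fun x => ?_)
        change d (e.symm (e _)) = Y.arrow a (r i x) - linOf (f' k) (X.arrow a x)
        rw [e.symm_apply_apply, hdx, inSumMap_lof, inMap_lof, inMap_lof]
      rw [h1, Functor.map_sub, Functor.map_comp, Functor.map_comp, hr i a, hf' k, sub_eq_zero]
      exact (f.naturality ((Paths.of Q).map a)).symm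
    obtain ⟨I, α, β, hI, hαβ⟩ := (toStable_map_eq_zero_iff _).1 hd
    obtain ⟨γ, hγ⟩ := exists_extension hI (X.inMap k) (hX k) (linOf α ∘ₗ e.toLinearMap)
    refine ⟨linOf (f' k) + linOf β ∘ₗ γ, ?_, ?_⟩
    · have : homOf (linOf (f' k) + linOf β ∘ₗ γ) = f' k + homOf γ ≫ β := rfl
      rw [this, Functor.map_add, hf' k, toStable_map_eq_zero_iff (homOf γ ≫ β) |>.2
        ⟨I, homOf γ, β, hI, rfl⟩, add_zero]
    · intro i a x
      rw [← inMap_lof, LinearMap.add_apply, LinearMap.comp_apply, hγ]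
      have h2 : linOf β (linOf α (e (DirectSum.lof Rᵐᵒᵖ (Σ j : Q, (j ⟶ k))
          (fun a => X.at a.1) ⟨i, a⟩ x))) = d (DirectSum.lof Rᵐᵒᵖ (Σ j : Q, (j ⟶ k))
          (fun a => X.at a.1) ⟨i, a⟩ x) := by
        have := LinearMap.congr_fun (congrArg linOf hαβ) (e (DirectSum.lof Rᵐᵒᵖ (Σ j : Q, (j ⟶ k))
          (fun a => X.at a.1) ⟨i, a⟩ x))
        refine Eq.trans this.symm ?_
        change d (e.symm (e _)) = _
        rw [e.symm_apply_apply]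
      rw [LinearMap.comp_apply, LinearEquiv.coe_coe, h2, hdx, add_sub_cancel, inSumMap_lof, inMap_lof])
  refine ⟨g, ?_⟩
  ext k
  exact hg k

lemma monoToStable_full [Finite Q] [∀ i j : Q, Finite (i ⟶ j)] (hQ : IsAcyclicQuiver Q) :
    (monoToStable Q R).Full where
  map_surjective {X Y} f := by
    obtain ⟨g, hg⟩ := exists_lift_stable hQ X.property f
    exact ⟨ObjectProperty.homMk g, hg⟩

end Full

end

end QuiverMono

namespace QuiverMono

noncomputable section

set_option linter.unusedSectionVars false

/-! ### Free representations and the injective objects of the monomorphism category -/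

section FreeReps

variable {Q : Type w} [Quiver.{v + 1} Q] {R : Type u} [Ring R]

/-- An identification of `X` with the representation freely generated by the module `A` at the
vertex `j`. -/
structure FreeData (X : Rep Q (RightMod R)) (j : Q) (A : RightMod R) where
  /-- The identification at a vertex. -/
  coord : ∀ k : Q, X.at k ≃ₗ[Rᵐᵒᵖ] (Quiver.Path j k →₀ A)
  coord_arrow : ∀ ⦃i k : Q⦄ (a : i ⟶ k) (x : X.at i),
    coord k (X.arrow a x) = (coord i x).mapDomain fun p => p.cons a

lemma exists_freeRep [Finite Q] [∀ i j : Q, Finite (i ⟶ j)] (hQ : IsAcyclicQuiver Q) (j : Q)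
    (A : RightMod R) : ∃ X : Rep Q (RightMod R), Nonempty (FreeData X j A) := by
  have := fun k => hQ.finite_path j k
  obtain ⟨X, θ, hθ⟩ := exists_rep (R := R) (fun k : Q => (Quiver.Path j k →₀ A))
    (fun i k a => Finsupp.lmapDomain A Rᵐᵒᵖ fun p => p.cons a)
  exact ⟨X, ⟨θ, hθ⟩⟩

namespace FreeData

variable {X Y : Rep Q (RightMod R)} {j : Q} {A B : RightMod R}

/-- The inclusion of the generating module at the summand of a path. -/
def gen (F : FreeData X j A) {k : Q} (p : Quiver.Path j k) : A →ₗ[Rᵐᵒᵖ] X.at k :=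
  (F.coord k).symm.toLinearMap ∘ₗ Finsupp.lsingle p

lemma coord_gen (F : FreeData X j A) {k : Q} (p : Quiver.Path j k) (x : A) :
    F.coord k (F.gen p x) = Finsupp.single p x :=
  (F.coord k).apply_symm_apply _

lemma gen_injective (F : FreeData X j A) {k : Q} (p : Quiver.Path j k) :
    Function.Injective (F.gen p) :=
  (F.coord k).symm.injective.comp (Finsupp.single_injective p)

lemma arrow_gen (F : FreeData X j A) {i k : Q} (p : Quiver.Path j i) (a : i ⟶ k) (x : A) :
    X.arrow a (F.gen p x) = F.gen (p.cons a) x := by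
  apply (F.coord k).injective
  rw [F.coord_arrow, coord_gen, coord_gen, Finsupp.mapDomain_single]

lemma ext_gen (F : FreeData X j A) {k : Q} {N : Type*} [AddCommGroup N] [Module Rᵐᵒᵖ N]
    {f g : X.at k →ₗ[Rᵐᵒᵖ] N} (h : ∀ p x, f (F.gen p x) = g (F.gen p x)) : f = g := by
  have : f ∘ₗ (F.coord k).symm.toLinearMap = g ∘ₗ (F.coord k).symm.toLinearMap :=
    Finsupp.lhom_ext fun p x => h p x
  refine LinearMap.ext fun x => ?_
  have h2 := LinearMap.congr_fun this (F.coord k x)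
  simpa using h2

/-- Morphisms out of a free representation are determined by the generating module. -/
lemma hom_ext (F : FreeData X j A) {f g : X ⟶ Y}
    (h : ∀ x, repLin f j (F.gen Quiver.Path.nil x) = repLin g j (F.gen Quiver.Path.nil x)) :
    f = g := by
  have key : ∀ (k : Q) (p : Quiver.Path j k) (x : A),
      repLin f k (F.gen p x) = repLin g k (F.gen p x) := by
    intro k p x
    induction p with
    | nil => exact h x
    | cons p a ih => rw [← F.arrow_gen, repLin_arrow, repLin_arrow, ih]
  exact repHom_ext fun i x => LinearMap.congr_fun (F.ext_gen (key i)) x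

/-- Linear maps out of the generating module extend to the free representation. -/
lemma exists_hom (F : FreeData X j A) (a : A →ₗ[Rᵐᵒᵖ] Y.at j) :
    ∃ f : X ⟶ Y, ∀ x, repLin f j (F.gen Quiver.Path.nil x) = a x := by
  let path : ∀ {k : Q} (p : Quiver.Path j k), Y.at j →ₗ[Rᵐᵒᵖ] Y.at k := fun {k} p =>
    linOf (Y.map (show (Paths.of Q).obj j ⟶ (Paths.of Q).obj k from p))
  have hcons : ∀ {i k : Q} (p : Quiver.Path j i) (b : i ⟶ k) (y : Y.at j),
      path (p.cons b) y = Y.arrow b (path p y) := fun {i k} p b y =>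
    LinearMap.congr_fun (congrArg linOf (Y.map_comp
      (show (Paths.of Q).obj j ⟶ (Paths.of Q).obj i from p) ((Paths.of Q).map b))) y
  let r : ∀ k : Q, X.at k →ₗ[Rᵐᵒᵖ] Y.at k := fun k =>
    (Finsupp.lsum ℕ fun p => path p ∘ₗ a) ∘ₗ (F.coord k).toLinearMap
  have hr : ∀ {k : Q} (p : Quiver.Path j k) (x : A), r k (F.gen p x) = path p (a x) := by
    intro k p x
    change Finsupp.lsum ℕ (fun p => path p ∘ₗ a) (F.coord k (F.gen p x)) = _
    rw [coord_gen, Finsupp.lsum_single]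
    rfl
  refine ⟨repHomOf r fun i k b => ?_, fun x => ?_⟩
  · intro x
    have : r k ∘ₗ X.arrow b = Y.arrow b ∘ₗ r i := F.ext_gen fun p x => by
      exact (congrArg (r k) (F.arrow_gen p b x)).trans ((hr _ x).trans
        ((hcons p b _).trans (congrArg _ (hr p x)).symm))
    exact LinearMap.congr_fun this x
  · refine (hr Quiver.Path.nil x).trans ?_
    exact LinearMap.congr_fun (congrArg linOf (Y.map_id ((Paths.of Q).obj j))) (a x)

/-- Functoriality of free representations. -/
def map (F : FreeData X j A) (G : FreeData Y j B) (u : A →ₗ[Rᵐᵒᵖ] B) : X ⟶ Y :=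
  repHomOf (fun k => (G.coord k).symm.toLinearMap ∘ₗ Finsupp.mapRange.linearMap u ∘ₗ
    (F.coord k).toLinearMap) fun i k a x => by
      apply (G.coord k).injective
      rw [G.coord_arrow]
      simp only [LinearMap.comp_apply, LinearEquiv.coe_coe, LinearEquiv.apply_symm_apply,
        F.coord_arrow, Finsupp.mapRange.linearMap_apply]
      rw [Finsupp.mapDomain_mapRange]
      exact fun x y => map_add u x y

lemma coord_map (F : FreeData X j A) (G : FreeData Y j B) (u : A →ₗ[Rᵐᵒᵖ] B) (k : Q)
    (x : X.at k) : G.coord k (repLin (F.map G u) k x) =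
      Finsupp.mapRange u (map_zero u) (F.coord k x) :=
  (G.coord k).apply_symm_apply _

lemma map_gen (F : FreeData X j A) (G : FreeData Y j B) (u : A →ₗ[Rᵐᵒᵖ] B) {k : Q}
    (p : Quiver.Path j k) (x : A) : repLin (F.map G u) k (F.gen p x) = G.gen p (u x) := by
  apply (G.coord k).injective
  rw [coord_map, coord_gen, coord_gen, Finsupp.mapRange_single]

-- A nontrivial path determines its last arrow and the path before it. So the coordinate of `inMap
-- x` at `p.cons a` is the coordinate at `p` of the component of `x` at `a`, and `x` can be
-- recovered from its image.
open Classical in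
lemma isMonoRep (F : FreeData X j A) : isMonoRep Q R X := by
  intro k
  rw [← LinearMap.ker_eq_bot, Submodule.eq_bot_iff]
  intro x hx
  refine DFinsupp.ext fun ⟨i, a⟩ => ?_
  apply (F.coord i).injective
  ext p
  have key : (Finsupp.lapply (p.cons a) ∘ₗ (F.coord k).toLinearMap) ∘ₗ X.inMap k =
      Finsupp.lapply p ∘ₗ (F.coord i).toLinearMap ∘ₗ
        DirectSum.component Rᵐᵒᵖ (Σ j : Q, (j ⟶ k)) (fun a => X.at a.1) ⟨i, a⟩ := by
    refine inSum_ext fun i' a' y => ?_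
    simp only [LinearMap.comp_apply, LinearEquiv.coe_coe, Finsupp.lapply_apply]
    rw [inMap_lof, F.coord_arrow]
    by_cases h : (⟨i', a'⟩ : Σ j : Q, (j ⟶ k)) = ⟨i, a⟩
    · obtain ⟨rfl, h⟩ := Sigma.mk.inj_iff.1 h
      obtain rfl := eq_of_heq h
      rw [DirectSum.component.lof_self]
      exact Finsupp.mapDomain_apply (fun p q h => by simpa using h) _ _
    · rw [DirectSum.component.of]
      rw [dif_neg h, map_zero, Finsupp.mapDomain_of_notMem_range]
      · rfl
      · rintro ⟨q, hq⟩
        apply h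
        simp only [Quiver.Path.cons.injEq] at hq
        obtain ⟨rfl, -, h2⟩ := hq
        rw [eq_of_heq h2]
  have h2 := LinearMap.congr_fun key x
  rw [LinearMap.comp_apply, LinearMap.mem_ker.1 hx, map_zero] at h2
  exact h2.symm.trans (by change (0 : A) = (F.coord i 0) p; rw [map_zero]; rfl)

end FreeData

lemma baer_pi {A : Type*} [Ring A] {ι : Type*} (M : ι → Type*) [∀ i, AddCommGroup (M i)]
    [∀ i, Module A (M i)] (h : ∀ i, Module.Baer A (M i)) : Module.Baer A (∀ i, M i) := by
  intro I g
  choose f hf using fun i => h i I (LinearMap.proj i ∘ₗ g)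
  exact ⟨LinearMap.pi f, fun x hx => funext fun i => hf i x hx⟩

lemma FreeData.injective [IsArtinAlg R] {X : Rep Q (RightMod R)} {j : Q} {A : RightMod R}
    (F : FreeData X j A) (hA : Injective A) (k : Q) [Finite (Quiver.Path j k)] :
    Injective (X.at k) := by
  rw [injective_iff_baer] at hA ⊢
  exact (baer_pi _ fun _ => hA).of_equiv ((F.coord k).trans
    (Finsupp.linearEquivFunOnFinite Rᵐᵒᵖ A (Quiver.Path j k))).symm

lemma FreeData.cls_eq [IsArtinAlg R] {X : Rep Q (RightMod R)} {j : Q} {A : RightMod R}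
    (F : FreeData X j A) (k : Q) [Finite (Quiver.Path j k)] :
    cls (X.at k) = Nat.card (Quiver.Path j k) • cls A := by
  rw [cls_pi (fun _ : Quiver.Path j k => A) (X.at k) ((F.coord k).trans
    (Finsupp.linearEquivFunOnFinite Rᵐᵒᵖ A (Quiver.Path j k)))]
  have : Fintype (Quiver.Path j k) := Fintype.ofFinite _
  rw [finsum_eq_sum_of_fintype, Finset.sum_const, Nat.card_eq_fintype_card, Finset.card_univ]

variable [IsArtinAlg R] [Finite Q] [∀ i j : Q, Finite (i ⟶ j)]

/-- Generating a free representation at `k` is left adjoint to evaluation at `k` and turns short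
exact sequences of modules into conflations. The lifting problem for `A → B` at `k` thus becomes one
in the monomorphism category. -/
lemma IsInjMono.injective_at (hQ : IsAcyclicQuiver Q) {I : MonoRep Q R} (hI : IsInjMono I)
    (k : Q) : Injective (I.obj.at k) := by
  refine ⟨fun {A B} h g hg => ?_⟩
  have hg' := (injective_linOf_iff_mono g).2 hg
  let C : RightMod R := FGModuleCat.of Rᵐᵒᵖ (B ⧸ LinearMap.range (linOf g))
  let q : B →ₗ[Rᵐᵒᵖ] C := (LinearMap.range (linOf g)).mkQ
  obtain ⟨X, ⟨FX⟩⟩ := exists_freeRep hQ k A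
  obtain ⟨Y, ⟨FY⟩⟩ := exists_freeRep hQ k B
  obtain ⟨Z, ⟨FZ⟩⟩ := exists_freeRep hQ k C
  let X' : MonoRep Q R := ⟨X, FX.isMonoRep⟩
  let Y' : MonoRep Q R := ⟨Y, FY.isMonoRep⟩
  let Z' : MonoRep Q R := ⟨Z, FZ.isMonoRep⟩
  let f : X' ⟶ Y' := ObjectProperty.homMk (FX.map FY (linOf g))
  let p : Y' ⟶ Z' := ObjectProperty.homMk (FY.map FZ q)
  have hconf : IsConflation f p := by
    intro i
    refine ⟨?_, ?_, ?_⟩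
    · intro x y hxy
      have := congrArg (FY.coord i) hxy
      change FY.coord i (repLin (FX.map FY (linOf g)) i x) =
        FY.coord i (repLin (FX.map FY (linOf g)) i y) at this
      rw [FX.coord_map, FX.coord_map] at this
      exact (FX.coord i).injective (Finsupp.mapRange_injective _ _ hg' this)
    · intro y
      change repLin (FY.map FZ q) i y = 0 ↔ ∃ x, repLin (FX.map FY (linOf g)) i x = y
      rw [← (FZ.coord i).map_eq_zero_iff, FY.coord_map]
      constructor
      · intro h0
        -- Preimages are chosen with `0` sent to `0`, as applying the choice to finitely supported
        -- functions demands.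
        have hs : ∀ b : B, ∃ a : A, (b = 0 → a = 0) ∧ (q b = 0 → linOf g a = b) := by
          intro b
          by_cases hb : b = 0
          · exact ⟨0, fun _ => rfl, fun _ => by rw [hb, map_zero]⟩
          · by_cases hq : q b = 0
            · obtain ⟨a, ha⟩ := (Submodule.Quotient.mk_eq_zero _).1 hq
              exact ⟨a, fun h => absurd h hb, fun _ => ha⟩
            · exact ⟨0, fun _ => rfl, fun h => absurd h hq⟩
        choose s hs1 hs2 using hs
        refine ⟨(FX.coord i).symm (Finsupp.mapRange s (hs1 0 rfl) (FY.coord i y)), ?_⟩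
        apply (FY.coord i).injective
        rw [FX.coord_map, LinearEquiv.apply_symm_apply]
        ext t
        simp only [Finsupp.mapRange_apply]
        refine hs2 _ ?_
        exact DFunLike.congr_fun h0 t
      · rintro ⟨x, rfl⟩
        rw [FX.coord_map]
        ext t
        simp only [Finsupp.mapRange_apply]
        exact (Submodule.Quotient.mk_eq_zero _).2 ⟨_, rfl⟩
    · intro z
      obtain ⟨y, hy⟩ := Finsupp.mapRange_surjective q (map_zero q)
        (Submodule.mkQ_surjective _) (FZ.coord i z)
      refine ⟨(FY.coord i).symm y, ?_⟩
      apply (FZ.coord i).injective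
      change FZ.coord i (repLin (FY.map FZ q) i _) = _
      rw [FY.coord_map, LinearEquiv.apply_symm_apply, hy]
  obtain ⟨φ, hφ⟩ := FX.exists_hom (linOf h : A →ₗ[Rᵐᵒᵖ] I.obj.at k)
  obtain ⟨ψ, hψ⟩ := hI f p hconf (ObjectProperty.homMk (X := X') φ)
  refine ⟨homOf (repLin ψ.hom k ∘ₗ FY.gen Quiver.Path.nil), linOf_injective (LinearMap.ext fun x => ?_)⟩
  have h1 : f.hom ≫ ψ.hom = φ := congrArg (fun t : X' ⟶ I => t.hom) hψ
  have h2 := LinearMap.congr_fun (congrArg (fun t : X ⟶ I.obj => repLin t k) h1)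
    (FX.gen Quiver.Path.nil x)
  refine Eq.trans ?_ (h2.trans (hφ x))
  change repLin ψ.hom k (FY.gen Quiver.Path.nil (linOf g x)) =
    repLin ψ.hom k (repLin (FX.map FY (linOf g)) k (FX.gen Quiver.Path.nil x))
  rw [FX.map_gen]

/-- Recursion over the vertices: at `k` the extension is prescribed on the images of `X_k` and of
`Y.inMap k`. The prescriptions agree on the overlap because `Z` is monic: an element of `Y.InSum k`
whose image in `Y_k` comes from `X_k` already comes from `X.InSum k`. -/
lemma isInjMono_of_injective_at (hQ : IsAcyclicQuiver Q) {I : MonoRep Q R}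
    (hI : ∀ k : Q, Injective (I.obj.at k)) : IsInjMono I := by
  intro X Y Z f g hfg h
  obtain ⟨t, ht⟩ := exists_repHom hQ (X := Y.obj) (Y := I.obj)
    (fun k s => ∀ x, s (repLin f.hom k x) = repLin h.hom k x) (by
    intro k r hr
    obtain ⟨s, hs⟩ := exists_extension_of_ker_le (hI k)
      ((repLin f.hom k).coprod (Y.obj.inMap k))
      ((repLin h.hom k).coprod (I.obj.inMap k ∘ₗ inSumMap r k)) (by
        rintro ⟨x, y⟩ hxy
        have hxy' : repLin f.hom k x + Y.obj.inMap k y = 0 := hxy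
        change repLin h.hom k x + I.obj.inMap k (inSumMap r k y) = 0
        have hgf : ∀ i (x : X.obj.at i), repLin g.hom i (repLin f.hom i x) = 0 := fun i x =>
          ((hfg i).2.1 _).2 ⟨x, rfl⟩
        have h1 : Z.obj.inMap k (inSumMap (fun i => repLin g.hom i) k y) = 0 := by
          rw [← repLin_inMap]
          have := congrArg (repLin g.hom k) hxy'
          rwa [map_add, hgf, zero_add, map_zero] at this
        have h2 := Z.property k (h1.trans (map_zero _).symm)
        have h3 : ∀ a, ∃ x' : X.obj.at a.1, repLin f.hom a.1 x' = y a := fun a =>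
          ((hfg a.1).2.1 (y a)).1 (by
            have := DFunLike.congr_fun h2 a
            rwa [inSumMap_apply] at this)
        have h4 : ∃ y' : X.obj.InSum k, inSumMap (fun i => repLin f.hom i) k y' = y := by
          choose x' hx' using h3
          classical
          have : Fintype (Σ j : Q, (j ⟶ k)) := Fintype.ofFinite _
          refine ⟨(DirectSum.linearEquivFunOnFintype Rᵐᵒᵖ (Σ j : Q, (j ⟶ k))
            (fun a => X.obj.at a.1)).symm x', DFinsupp.ext fun a => ?_⟩
          refine (inSumMap_apply _ _ _ _).trans ?_
          rw [← hx' a]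
          exact congrArg _ (congrFun ((DirectSum.linearEquivFunOnFintype Rᵐᵒᵖ (Σ j : Q, (j ⟶ k))
            (fun a => X.obj.at a.1)).apply_symm_apply x') a)
        obtain ⟨y', rfl⟩ := h4
        rw [← repLin_inMap, ← map_add] at hxy'
        have h5 : x + X.obj.inMap k y' = 0 := (hfg k).1 (hxy'.trans (map_zero _).symm)
        have h6 : inSumMap r k (inSumMap (fun i => repLin f.hom i) k y') =
            inSumMap (fun i => repLin h.hom i) k y' := by
          refine DFinsupp.ext fun a => ?_
          refine (inSumMap_apply _ _ _ _).trans ((congrArg _ (inSumMap_apply _ _ _ _)).trans ?_)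
          exact (hr a.1 a.2 _).trans (inSumMap_apply _ _ _ _).symm
        rw [h6, ← repLin_inMap, ← map_add, h5, map_zero])
    refine ⟨s, fun x => ?_, fun i a x => ?_⟩
    · simpa using hs (x, 0)
    · classical
      have := hs (0, DirectSum.lof Rᵐᵒᵖ (Σ j : Q, (j ⟶ k)) (fun a => Y.obj.at a.1) ⟨i, a⟩ x)
      simp only [LinearMap.coprod_apply, map_zero, zero_add, LinearMap.comp_apply] at this
      rwa [inMap_lof, inSumMap_lof, inMap_lof] at this)
  exact ⟨ObjectProperty.homMk t, ObjectProperty.hom_ext _ (repHom_ext fun i x => ht i x)⟩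

lemma isInjMono_iff (hQ : IsAcyclicQuiver Q) (X : MonoRep Q R) :
    IsInjMono X ↔ (monoToStable Q R).map (𝟙 X) = 0 := by
  rw [monoToStable_map_id_eq_zero_iff]
  exact ⟨fun h => h.injective_at hQ, isInjMono_of_injective_at hQ⟩

/-- The indecomposable injective objects are the free representations on indecomposable injective
modules. -/
lemma exists_freeData_of_injective (hQ : IsAcyclicQuiver Q) {X : MonoRep Q R} (hX : IsIndec X)
    (hI : IsInjMono X) :
    ∃ (j : Q) (J : RightMod R), IsIndec J ∧ Injective J ∧ Nonempty (FreeData X.obj j J) := by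
  have hne : ∃ k : Q, ¬ Subsingleton (X.obj.at k) := by
    by_contra h
    push Not at h
    apply hX.1
    rw [IsZero.iff_id_eq_zero]
    exact ObjectProperty.hom_ext _ (repHom_ext fun i x => @Subsingleton.elim _ (h i) _ _)
  -- At a source `j` of the support, the free representation on `X_j` maps to `X`. The aim is to
  -- split this map, so that it is an isomorphism by indecomposability.
  obtain ⟨j, hj, hmin⟩ := hQ.wellFounded.has_min {k : Q | ¬ Subsingleton (X.obj.at k)} hne
  have hmin' : ∀ i : Q, (i ⟶ j) → Subsingleton (X.obj.at i) := fun i a => by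
    by_contra h
    exact hmin i h ⟨a⟩
  have hinj := hI.injective_at hQ
  obtain ⟨Y, ⟨F⟩⟩ := exists_freeRep hQ j (X.obj.at j)
  have := fun k => hQ.finite_path j k
  obtain ⟨f, hf⟩ := F.exists_hom (Y := X.obj) LinearMap.id
  -- The retraction is prescribed only at `j`; elsewhere it extends because the modules of `Y` are
  -- injective and `X` is monic. Speaking of paths of length zero instead of `k = j` avoids
  -- transport along an equality of vertices.
  obtain ⟨g, hg⟩ := exists_repHom hQ (X := X.obj) (Y := Y)
    (fun k s => ∀ (p : Quiver.Path j k), p.length = 0 → ∀ x : X.obj.at j,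
      s (linOf (X.obj.map (show (Paths.of Q).obj j ⟶ (Paths.of Q).obj k from p)) x) =
        F.gen p x) (by
    intro k r hr
    by_cases h : ∃ p : Quiver.Path j k, p.length = 0
    · obtain ⟨p, hp⟩ := h
      cases p with
      | cons p a => simp at hp
      | nil =>
        refine ⟨F.gen Quiver.Path.nil, fun p hp x => ?_, fun i a x => ?_⟩
        · rw [hQ j p]
          exact congrArg _ (LinearMap.congr_fun
            (congrArg linOf (X.obj.map_id ((Paths.of Q).obj j))) x)
        · have := hmin' i a
          rw [Subsingleton.elim x 0, map_zero, map_zero, map_zero, map_zero]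
    · classical
      obtain ⟨s, hs⟩ := exists_extension (F.injective (hinj j) k) (X.obj.inMap k) (X.property k)
        (Y.inMap k ∘ₗ inSumMap r k)
      refine ⟨s, fun p hp => absurd ⟨p, hp⟩ h, fun i a x => ?_⟩
      rw [← inMap_lof, hs, LinearMap.comp_apply, inSumMap_lof, inMap_lof])
  have hfg : f ≫ g = 𝟙 Y := F.hom_ext fun x => by
    refine Eq.trans (congrArg (repLin g j) (hf x)) ?_
    refine Eq.trans ?_ (hg j Quiver.Path.nil rfl x)
    exact congrArg _ (LinearMap.congr_fun
      (congrArg linOf (X.obj.map_id ((Paths.of Q).obj j))) x).symm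
  let Y' : MonoRep Q R := ⟨Y, F.isMonoRep⟩
  let r : Retract Y' X := ⟨ObjectProperty.homMk f, ObjectProperty.homMk g,
    ObjectProperty.hom_ext _ hfg⟩
  have hiso : IsIso r.i := by
    refine (hX.retract_isZero_or_isIso r).resolve_left fun h => hj ⟨fun x y => ?_⟩
    apply F.gen_injective Quiver.Path.nil
    rw [IsZero.iff_id_eq_zero] at h
    have h0 : ∀ z : Y.at j, z = 0 := fun z =>
      LinearMap.congr_fun (congrArg (fun t : Y' ⟶ Y' => repLin t.hom j) h) z
    rw [h0 (F.gen _ x), h0 (F.gen _ y)]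
  let φ : Y ≅ X.obj := (isMonoRep Q R).ι.mapIso (asIso r.i)
  have hindec : IsIndec (X.obj.at j) := by
    refine isIndec_of_idem (fun h => hj ((isZero_iff_subsingleton _).1 h)) fun e he => ?_
    have hY : IsIndec Y' := hX.of_iso (asIso r.i).symm
    have he' : ∀ x, linOf e (linOf e x) = linOf e x := fun x =>
      LinearMap.congr_fun (congrArg linOf he) x
    rcases hY.idem (ObjectProperty.homMk (X := Y') (Y := Y') (F.map F (linOf e)))
      (ObjectProperty.hom_ext _ (F.hom_ext fun x => by
        change repLin (F.map F (linOf e)) j (repLin (F.map F (linOf e)) j _) =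
          repLin (F.map F (linOf e)) j _
        rw [F.map_gen, F.map_gen, he'])) with h | h
    · left
      refine linOf_injective (LinearMap.ext fun x => F.gen_injective Quiver.Path.nil ?_)
      rw [← F.map_gen F]
      refine Eq.trans (LinearMap.congr_fun (congrArg (fun t : Y' ⟶ Y' => repLin t.hom j) h) _) ?_
      exact (map_zero (F.gen Quiver.Path.nil)).symm
    · right
      refine linOf_injective (LinearMap.ext fun x => F.gen_injective Quiver.Path.nil ?_)
      rw [← F.map_gen F]
      exact LinearMap.congr_fun (congrArg (fun t : Y' ⟶ Y' => repLin t.hom j) h) _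
  refine ⟨j, X.obj.at j, hindec, hinj j, ⟨⟨fun k =>
    (equivOf (φ.app ((Paths.of Q).obj k))).symm ≪≫ₗ F.coord k, fun i k a x => ?_⟩⟩⟩
  have h1 : (equivOf (φ.app ((Paths.of Q).obj k))).symm (X.obj.arrow a x) =
      Y.arrow a ((equivOf (φ.app ((Paths.of Q).obj i))).symm x) := repLin_arrow φ.inv a x
  rw [LinearEquiv.trans_apply, h1, F.coord_arrow]
  rfl

/-- Free representations on indecomposable injective modules are indecomposable injective. -/
lemma FreeData.isIndec_and_isInjMono (hQ : IsAcyclicQuiver Q) {X : MonoRep Q R} {j : Q}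
    {J : RightMod R} (F : FreeData X.obj j J) (hJ : IsIndec J) (hJ' : Injective J) :
    IsIndec X ∧ IsInjMono X := by
  have := fun k => hQ.finite_path j k
  refine ⟨?_, isInjMono_of_injective_at hQ fun k => F.injective hJ' k⟩
  refine isIndec_of_idem (fun h => hJ.1 ?_) fun e he => ?_
  · rw [isZero_iff_subsingleton]
    rw [IsZero.iff_id_eq_zero] at h
    have h0 : ∀ z : X.obj.at j, z = 0 := fun z =>
      LinearMap.congr_fun (congrArg (fun t : X ⟶ X => repLin t.hom j) h) z
    exact ⟨fun x y => F.gen_injective Quiver.Path.nil (by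
      rw [h0 (F.gen _ x), h0 (F.gen _ y)])⟩
  · let ev : X.obj.at j →ₗ[Rᵐᵒᵖ] J := Finsupp.lapply Quiver.Path.nil ∘ₗ (F.coord j).toLinearMap
    have hev : ∀ x, F.gen Quiver.Path.nil (ev x) = x := fun x => by
      apply (F.coord j).injective
      rw [F.coord_gen]
      ext p
      rw [hQ j p, Finsupp.single_eq_same]
      rfl
    have hev' : ∀ x, ev (F.gen Quiver.Path.nil x) = x := fun x => F.gen_injective _ (hev _)
    let ε : J ⟶ J := homOf (ev ∘ₗ repLin e.hom j ∘ₗ F.gen Quiver.Path.nil)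
    have hε : ε ≫ ε = ε := linOf_injective (LinearMap.ext fun x => by
      change ev (repLin e.hom j (F.gen Quiver.Path.nil (ev (repLin e.hom j _)))) = ev _
      rw [hev]
      exact congrArg ev (LinearMap.congr_fun (congrArg (fun t : X ⟶ X => repLin t.hom j) he) _))
    have hεe : ∀ x, repLin e.hom j (F.gen Quiver.Path.nil x) = F.gen Quiver.Path.nil (linOf ε x) :=
      fun x => (hev _).symm
    rcases hJ.idem ε hε with h | h
    · left
      refine ObjectProperty.hom_ext _ (F.hom_ext fun x => ?_)
      rw [hεe, h]
      exact map_zero _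
    · right
      refine ObjectProperty.hom_ext _ (F.hom_ext fun x => ?_)
      rw [hεe, h]
      rfl

end FreeReps

end

end QuiverMono

namespace QuiverMono

noncomputable section

set_option linter.unusedSectionVars false

/-! ### The Mimo-construction -/

section Mimo

variable {Q : Type w} [Quiver.{v + 1} Q] {R : Type u} [Ring R]

open Classical in
/-- The map on the sums over paths given by composition with an arrow. -/
def pushPath (J : Q → RightMod R) {i k : Q} (β : i ⟶ k) :
    (DirectSum (Σ j : Q, Quiver.Path j i) fun p => J p.1) →ₗ[Rᵐᵒᵖ]
      DirectSum (Σ j : Q, Quiver.Path j k) fun p => J p.1 :=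
  DirectSum.toModule Rᵐᵒᵖ (Σ j : Q, Quiver.Path j i) _ (fun p =>
    DirectSum.lof Rᵐᵒᵖ (Σ j : Q, Quiver.Path j k) (fun q => J q.1) ⟨p.1, p.2.cons β⟩)

section

variable (J : Q → RightMod R) {i k : Q} (β : i ⟶ k)

open Classical in
lemma pushPath_lof (p : Σ j : Q, Quiver.Path j i) (x : J p.1) :
    pushPath J β (DirectSum.lof Rᵐᵒᵖ (Σ j : Q, Quiver.Path j i) (fun p => J p.1) p x) =
      DirectSum.lof Rᵐᵒᵖ (Σ j : Q, Quiver.Path j k) (fun q => J q.1) ⟨p.1, p.2.cons β⟩ x :=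
  DirectSum.toModule_lof (R := Rᵐᵒᵖ) (ι := Σ j : Q, Quiver.Path j i) (M := fun p => J p.1)
    (φ := fun p => DirectSum.lof Rᵐᵒᵖ (Σ j : Q, Quiver.Path j k) (fun q => J q.1)
      ⟨p.1, p.2.cons β⟩) p x

open Classical in
lemma pushPath_nil (z : DirectSum (Σ j : Q, Quiver.Path j i) fun p => J p.1) :
    pushPath J β z ⟨k, Quiver.Path.nil⟩ = 0 := by
  have : DirectSum.component Rᵐᵒᵖ (Σ j : Q, Quiver.Path j k) (fun p => J p.1)
      ⟨k, Quiver.Path.nil⟩ ∘ₗ pushPath J β = 0 := by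
    refine DirectSum.linearMap_ext Rᵐᵒᵖ fun p => LinearMap.ext fun x => ?_
    rw [LinearMap.comp_apply, LinearMap.comp_apply, LinearMap.zero_comp, LinearMap.zero_apply,
      pushPath_lof, DirectSum.component.of, dif_neg]
    rintro h
    have := congrArg (fun t : Σ j : Q, Quiver.Path j k => t.2.length) h
    simp at this
  exact LinearMap.congr_fun this z

open Classical in
lemma pushPath_cons (z : DirectSum (Σ j : Q, Quiver.Path j i) fun p => J p.1)
    (p : Σ j : Q, Quiver.Path j i) : pushPath J β z ⟨p.1, p.2.cons β⟩ = z p := by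
  have : DirectSum.component Rᵐᵒᵖ (Σ j : Q, Quiver.Path j k) (fun p => J p.1)
      ⟨p.1, p.2.cons β⟩ ∘ₗ pushPath J β =
      DirectSum.component Rᵐᵒᵖ (Σ j : Q, Quiver.Path j i) (fun p => J p.1) p := by
    refine DirectSum.linearMap_ext Rᵐᵒᵖ fun q => LinearMap.ext fun x => ?_
    rw [LinearMap.comp_apply, LinearMap.comp_apply, LinearMap.comp_apply, pushPath_lof]
    by_cases h : q = p
    · subst h
      rw [DirectSum.component.lof_self, DirectSum.component.lof_self]
    · rw [DirectSum.component.of, DirectSum.component.of, dif_neg h, dif_neg]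
      intro h'
      apply h
      obtain ⟨a, q⟩ := q
      obtain ⟨b, p⟩ := p
      obtain ⟨rfl, h'⟩ := Sigma.mk.inj_iff.1 h'
      have := Quiver.Path.cons.inj (eq_of_heq h')
      exact congrArg (Sigma.mk a) (eq_of_heq this.2.1)
  exact LinearMap.congr_fun this z

open Classical in
lemma pushPath_cons_ne (z : DirectSum (Σ j : Q, Quiver.Path j i) fun p => J p.1)
    {j i' : Q} (p : Quiver.Path j i') (γ : i' ⟶ k)
    (h : (⟨i, β⟩ : Σ i : Q, (i ⟶ k)) ≠ ⟨i', γ⟩) : pushPath J β z ⟨j, p.cons γ⟩ = 0 := by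
  have : DirectSum.component Rᵐᵒᵖ (Σ j : Q, Quiver.Path j k) (fun p => J p.1)
      ⟨j, p.cons γ⟩ ∘ₗ pushPath J β = 0 := by
    refine DirectSum.linearMap_ext Rᵐᵒᵖ fun q => LinearMap.ext fun x => ?_
    rw [LinearMap.comp_apply, LinearMap.comp_apply, LinearMap.zero_comp, LinearMap.zero_apply,
      pushPath_lof, DirectSum.component.of, dif_neg]
    intro h'
    apply h
    obtain ⟨a, q⟩ := q
    obtain ⟨rfl, h'⟩ := Sigma.mk.inj_iff.1 h'
    have := Quiver.Path.cons.inj (eq_of_heq h')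
    obtain ⟨rfl, -, h2⟩ := this
    rw [eq_of_heq h2]
  exact LinearMap.congr_fun this z

end

section

variable (B : Rep Q (RightMod R)) (J : Q → RightMod R)
  (e : ∀ i : Q, B.InSum i →ₗ[Rᵐᵒᵖ] J i) {i k : Q} (β : i ⟶ k)

lemma moArrow_fst (y : MoObj B J i) : (moArrow B J e β y).1 = B.arrow β y.1 :=
  add_zero _

open Classical in
lemma moArrow_snd (y : MoObj B J i) : (moArrow B J e β y).2 =
    DirectSum.lof Rᵐᵒᵖ (Σ j : Q, Quiver.Path j k) (fun p => J p.1) ⟨k, Quiver.Path.nil⟩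
      (e k (DirectSum.lof Rᵐᵒᵖ (Σ j : Q, (j ⟶ k)) (fun a => B.at a.1) ⟨i, β⟩ y.1)) +
    pushPath J β y.2 := rfl

open Classical in
lemma moArrow_nil (y : MoObj B J i) : (moArrow B J e β y).2 ⟨k, Quiver.Path.nil⟩ =
    e k (DirectSum.lof Rᵐᵒᵖ (Σ j : Q, (j ⟶ k)) (fun a => B.at a.1) ⟨i, β⟩ y.1) := by
  rw [moArrow_snd, DirectSum.add_apply, pushPath_nil, add_zero,
    DirectSum.apply_eq_component Rᵐᵒᵖ, DirectSum.component.lof_self]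

open Classical in
lemma moArrow_cons (y : MoObj B J i) (p : Σ j : Q, Quiver.Path j i) :
    (moArrow B J e β y).2 ⟨p.1, p.2.cons β⟩ = y.2 p := by
  rw [moArrow_snd, DirectSum.add_apply, pushPath_cons,
    DirectSum.apply_eq_component Rᵐᵒᵖ (DirectSum.lof _ _ _ _ _), DirectSum.component.of, dif_neg,
    zero_add]
  intro h
  have := congrArg (fun t : Σ j : Q, Quiver.Path j k => t.2.length) h
  simp at this

open Classical in
lemma moArrow_cons_ne (y : MoObj B J i) {j i' : Q} (p : Quiver.Path j i') (γ : i' ⟶ k)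
    (h : (⟨i, β⟩ : Σ i : Q, (i ⟶ k)) ≠ ⟨i', γ⟩) : (moArrow B J e β y).2 ⟨j, p.cons γ⟩ = 0 := by
  rw [moArrow_snd, DirectSum.add_apply, pushPath_cons_ne J β y.2 p γ h, add_zero,
    DirectSum.apply_eq_component Rᵐᵒᵖ, DirectSum.component.of, dif_neg]
  intro h
  have := congrArg (fun t : Σ j : Q, Quiver.Path j k => t.2.length) h
  simp at this

end

section

variable {X B : Rep Q (RightMod R)} {J : Q → RightMod R}
  {e : ∀ i : Q, B.InSum i →ₗ[Rᵐᵒᵖ] J i}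
  (θ : ∀ k : Q, X.at k ≃ₗ[Rᵐᵒᵖ] MoObj B J k)

/-- The component of an identification with the Mimo-construction in the original
representation. -/
def moFst (k : Q) : X.at k →ₗ[Rᵐᵒᵖ] B.at k := LinearMap.fst _ _ _ ∘ₗ (θ k).toLinearMap

open Classical in
/-- The component at a path of an identification with the Mimo-construction. -/
def moSnd (k : Q) (p : Σ j : Q, Quiver.Path j k) : X.at k →ₗ[Rᵐᵒᵖ] J p.1 :=
  DirectSum.component Rᵐᵒᵖ (Σ j : Q, Quiver.Path j k) (fun p => J p.1) p ∘ₗ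
    LinearMap.snd _ _ _ ∘ₗ (θ k).toLinearMap

lemma eq_zero_of_mo {k : Q} (x : X.at k) (h1 : moFst θ k x = 0) (h2 : ∀ p, moSnd θ k p x = 0) :
    x = 0 := by
  apply (θ k).injective
  rw [map_zero]
  exact Prod.ext h1 (DFinsupp.ext h2)

lemma moFst_inMap
    (hθ : ∀ ⦃i k : Q⦄ (β : i ⟶ k) (x : X.at i), θ k (X.arrow β x) = moArrow B J e β (θ i x))
    (k : Q) (x : X.InSum k) :
    moFst θ k (X.inMap k x) = B.inMap k (inSumMap (moFst θ) k x) := by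
  have : moFst θ k ∘ₗ X.inMap k = B.inMap k ∘ₗ inSumMap (moFst θ) k := inSum_ext fun i a y => by
    rw [LinearMap.comp_apply, LinearMap.comp_apply, inMap_lof, inSumMap_lof, inMap_lof]
    exact (congrArg Prod.fst (hθ a y)).trans (moArrow_fst B J e a _)
  exact LinearMap.congr_fun this x

lemma moSnd_inMap_nil
    (hθ : ∀ ⦃i k : Q⦄ (β : i ⟶ k) (x : X.at i), θ k (X.arrow β x) = moArrow B J e β (θ i x))
    (k : Q) (x : X.InSum k) :
    moSnd θ k ⟨k, Quiver.Path.nil⟩ (X.inMap k x) = e k (inSumMap (moFst θ) k x) := by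
  have : moSnd θ k ⟨k, Quiver.Path.nil⟩ ∘ₗ X.inMap k = e k ∘ₗ inSumMap (moFst θ) k :=
    inSum_ext fun i a y => by
      rw [LinearMap.comp_apply, LinearMap.comp_apply, inMap_lof, inSumMap_lof]
      exact (congrArg (fun t : MoObj B J k => t.2 ⟨k, Quiver.Path.nil⟩) (hθ a y)).trans
        (moArrow_nil B J e a _)
  exact LinearMap.congr_fun this x

open Classical in
lemma moSnd_inMap_cons
    (hθ : ∀ ⦃i k : Q⦄ (β : i ⟶ k) (x : X.at i), θ k (X.arrow β x) = moArrow B J e β (θ i x))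
    {i k : Q} (β : i ⟶ k) (p : Σ j : Q, Quiver.Path j i) (x : X.InSum k) :
    moSnd θ k ⟨p.1, p.2.cons β⟩ (X.inMap k x) = moSnd θ i p (x ⟨i, β⟩) := by
  have : moSnd θ k ⟨p.1, p.2.cons β⟩ ∘ₗ X.inMap k = moSnd θ i p ∘ₗ
      DirectSum.component Rᵐᵒᵖ (Σ j : Q, (j ⟶ k)) (fun a => X.at a.1) ⟨i, β⟩ :=
    inSum_ext fun i' a y => by
      rw [LinearMap.comp_apply, LinearMap.comp_apply, inMap_lof]
      refine (congrArg (fun t : MoObj B J k => t.2 ⟨p.1, p.2.cons β⟩) (hθ a y)).trans ?_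
      by_cases h : (⟨i', a⟩ : Σ j : Q, (j ⟶ k)) = ⟨i, β⟩
      · obtain ⟨rfl, h⟩ := Sigma.mk.inj_iff.1 h
        obtain rfl := eq_of_heq h
        rw [DirectSum.component.lof_self]
        exact moArrow_cons B J e a _ p
      · rw [DirectSum.component.of, dif_neg h, map_zero]
        exact moArrow_cons_ne B J e a _ p.2 β h
  exact LinearMap.congr_fun this x

/-- For `x` in the kernel, the first component puts its image in `B.InSum k` into the kernel of
`B.inMap k`, where the component of the trivial path, given by `e k`, is injective. The components
at nontrivial paths recover the remaining coordinates of `x`. -/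
lemma isMonoRep_of_mo
    (hθ : ∀ ⦃i k : Q⦄ (β : i ⟶ k) (x : X.at i), θ k (X.arrow β x) = moArrow B J e β (θ i x))
    (he : ∀ i, Function.Injective (e i ∘ₗ (LinearMap.ker (B.inMap i)).subtype)) :
    isMonoRep Q R X := by
  intro k
  rw [← LinearMap.ker_eq_bot, Submodule.eq_bot_iff]
  intro x hx
  rw [LinearMap.mem_ker] at hx
  have h1 : inSumMap (moFst θ) k x ∈ LinearMap.ker (B.inMap k) := by
    rw [LinearMap.mem_ker, ← moFst_inMap θ hθ, hx, map_zero]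
  have h2 : e k (inSumMap (moFst θ) k x) = 0 := by
    rw [← moSnd_inMap_nil θ hθ, hx, map_zero]
  have h3 : inSumMap (moFst θ) k x = 0 :=
    congrArg Subtype.val (@he k ⟨_, h1⟩ 0 (h2.trans (map_zero _).symm))
  refine DFinsupp.ext fun a => eq_zero_of_mo θ _ ?_ fun p => ?_
  · rw [← inSumMap_apply, h3]
    rfl
  · exact (moSnd_inMap_cons θ hθ a.2 p x).symm.trans (by rw [hx, map_zero])

end

/-- The Mimo-construction exists. -/
lemma exists_isMimo [IsArtinAlg R] [Finite Q] [∀ i j : Q, Finite (i ⟶ j)] (hQ : IsAcyclicQuiver Q)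
    (B : Rep Q (RightMod R)) : ∃ X : MonoRep Q R, IsMimo B X := by
  have := fun j k => hQ.finite_path j k
  choose J j hj using fun k => exists_injEnvelope (R := R) (LinearMap.ker (B.inMap k))
  choose e he using fun k => exists_extension (hj k).2.1 (LinearMap.ker (B.inMap k)).subtype
    Subtype.val_injective (j k)
  have he' : ∀ k, e k ∘ₗ (LinearMap.ker (B.inMap k)).subtype = j k := fun k => LinearMap.ext (he k)
  obtain ⟨X, θ, hθ⟩ := exists_rep (R := R) (fun k => MoObj B J k) fun i k β => moArrow B J e β
  exact ⟨⟨X, isMonoRep_of_mo θ hθ fun k => by rw [he' k]; exact (hj k).1⟩, J, e,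
    fun k => by rw [he' k]; exact hj k, θ, hθ⟩

lemma IsMimo.of_iso {B : Rep Q (RightMod R)} {X Y : MonoRep Q R} (h : IsMimo B X) (φ : X ≅ Y) :
    IsMimo B Y := by
  obtain ⟨J, e, he, θ, hθ⟩ := h
  refine ⟨J, e, he, fun k => (equivOf (((isMonoRep Q R).ι.mapIso φ.symm).app _)) ≪≫ₗ θ k, ?_⟩
  intro i k β x
  exact (congrArg (θ k) (repLin_arrow φ.inv.hom β x)).trans (hθ β _)

/-- The projection from the Mimo-construction is a stable isomorphism. -/
lemma IsMimo.nonempty_stableIso [IsArtinAlg R] [Finite Q] [∀ i j : Q, Finite (i ⟶ j)]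
    (hQ : IsAcyclicQuiver Q) {B : Rep Q (RightMod R)} {X : MonoRep Q R} (h : IsMimo B X) :
    Nonempty ((monoToStable Q R).obj X ≅ B ⋙ toStable (RightMod R)) := by
  classical
  have := fun j k => hQ.finite_path j k
  obtain ⟨J, e, he, θ, hθ⟩ := h
  let π : X.obj ⟶ B := repHomOf (moFst θ) fun i k β x =>
    (congrArg Prod.fst (hθ β x)).trans (moArrow_fst B J e β _)
  have hπ : ∀ k : Q, IsIso ((toStable (RightMod R)).map (homOf (moFst θ k))) := by
    intro k
    -- The section `s` is taken at the single vertex `k`; no compatibility with arrows is needed. It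
    -- inverts the projection stably, since the error factors through the sum of the injective
    -- modules `J_{s(p)}`.
    let s : B.at k →ₗ[Rᵐᵒᵖ] X.obj.at k := (θ k).symm.toLinearMap ∘ₗ LinearMap.inl _ _ _
    obtain ⟨N, ⟨f⟩⟩ := exists_rightMod R
      (DirectSum (Σ j : Q, Quiver.Path j k) fun p => J p.1)
    let d : N →ₗ[Rᵐᵒᵖ] X.obj.at k := (θ k).symm.toLinearMap ∘ₗ LinearMap.inr _ _ _ ∘ₗ
      f.symm.toLinearMap
    have hd : (toStable (RightMod R)).map (homOf d) = 0 :=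
      toStable_map_directSum_eq_zero (fun p : (Σ j : Q, Quiver.Path j k) => J p.1) N _ f d
        fun p => toStable_map_eq_zero_of_injective _ (Or.inl (he p.1).2.1)
    have h1 : homOf s ≫ homOf (moFst θ k) = 𝟙 (B.at k) := linOf_injective (LinearMap.ext fun x =>
      congrArg Prod.fst ((θ k).apply_symm_apply (x, 0)))
    have h2 : homOf (moFst θ k) ≫ homOf s +
        homOf (f.toLinearMap ∘ₗ LinearMap.snd _ _ _ ∘ₗ (θ k).toLinearMap) ≫ homOf d =
          𝟙 (X.obj.at k) := by
      refine linOf_injective (LinearMap.ext fun x => (θ k).injective ?_)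
      change θ k ((θ k).symm ((θ k x).1, 0) + (θ k).symm (0, f.symm (f (θ k x).2))) = θ k x
      rw [map_add, (θ k).apply_symm_apply, (θ k).apply_symm_apply, f.symm_apply_apply]
      simp
    refine ⟨(toStable (RightMod R)).map (homOf s), ?_, ?_⟩
    · have h3 := congrArg (toStable (RightMod R)).map h2
      rw [Functor.map_add, Functor.map_comp, Functor.map_comp _ _ (homOf d), hd, comp_zero,
        add_zero] at h3
      exact h3.trans ((toStable (RightMod R)).map_id _)
    · rw [← Functor.map_comp, h1, CategoryTheory.Functor.map_id]
  have : ∀ k, IsIso ((Functor.whiskerRight π (toStable (RightMod R))).app k) := hπ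
  have := NatIso.isIso_of_isIso_app (Functor.whiskerRight π (toStable (RightMod R)))
  exact ⟨asIso (Functor.whiskerRight π (toStable (RightMod R)))⟩

lemma IsMimo.cls_eq [IsArtinAlg R] {B : Rep Q (RightMod R)} {X : MonoRep Q R} {J : Q → RightMod R}
    {k : Q} [Finite (Σ j : Q, Quiver.Path j k)] (θ : X.obj.at k ≃ₗ[Rᵐᵒᵖ] MoObj B J k) :
    cls (X.obj.at k) = cls (B.at k) + ∑ᶠ p : (Σ j : Q, Quiver.Path j k), cls (J p.1) := by
  obtain ⟨N, ⟨f⟩⟩ := exists_rightMod R (DirectSum (Σ j : Q, Quiver.Path j k) fun p => J p.1)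
  rw [cls_prod (θ ≪≫ₗ (LinearEquiv.refl _ _).prodCongr f),
    cls_directSum (fun p : (Σ j : Q, Quiver.Path j k) => J p.1) N f.symm]

/-- The Mimo-construction of a representation without injective summands is minimal. -/
lemma IsMimo.isMinimal [IsArtinAlg R] [Finite Q] [∀ i j : Q, Finite (i ⟶ j)]
    (hQ : IsAcyclicQuiver Q) {B : Rep Q (RightMod R)} {X : MonoRep Q R}
    (hB : ∀ k : Q, NoInjSummand (B.at k)) (h : IsMimo B X) : IsMinimal (monoToStable Q R) X := by
  classical
  obtain ⟨J, e, he, θ, hθ⟩ := h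
  rintro Y ⟨r⟩ hY
  rw [monoToStable_map_id_eq_zero_iff] at hY
  suffices hs : ∀ k : Q, Subsingleton (Y.obj.at k) by
    rw [IsZero.iff_id_eq_zero]
    exact ObjectProperty.hom_ext _ (repHom_ext fun k x => Subsingleton.elim _ _)
  intro k
  induction k using hQ.wellFounded.induction with
  | _ k ih =>
    let a₁ : Y.obj.at k →ₗ[Rᵐᵒᵖ] B.at k := moFst θ k ∘ₗ repLin r.i.hom k
    let a₂ : Y.obj.at k →ₗ[Rᵐᵒᵖ] J k := moSnd θ k ⟨k, Quiver.Path.nil⟩ ∘ₗ repLin r.i.hom k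
    let b : MoObj B J k →ₗ[Rᵐᵒᵖ] Y.obj.at k := repLin r.r.hom k ∘ₗ (θ k).symm.toLinearMap
    let b₁ : B.at k →ₗ[Rᵐᵒᵖ] Y.obj.at k := b ∘ₗ LinearMap.inl _ _ _
    let b₂ : J k →ₗ[Rᵐᵒᵖ] Y.obj.at k := b ∘ₗ LinearMap.inr _ _ _ ∘ₗ
      DirectSum.lof Rᵐᵒᵖ (Σ j : Q, Quiver.Path j k) (fun p => J p.1) ⟨k, Quiver.Path.nil⟩
    -- Arrows into `k` start where `Y` vanishes by induction, so the retraction kills their images.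
    -- These images cover the summands of nontrivial paths; hence `b` depends only on `B_k` and on
    -- the copy of `J_k` at the trivial path.
    have hbr : ∀ {i : Q} (β : i ⟶ k) (y : MoObj B J i), b (moArrow B J e β y) = 0 := by
      intro i β y
      have := ih i ⟨β⟩
      have h1 : (θ k).symm (moArrow B J e β y) = X.obj.arrow β ((θ i).symm y) := by
        rw [LinearEquiv.symm_apply_eq, hθ, LinearEquiv.apply_symm_apply]
      change repLin r.r.hom k ((θ k).symm _) = 0
      rw [h1, repLin_arrow, Subsingleton.elim (repLin r.r.hom i _) 0, map_zero]
    have hb : b = b₁ ∘ₗ LinearMap.fst _ _ _ + b₂ ∘ₗ DirectSum.component Rᵐᵒᵖ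
        (Σ j : Q, Quiver.Path j k) (fun p => J p.1) ⟨k, Quiver.Path.nil⟩ ∘ₗ
          LinearMap.snd _ _ _ := by
      refine LinearMap.prod_ext ?_ ?_
      · refine LinearMap.ext fun x => ?_
        change b (x, 0) = b₁ x + b₂ 0
        rw [map_zero, add_zero]
        rfl
      · refine DirectSum.linearMap_ext Rᵐᵒᵖ fun ⟨j, p⟩ => LinearMap.ext fun x => ?_
        change b (0, DirectSum.lof Rᵐᵒᵖ (Σ j : Q, Quiver.Path j k) (fun p => J p.1) ⟨j, p⟩ x) =
          b₁ 0 + b₂ (DirectSum.component Rᵐᵒᵖ (Σ j : Q, Quiver.Path j k) (fun p => J p.1)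
            ⟨k, Quiver.Path.nil⟩
              (DirectSum.lof Rᵐᵒᵖ (Σ j : Q, Quiver.Path j k) (fun p => J p.1) ⟨j, p⟩ x))
        rw [map_zero, zero_add]
        cases p with
        | nil => rw [DirectSum.component.lof_self]; rfl
        | cons p β =>
          rw [DirectSum.component.of, dif_neg, map_zero]
          · refine Eq.trans (congrArg b ?_) (hbr β (0,
              DirectSum.lof Rᵐᵒᵖ (Σ j : Q, Quiver.Path j _) (fun p => J p.1) ⟨j, p⟩ x))
            refine Prod.ext ?_ ?_
            · rw [moArrow_fst, map_zero]
            · rw [moArrow_snd, map_zero, map_zero, map_zero, zero_add, pushPath_lof]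
          · intro h
            have := congrArg (fun t : Σ j : Q, Quiver.Path j k => t.2.length) h
            simp at this
    have hsum : homOf a₁ ≫ homOf b₁ + homOf a₂ ≫ homOf b₂ = 𝟙 (Y.obj.at k) := by
      refine linOf_injective (LinearMap.ext fun x => ?_)
      refine (LinearMap.congr_fun hb (θ k (repLin r.i.hom k x))).symm.trans ?_
      change repLin r.r.hom k ((θ k).symm (θ k _)) = x
      rw [LinearEquiv.symm_apply_apply]
      exact congrArg (fun f : Y ⟶ Y => repLin f.hom k x) r.retract
    have hzero : ∀ x : B.InSum k, b₁ (B.inMap k x) + b₂ (e k x) = 0 := by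
      intro x
      have : b₁ ∘ₗ B.inMap k + b₂ ∘ₗ e k = 0 := by
        refine inSum_ext fun i β x => ?_
        refine Eq.trans ?_ (hbr β (x, 0))
        rw [hb, LinearMap.add_apply, LinearMap.add_apply, LinearMap.comp_apply,
          LinearMap.comp_apply, inMap_lof]
        change _ = b₁ (moArrow B J e β (x, 0)).1 + b₂ ((moArrow B J e β (x, 0)).2 ⟨k, Quiver.Path.nil⟩)
        rw [moArrow_fst, moArrow_nil]
        rfl
      exact LinearMap.congr_fun this x
    -- The opposite composite is an endomorphism of `B_k` through the injective module `Y_k`, hence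
    -- nilpotent because `B_k` has no injective summand. So the part of the identity of `Y_k` that
    -- passes through `J_k` is invertible.
    have hnil : IsNilpotent (R := End (Y.obj.at k)) (homOf a₁ ≫ homOf b₁) := by
      refine isNilpotent_comp_comm _ _ ((noInjSummand_iff.1 (hB k)).isNilpotent _ ?_)
      exact (toStable_map_eq_zero_iff _).2 ⟨_, _, _, hY k, rfl⟩
    obtain ⟨c, hc⟩ := hnil.isUnit_one_sub.exists_right_inv
    have hc' : c ≫ homOf a₂ ≫ homOf b₂ = 𝟙 (Y.obj.at k) := by
      refine Eq.trans ?_ hc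
      rw [eq_sub_of_add_eq' hsum]
      rfl
    have hs : ∀ x, b₂ (a₂ (linOf c x)) = x := LinearMap.congr_fun (congrArg linOf hc')
    -- This removes from `J_k` the copy of `Y_k` embedded by `a₂ ∘ c`. As `b₂ ∘ e k` vanishes on the
    -- kernel of `B.inMap k`, the map fixes the envelope of that kernel and is bijective by left
    -- minimality. Yet it kills the copy of `Y_k`.
    let g : J k →ₗ[Rᵐᵒᵖ] J k := LinearMap.id - a₂ ∘ₗ linOf c ∘ₗ b₂
    have hg : Function.Bijective g := (he k).2.2 g (LinearMap.ext fun x => by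
      have h1 : b₂ (e k x) = 0 := by
        have := hzero x
        rwa [LinearMap.mem_ker.1 x.2, map_zero, zero_add] at this
      change e k x - a₂ (linOf c (b₂ (e k x))) = e k x
      rw [h1, map_zero, map_zero, sub_zero])
    refine ⟨fun x y => ?_⟩
    have key : ∀ x : Y.obj.at k, x = 0 := fun x => by
      have h1 : g (a₂ (linOf c x)) = 0 := by
        change a₂ (linOf c x) - a₂ (linOf c (b₂ (a₂ (linOf c x)))) = 0
        rw [hs, sub_self]
      rw [← hs x, hg.1 (h1.trans (map_zero g).symm), map_zero]
    rw [key x, key y]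

/-- Every stable representation can be lifted to a representation without injective summands. -/
lemma exists_lift_rep [IsArtinAlg R] (M : Rep Q (StableCat (RightMod R))) :
    ∃ B : Rep Q (RightMod R), (∀ k : Q, NoInjSummand (B.at k)) ∧
      Nonempty (B ⋙ toStable (RightMod R) ≅ M) := by
  choose N hN φ using fun k : Q => exists_noInjSummand_iso (M.at k).as
  let φ' : ∀ k, M.at k ≅ (toStable (RightMod R)).obj (N k) := fun k => (φ k).some
  -- The path category is free, so the morphisms of the arrows are lifted independently, without
  -- relations to respect.
  choose f hf using fun (i k : Q) (a : i ⟶ k) => (toStable (RightMod R)).map_surjective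
    ((φ' i).inv ≫ M.map ((Paths.of Q).map a) ≫ (φ' k).hom)
  refine ⟨mkRep N f, hN, ⟨repIso (fun k => (φ' k).symm) fun i k a => ?_⟩⟩
  have h1 : (toStable (RightMod R)).map ((mkRep N f).map ((Paths.of Q).map a)) =
    (φ' i).inv ≫ M.map ((Paths.of Q).map a) ≫ (φ' k).hom :=
      (congrArg _ (mkRep_map N f a)).trans (hf i k a)
  have h2 : ((φ' i).inv ≫ M.map ((Paths.of Q).map a) ≫ (φ' k).hom) ≫ (φ' k).inv =
    (φ' i).inv ≫ M.map ((Paths.of Q).map a) := by simp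
  exact (congrArg (· ≫ (φ' k).inv) h1).trans h2

end Mimo

end

end QuiverMono

namespace QuiverMono

noncomputable section

set_option linter.unusedSectionVars false

/-! ### Bijections induced by equivalences -/

section Transfer

variable {C : Type*} [Category C] [Preadditive C] {C' : Type*} [Category C'] [Preadditive C']
  {D : Type*} [Category D] [Preadditive D] {E : Type*} [Category E] [Preadditive E]

lemma map_comp_eq_zero_iff (F : C ⥤ D) (G : D ⥤ E) [G.Faithful] [G.PreservesZeroMorphisms]
    {X Y : C} (f : X ⟶ Y) : (F ⋙ G).map f = 0 ↔ F.map f = 0 :=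
  G.map_eq_zero_iff

lemma isMinimal_comp_iff (F : C ⥤ D) (G : D ⥤ E) [G.Faithful] [G.PreservesZeroMorphisms] (X : C) :
    IsMinimal (F ⋙ G) X ↔ IsMinimal F X := by
  unfold IsMinimal
  simp only [map_comp_eq_zero_iff F G]

/-- Both sides are classified by their images in `D`: minimal objects are determined by their images
up to isomorphism, and indecomposability transfers to a minimal object with isomorphic image. -/
lemma exists_indec_equiv [IsIdempotentComplete C] [HasDrazin C] [IsIdempotentComplete C']
    [HasDrazin C'] (F : C ⥤ D) (F' : C' ⥤ D) [F.Additive] [F.Full] [F'.Additive] [F'.Full]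
    {P : ObjectProperty C} {P' : ObjectProperty C'}
    (hP : ∀ X, P X ↔ IsIndec X ∧ F.map (𝟙 X) ≠ 0)
    (hP' : ∀ X, P' X ↔ IsIndec X ∧ F'.map (𝟙 X) ≠ 0)
    (h : ∀ X, ∃ Y, IsMinimal F' Y ∧ Nonempty (F.obj X ≅ F'.obj Y))
    (h' : ∀ Y, ∃ X, IsMinimal F X ∧ Nonempty (F.obj X ≅ F'.obj Y)) :
    ∃ e : IsoClasses P ≃ IsoClasses P', ∀ X Y (hX : P X) (hY : P' Y),
      e (IsoClasses.mk X hX) = IsoClasses.mk Y hY ↔ Nonempty (F.obj X ≅ F'.obj Y) := by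
  refine exists_isoClasses_equiv (fun X Y => Nonempty (F.obj X ≅ F'.obj Y)) ?_ ?_ ?_ ?_ ?_
  · intro X hX
    obtain ⟨Y, hY, ⟨φ⟩⟩ := h X
    rw [hP] at hX
    exact ⟨Y, (hP' Y).2 (hX.1.transfer F' hX.2 hY φ), ⟨φ⟩⟩
  · intro Y hY
    obtain ⟨X, hX, ⟨φ⟩⟩ := h' Y
    rw [hP'] at hY
    exact ⟨X, (hP X).2 (hY.1.transfer F hY.2 hX φ.symm), ⟨φ⟩⟩
  · rintro X X' Y Y' hX hX' hY hY' ⟨φ⟩ ⟨φ'⟩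
    rw [hP] at hX hX'
    rw [hP'] at hY hY'
    constructor
    · rintro ⟨ψ⟩
      exact (hY.1.isMinimal F' hY.2).iso _ (hY'.1.isMinimal F' hY'.2)
        (φ.symm ≪≫ F.mapIso ψ ≪≫ φ')
    · rintro ⟨ψ⟩
      exact (hX.1.isMinimal F hX.2).iso _ (hX'.1.isMinimal F hX'.2)
        (φ ≪≫ F'.mapIso ψ ≪≫ φ'.symm)
  · rintro X X' Y - - - ⟨ψ⟩ ⟨φ⟩
    exact ⟨F.mapIso ψ.symm ≪≫ φ⟩
  · rintro X Y Y' - - - ⟨ψ⟩ ⟨φ⟩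
    exact ⟨φ ≪≫ F'.mapIso ψ⟩

end Transfer

/-! ### Mimo-constructions as the minimal lifts of stable representations -/

section StableMimo

variable {Q : Type w} [Quiver.{v + 1} Q] [Finite Q] [∀ i j : Q, Finite (i ⟶ j)]
  {R : Type u} [Ring R] [IsArtinAlg R]

lemma nonInjIndecMono_iff (hQ : IsAcyclicQuiver Q) (X : MonoRep Q R) :
    nonInjIndecMono Q R X ↔ IsIndec X ∧ (monoToStable Q R).map (𝟙 X) ≠ 0 :=
  and_congr_right fun _ => not_congr (isInjMono_iff hQ X)

lemma IsStableMimo.isMinimal (hQ : IsAcyclicQuiver Q) {M : Rep Q (StableCat (RightMod R))}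
    {X : MonoRep Q R} (h : IsStableMimo M X) : IsMinimal (monoToStable Q R) X := by
  obtain ⟨B, hB, -, hX⟩ := h
  exact hX.isMinimal hQ hB

lemma IsStableMimo.nonempty_iso (hQ : IsAcyclicQuiver Q) {M : Rep Q (StableCat (RightMod R))}
    {X : MonoRep Q R} (h : IsStableMimo M X) : Nonempty ((monoToStable Q R).obj X ≅ M) := by
  obtain ⟨B, -, ⟨φ⟩, hX⟩ := h
  obtain ⟨ψ⟩ := hX.nonempty_stableIso hQ
  exact ⟨ψ ≪≫ φ⟩

lemma exists_isStableMimo (hQ : IsAcyclicQuiver Q) (M : Rep Q (StableCat (RightMod R))) :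
    ∃ X : MonoRep Q R, IsStableMimo M X := by
  obtain ⟨B, hB, hM⟩ := exists_lift_rep M
  obtain ⟨X, hX⟩ := exists_isMimo hQ B
  exact ⟨X, B, hB, hM, hX⟩

/-- Minimal objects of the monomorphism category are Mimo-constructions. -/
lemma IsMinimal.isStableMimo (hQ : IsAcyclicQuiver Q) {X : MonoRep Q R}
    (hX : IsMinimal (monoToStable Q R) X) {M : Rep Q (StableCat (RightMod R))}
    (φ : (monoToStable Q R).obj X ≅ M) : IsStableMimo M X := by
  obtain ⟨Y, hY⟩ := exists_isStableMimo hQ M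
  have := monoToStable_full (R := R) hQ
  obtain ⟨ψ⟩ := hY.nonempty_iso hQ
  obtain ⟨θ⟩ := (hY.isMinimal hQ).iso _ hX (ψ ≪≫ φ.symm)
  obtain ⟨B, hB, hM, hY⟩ := hY
  exact ⟨B, hB, hM, hY.of_iso θ⟩

end StableMimo

/-! ### The bijection of indecomposable non-injective objects -/

section InducedBijection

variable {Q : Type w} [Quiver.{v + 1} Q] [Finite Q] [∀ i j : Q, Finite (i ⟶ j)]
  {Λ : Type u₁} {Γ : Type u₂} [Ring Λ] [Ring Γ] [IsArtinAlg Λ] [IsArtinAlg Γ]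
  (Φ : StableCat (RightMod Λ) ≌ StableCat (RightMod Γ))

/-- The functor on stable representations given by `Φ`. -/
abbrev repFunctor (Q : Type w) [Quiver.{v + 1} Q] : Rep Q (StableCat (RightMod Λ)) ⥤
    Rep Q (StableCat (RightMod Γ)) :=
  (Functor.whiskeringRight (Paths Q) _ _).obj Φ.functor

instance : (repFunctor Φ Q).Additive where
  map_add {X Y f g} := by
    have := additive_of_isEquivalence Φ
    ext i
    exact Φ.functor.map_add

/-- One of the two functors is composed with the equivalence induced by `Φ`; faithfulness keeps its
minimal objects the same. -/
lemma exists_monoEquiv (hQ : IsAcyclicQuiver Q) :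
    ∃ e : IsoClasses (nonInjIndecMono Q Λ) ≃ IsoClasses (nonInjIndecMono Q Γ),
      ∀ X Y (hX : nonInjIndecMono Q Λ X) (hY : nonInjIndecMono Q Γ Y),
        e (IsoClasses.mk X hX) = IsoClasses.mk Y hY ↔
          Nonempty ((monoToStable Q Λ ⋙ repFunctor Φ Q).obj X ≅ (monoToStable Q Γ).obj Y) := by
  have := monoToStable_full (R := Λ) hQ
  have := monoToStable_full (R := Γ) hQ
  refine exists_indec_equiv (monoToStable Q Λ ⋙ repFunctor Φ Q) (monoToStable Q Γ) ?_
    (nonInjIndecMono_iff hQ) ?_ ?_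
  · intro X
    rw [nonInjIndecMono_iff hQ, Ne, Ne,
      map_comp_eq_zero_iff (monoToStable Q Λ) (repFunctor Φ Q)]
  · intro X
    obtain ⟨Y, hY⟩ := exists_isStableMimo hQ ((monoToStable Q Λ ⋙ repFunctor Φ Q).obj X)
    obtain ⟨φ⟩ := hY.nonempty_iso hQ
    exact ⟨Y, hY.isMinimal hQ, ⟨φ.symm⟩⟩
  · intro Y
    obtain ⟨X, hX⟩ := exists_isStableMimo hQ ((repFunctor Φ Q).objPreimage ((monoToStable Q Γ).obj Y))
    obtain ⟨φ⟩ := hX.nonempty_iso hQ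
    exact ⟨X, (isMinimal_comp_iff _ _ _).2 (hX.isMinimal hQ),
      ⟨(repFunctor Φ Q).mapIso φ ≪≫ (repFunctor Φ Q).objObjPreimageIso _⟩⟩

variable {Φ}

/-- Only the stable isomorphism class survives from the choice of a Mimo-construction, so any
induced bijection satisfies the relation that characterises the one in `exists_monoEquiv`. -/
lemma IsInducedBijection.nonempty_iso (hQ : IsAcyclicQuiver Q)
    {φQ : IsoClasses (nonInjIndecMono Q Λ) ≃ IsoClasses (nonInjIndecMono Q Γ)}
    (h : IsInducedBijection Φ φQ) {X : MonoRep Q Λ} {Y : MonoRep Q Γ}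
    (hX : nonInjIndecMono Q Λ X) (hY : nonInjIndecMono Q Γ Y)
    (hXY : φQ (IsoClasses.mk X hX) = IsoClasses.mk Y hY) :
    Nonempty ((monoToStable Q Λ ⋙ repFunctor Φ Q).obj X ≅ (monoToStable Q Γ).obj Y) := by
  obtain ⟨M, Y', hY', h1, h2, h3⟩ := h X hX
  rw [hXY, isoClasses_mk_eq_iff] at h3
  obtain ⟨α⟩ := h1.nonempty_iso hQ
  obtain ⟨β⟩ := h2.nonempty_iso hQ
  obtain ⟨γ⟩ := h3
  exact ⟨(repFunctor Φ Q).mapIso α ≪≫ β.symm ≪≫ (monoToStable Q Γ).mapIso γ.symm⟩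

/-- A stable equivalence induces a unique bijection between the indecomposable non-injective
objects of the monomorphism categories. -/
theorem existsUnique_inducedBijection (hQ : IsAcyclicQuiver Q) :
    ∃! φQ : IsoClasses (nonInjIndecMono Q Λ) ≃ IsoClasses (nonInjIndecMono Q Γ),
      IsInducedBijection Φ φQ := by
  obtain ⟨e, he⟩ := exists_monoEquiv Φ hQ
  refine ⟨e, fun X hX => ?_, fun φQ h => Equiv.ext fun a => ?_⟩
  · obtain ⟨Y, hY, hXY⟩ := (e (IsoClasses.mk X hX)).exists_rep
    obtain ⟨φ⟩ := (he X Y hX hY).1 hXY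
    have hX' := (nonInjIndecMono_iff hQ X).1 hX
    have hY' := (nonInjIndecMono_iff hQ Y).1 hY
    exact ⟨(monoToStable Q Λ).obj X, Y, hY,
      (hX'.1.isMinimal _ hX'.2).isStableMimo hQ (Iso.refl _),
      (hY'.1.isMinimal _ hY'.2).isStableMimo hQ φ.symm, hXY⟩
  · obtain ⟨X, hX, rfl⟩ := a.exists_rep
    obtain ⟨Y, hY, hXY⟩ := (φQ (IsoClasses.mk X hX)).exists_rep
    rw [hXY, eq_comm, he]
    exact h.nonempty_iso hQ hX hY hXY

end InducedBijection

end

end QuiverMono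

namespace QuiverMono

noncomputable section

set_option linter.unusedSectionVars false

/-! ### Corresponding modules -/

section Corresponding

variable {Λ : Type u₁} {Γ : Type u₂} [Ring Λ] [Ring Γ] [IsArtinAlg Λ] [IsArtinAlg Γ]
  {Φ : StableCat (RightMod Λ) ≌ StableCat (RightMod Γ)}

lemma Corresponds.symm {M : RightMod Λ} {N : RightMod Γ} (h : Corresponds Φ M N) :
    Corresponds Φ.symm N M :=
  ⟨Φ.inverse.mapIso h.some.symm ≪≫ (Φ.unitIso.app _).symm⟩

lemma RestrictsToSimples.symm (h : RestrictsToSimples Φ) : RestrictsToSimples Φ.symm :=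
  ⟨fun T hT => (h.2 T hT).imp fun _ hS => ⟨hS.1, hS.2.symm⟩,
    fun S hS => (h.1 S hS).imp fun _ hT => ⟨hT.1, hT.2.symm⟩⟩

lemma Corresponds.congr {M M' : RightMod Λ} {N N' : RightMod Γ} (h : Corresponds Φ M N)
    (α : M ≅ M') (β : N ≅ N') : Corresponds Φ M' N' :=
  ⟨Φ.functor.mapIso ((toStable _).mapIso α.symm) ≪≫ h.some ≪≫ (toStable _).mapIso β⟩

lemma Corresponds.iso_right {M : RightMod Λ} {N N' : RightMod Γ} (h : Corresponds Φ M N)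
    (h' : Corresponds Φ M N') (hN : NoInjSummand N) (hN' : NoInjSummand N') :
    Nonempty (N ≅ N') :=
  hN.iso hN' (h.some.symm ≪≫ h'.some)

lemma Corresponds.injective {M : RightMod Λ} {N : RightMod Γ} (h : Corresponds Φ M N)
    (hM : Injective M) : Injective N := by
  have := additive_of_isEquivalence Φ
  obtain ⟨φ⟩ := h
  rw [← toStable_map_id_eq_zero_iff] at hM ⊢
  rw [CategoryTheory.Functor.map_id] at hM ⊢
  rw [← φ.inv_hom_id, ← Category.id_comp φ.hom, ← CategoryTheory.Functor.map_id, hM]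
  simp

variable (Φ) in
lemma exists_corresponds (M : RightMod Λ) :
    ∃ N : RightMod Γ, NoInjSummand N ∧ Corresponds Φ M N := by
  obtain ⟨N, hN, ⟨φ⟩⟩ := exists_noInjSummand_iso (Φ.functor.obj ((toStable _).obj M)).as
  exact ⟨N, hN, ⟨φ⟩⟩

lemma Corresponds.isIndec {M : RightMod Λ} {N : RightMod Γ} (h : Corresponds Φ M N)
    (hM : IsIndec M) (hM' : ¬ Injective M) (hN : NoInjSummand N) : IsIndec N ∧ ¬ Injective N := by
  have := additive_of_isEquivalence Φ
  refine ⟨?_, fun hN => hM' (h.symm.injective hN)⟩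
  refine (hM.transfer (F := toStable (RightMod Λ) ⋙ Φ.functor) (toStable (RightMod Γ)) ?_
    (noInjSummand_iff.1 hN) h.some).1
  rw [Ne, map_comp_eq_zero_iff, toStable_map_id_eq_zero_iff]
  exact hM'

lemma Corresponds.biprod {M M' : RightMod Λ} {N N' : RightMod Γ} (h : Corresponds Φ M N)
    (h' : Corresponds Φ M' N') : Corresponds Φ (M ⊞ M') (N ⊞ N') := by
  have := additive_of_isEquivalence Φ
  have := preservesBinaryBiproducts_of_preservesBiproducts (toStable (RightMod Λ) ⋙ Φ.functor)
  exact ⟨(toStable (RightMod Λ) ⋙ Φ.functor).mapBiprod M M' ≪≫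
    biprod.mapIso h.some h'.some ≪≫ ((toStable (RightMod Γ)).mapBiprod N N').symm⟩

/-- The module underlying a submodule. -/
abbrev modOf {R : Type u} [Ring R] [IsArtinAlg R] {M : RightMod R} (N : Submodule Rᵐᵒᵖ M) :
    RightMod R :=
  FGModuleCat.of Rᵐᵒᵖ N

lemma iso_of_corresponds_socle {I I' : RightMod Λ} {J J' : RightMod Γ} {S S' : RightMod Λ}
    {T T' : RightMod Γ} (hS : S ≃ₗ[Λᵐᵒᵖ] socle Λᵐᵒᵖ I) (hS' : S' ≃ₗ[Λᵐᵒᵖ] socle Λᵐᵒᵖ I')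
    (hT : T ≃ₗ[Γᵐᵒᵖ] socle Γᵐᵒᵖ J) (hT' : T' ≃ₗ[Γᵐᵒᵖ] socle Γᵐᵒᵖ J') (hJ : Injective J)
    (hJ' : Injective J') (h : Corresponds Φ S T) (h' : Corresponds Φ S' T')
    (hTn : NoInjSummand T) (hTn' : NoInjSummand T') (φ : I ≅ I') : Nonempty (J ≅ J') := by
  have e : S ≃ₗ[Λᵐᵒᵖ] S' := hS ≪≫ₗ socleEquiv (equivOf φ) ≪≫ₗ hS'.symm
  obtain ⟨ψ⟩ := (h.congr (isoOf e) (Iso.refl _)).iso_right h' hTn hTn'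
  exact nonempty_iso_of_socle hJ hJ' (hT.symm ≪≫ₗ equivOf ψ ≪≫ₗ hT')

lemma Corresponds.simpleNonInj {S : RightMod Λ} {T J : RightMod Γ} (h : Corresponds Φ S T)
    (hS : ¬ Injective S) (hJ : IsIndec J) (hJ' : Injective J) (e : T ≃ₗ[Γᵐᵒᵖ] socle Γᵐᵒᵖ J) :
    simpleNonInj Γ T := by
  have := hJ.isSimpleModule_socle hJ'
  exact ⟨IsSimpleModule.congr e, fun hT => hS (h.symm.injective hT)⟩

lemma not_isSimpleModule_of_socle {T J : RightMod Γ} (hT : simpleNonInj Γ T) (hJ : Injective J)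
    (e : T ≃ₗ[Γᵐᵒᵖ] socle Γᵐᵒᵖ J) : ¬ IsSimpleModule Γᵐᵒᵖ J := by
  intro hs
  refine hT.2 (Injective.of_iso (isoOf (e ≪≫ₗ LinearEquiv.ofTop _ socle_eq_top)).symm hJ)

/-- The socle of `I` is simple and non-injective, so `Φ` carries it to a simple module `T`. The
module `J` is the injective envelope of `T`. -/
lemma exists_corresponds_injective (hΦ : RestrictsToSimples Φ) {I : RightMod Λ} (hI : IsIndec I)
    (hI' : Injective I) (hns : ¬ IsSimpleModule Λᵐᵒᵖ I) :
    ∃ (J : RightMod Γ) (S : RightMod Λ) (T : RightMod Γ), IsIndec J ∧ Injective J ∧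
      ¬ IsSimpleModule Γᵐᵒᵖ J ∧
      Nonempty (S ≃ₗ[Λᵐᵒᵖ] socle Λᵐᵒᵖ I) ∧ Nonempty (T ≃ₗ[Γᵐᵒᵖ] socle Γᵐᵒᵖ J) ∧
      Corresponds Φ S T := by
  have hS := hI.not_injective_of_socle (S := modOf (socle Λᵐᵒᵖ I)) hI' hns (LinearEquiv.refl _ _)
  obtain ⟨T, hT, hST⟩ := hΦ.1 _ hS
  have := hT.1
  obtain ⟨J, hJ, hJ', ⟨e⟩⟩ := exists_injective_with_socle (R := Γ) T
  exact ⟨J, _, T, hJ, hJ', not_isSimpleModule_of_socle hT hJ' e, ⟨LinearEquiv.refl _ _⟩, ⟨e⟩, hST⟩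

end Corresponding

/-! ### Isomorphisms of split Grothendieck groups -/

section Groups

variable {Λ : Type u₁} {Γ : Type u₂} [Ring Λ] [Ring Γ] [IsArtinAlg Λ] [IsArtinAlg Γ]

/-- The indecomposable modules that are not simple injective. -/
def nonSimpleInjIndec (R : Type u) [Ring R] : ObjectProperty (RightMod R) :=
  fun M => IsIndec M ∧ ¬ simpleInj R M

lemma cls_mem_of_indec {M : RightMod Λ} (hM : nonSimpleInjIndec Λ M) :
    cls M ∈ nonSimpleInjSubgroup Λ :=
  AddSubgroup.subset_closure ⟨M, hM.1, hM.2, rfl⟩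

lemma eqOn_nonSimpleInjSubgroup {A : Type*} [AddCommGroup A] {f g : nonSimpleInjSubgroup Λ →+ A}
    (h : ∀ (M : RightMod Λ) (hM : nonSimpleInjIndec Λ M),
      f ⟨cls M, cls_mem_of_indec hM⟩ = g ⟨cls M, cls_mem_of_indec hM⟩) : f = g := by
  refine AddMonoidHom.ext fun ⟨x, hx⟩ => ?_
  induction hx using AddSubgroup.closure_induction with
  | mem x hx =>
    obtain ⟨M, h1, h2, rfl⟩ := hx
    exact h M ⟨h1, h2⟩
  | zero => exact (map_zero f).trans (map_zero g).symm
  | add x y hx hy h1 h2 =>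
    exact (map_add f ⟨x, hx⟩ ⟨y, hy⟩).trans ((congrArg₂ _ h1 h2).trans
      (map_add g ⟨x, hx⟩ ⟨y, hy⟩).symm)
  | neg x hx h1 =>
    exact (map_neg f ⟨x, hx⟩).trans ((congrArg _ h1).trans (map_neg g ⟨x, hx⟩).symm)

lemma exists_hom_of_classes {P : ObjectProperty (RightMod Λ)} {P' : ObjectProperty (RightMod Γ)}
    (e : IsoClasses P → IsoClasses P') :
    ∃ T : SplitK₀ (RightMod Λ) →+ SplitK₀ (RightMod Γ),
      ∀ X Y (_ : IsIndec X) (hX : P X) (hY : P' Y),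
        e (IsoClasses.mk X hX) = IsoClasses.mk Y hY → T (cls X) = cls Y := by
  have key : ∀ a : IsoClasses (indecProp (RightMod Λ)), ∃ y : SplitK₀ (RightMod Γ),
      ∀ X Y (hi : IsIndec X) (hX : P X) (hY : P' Y), a = indecClass X hi →
        e (IsoClasses.mk X hX) = IsoClasses.mk Y hY → y = cls Y := by
    intro a
    by_cases h : ∃ (X : RightMod Λ) (hi : IsIndec X), a = indecClass X hi ∧ P X
    · obtain ⟨X, hi, rfl, hX⟩ := h
      obtain ⟨Y, hY, hXY⟩ := (e (IsoClasses.mk X hX)).exists_rep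
      refine ⟨cls Y, fun X' Y' hi' hX' hY' h1 h2 => ?_⟩
      rw [indecClass_eq_iff] at h1
      rw [← (isoClasses_mk_eq_iff hX hX').2 h1, hXY, isoClasses_mk_eq_iff] at h2
      exact cls_iso h2.some
    -- Classes outside `P` are unconstrained and receive the value `0`.
    · refine ⟨0, fun X' Y' hi' hX' hY' h1 h2 => ?_⟩
      exact absurd ⟨X', hi', h1, hX'⟩ h
  choose f hf using key
  obtain ⟨T, hT⟩ := exists_lift_of_indec f
  exact ⟨T, fun X Y hi hX hY h => (hT X hi).trans (hf _ X Y hi hX hY rfl h)⟩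

lemma exists_subgroup_addEquiv
    (e : IsoClasses (nonSimpleInjIndec Λ) ≃ IsoClasses (nonSimpleInjIndec Γ)) :
    ∃ φ : nonSimpleInjSubgroup Λ ≃+ nonSimpleInjSubgroup Γ,
      ∀ X Y (hX : nonSimpleInjIndec Λ X) (hY : nonSimpleInjIndec Γ Y),
        e (IsoClasses.mk X hX) = IsoClasses.mk Y hY →
          (φ ⟨cls X, cls_mem_of_indec hX⟩ : SplitK₀ (RightMod Γ)) = cls Y := by
  obtain ⟨T, hT⟩ := exists_hom_of_classes e
  obtain ⟨T', hT'⟩ := exists_hom_of_classes e.symm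
  have hmem : ∀ x : nonSimpleInjSubgroup Λ, T x ∈ nonSimpleInjSubgroup Γ := by
    rintro ⟨x, hx⟩
    have : nonSimpleInjSubgroup Λ ≤ (nonSimpleInjSubgroup Γ).comap T := by
      refine (AddSubgroup.closure_le _).2 ?_
      rintro _ ⟨X, h1, h2, rfl⟩
      obtain ⟨Y, hY, hXY⟩ := (e (IsoClasses.mk X ⟨h1, h2⟩)).exists_rep
      change T (cls X) ∈ nonSimpleInjSubgroup Γ
      rw [hT X Y h1 ⟨h1, h2⟩ hY hXY]
      exact cls_mem_of_indec hY
    exact this hx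
  have hmem' : ∀ x : nonSimpleInjSubgroup Γ, T' x ∈ nonSimpleInjSubgroup Λ := by
    rintro ⟨x, hx⟩
    have : nonSimpleInjSubgroup Γ ≤ (nonSimpleInjSubgroup Λ).comap T' := by
      refine (AddSubgroup.closure_le _).2 ?_
      rintro _ ⟨X, h1, h2, rfl⟩
      obtain ⟨Y, hY, hXY⟩ := (e.symm (IsoClasses.mk X ⟨h1, h2⟩)).exists_rep
      change T' (cls X) ∈ nonSimpleInjSubgroup Λ
      rw [hT' X Y h1 ⟨h1, h2⟩ hY hXY]
      exact cls_mem_of_indec hY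
    exact this hx
  let f := (T.comp (nonSimpleInjSubgroup Λ).subtype).codRestrict _ hmem
  let g := (T'.comp (nonSimpleInjSubgroup Γ).subtype).codRestrict _ hmem'
  refine ⟨AddMonoidHom.toAddEquiv f g (eqOn_nonSimpleInjSubgroup fun X hX => ?_)
    (eqOn_nonSimpleInjSubgroup fun Y hY => ?_), fun X Y hX hY h => hT X Y hX.1 hX hY h⟩
  · obtain ⟨Y, hY, hXY⟩ := (e (IsoClasses.mk X hX)).exists_rep
    refine Subtype.ext ?_
    change T' (T (cls X)) = cls X
    rw [hT X Y hX.1 hX hY hXY, hT' Y X hY.1 hY hX (by rw [← hXY, e.symm_apply_apply])]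
  · obtain ⟨X, hX, hXY⟩ := (e.symm (IsoClasses.mk Y hY)).exists_rep
    refine Subtype.ext ?_
    change T (T' (cls Y)) = cls Y
    rw [hT' Y X hY.1 hY hX hXY, hT X Y hX.1 hX hY (by rw [← hXY, e.apply_symm_apply])]

variable {Φ : StableCat (RightMod Λ) ≌ StableCat (RightMod Γ)}

/-- The definition of `IsInducedIso` provides only some `N`. Stable correspondents without injective
summands are unique up to isomorphism, so every such `N` will do. -/
lemma IsInducedIso.apply_of_corresponds {φ : nonSimpleInjSubgroup Λ ≃+ nonSimpleInjSubgroup Γ}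
    (h : IsInducedIso Φ φ) {M : RightMod Λ} {N : RightMod Γ} (hM : IsIndec M)
    (hM' : ¬ Injective M) (hN : NoInjSummand N) (hMN : Corresponds Φ M N) :
    ∃ hm : cls M ∈ nonSimpleInjSubgroup Λ,
      (φ ⟨cls M, hm⟩ : SplitK₀ (RightMod Γ)) = cls N := by
  refine ⟨cls_mem_of_indec ⟨hM, fun h => hM' h.2⟩, ?_⟩
  obtain ⟨N', h1, h2, h3, h4⟩ := h.1 M (cls_mem_of_indec ⟨hM, fun h => hM' h.2⟩) hM hM'
  obtain ⟨ψ⟩ := h3.iso_right hMN (h1.noInjSummand h2) hN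
  rw [h4, cls_iso ψ]

lemma IsInducedIso.apply_of_injective {φ : nonSimpleInjSubgroup Λ ≃+ nonSimpleInjSubgroup Γ}
    (h : IsInducedIso Φ φ) {I S : RightMod Λ} {J T : RightMod Γ} (hI : IsIndec I)
    (hI' : Injective I) (hns : ¬ IsSimpleModule Λᵐᵒᵖ I) (hJ : Injective J)
    (eS : S ≃ₗ[Λᵐᵒᵖ] socle Λᵐᵒᵖ I) (eT : T ≃ₗ[Γᵐᵒᵖ] socle Γᵐᵒᵖ J) (hST : Corresponds Φ S T)
    (hT : NoInjSummand T) :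
    ∃ hm : cls I ∈ nonSimpleInjSubgroup Λ,
      (φ ⟨cls I, hm⟩ : SplitK₀ (RightMod Γ)) = cls J := by
  have hm : cls I ∈ nonSimpleInjSubgroup Λ := cls_mem_of_indec ⟨hI, fun h => hns h.1⟩
  refine ⟨hm, ?_⟩
  obtain ⟨J', S', T', h1, h2, ⟨h3⟩, ⟨h4⟩, h5, h6⟩ := h.2 I hm hI hI' hns
  have hS' := hI.not_injective_of_socle hI' hns h3
  have hT' := h5.simpleNonInj hS'.2 h1 h2 h4
  obtain ⟨ψ⟩ := iso_of_corresponds_socle h3 eS h4 eT h2 hJ h5 hST hT'.noInjSummand hT (Iso.refl I)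
  rw [h6, cls_iso ψ]

/-- The relation between the indecomposable modules that describes the induced isomorphism. -/
def IndecCorresponds (Φ : StableCat (RightMod Λ) ≌ StableCat (RightMod Γ)) (X : RightMod Λ)
    (Y : RightMod Γ) : Prop :=
  (¬ Injective X ∧ ¬ Injective Y ∧ Corresponds Φ X Y) ∨
  (Injective X ∧ Injective Y ∧ ∃ (S : RightMod Λ) (T : RightMod Γ),
    Nonempty (S ≃ₗ[Λᵐᵒᵖ] socle Λᵐᵒᵖ X) ∧ Nonempty (T ≃ₗ[Γᵐᵒᵖ] socle Γᵐᵒᵖ Y) ∧ Corresponds Φ S T)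

lemma IndecCorresponds.symm {X : RightMod Λ} {Y : RightMod Γ} (h : IndecCorresponds Φ X Y) :
    IndecCorresponds Φ.symm Y X := by
  rcases h with ⟨h1, h2, h3⟩ | ⟨h1, h2, S, T, h3, h4, h5⟩
  · exact Or.inl ⟨h2, h1, h3.symm⟩
  · exact Or.inr ⟨h2, h1, T, S, h4, h3, h5.symm⟩

lemma IndecCorresponds.congr {X X' : RightMod Λ} {Y Y' : RightMod Γ}
    (h : IndecCorresponds Φ X Y) (α : X ≅ X') (β : Y ≅ Y') : IndecCorresponds Φ X' Y' := by
  rcases h with ⟨h1, h2, h3⟩ | ⟨h1, h2, S, T, ⟨h3⟩, ⟨h4⟩, h5⟩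
  · exact Or.inl ⟨fun h => h1 (Injective.of_iso α.symm h), fun h => h2 (Injective.of_iso β.symm h),
      h3.congr α β⟩
  · exact Or.inr ⟨Injective.of_iso α h1, Injective.of_iso β h2, S, T,
      ⟨h3 ≪≫ₗ socleEquiv (equivOf α)⟩, ⟨h4 ≪≫ₗ socleEquiv (equivOf β)⟩, h5⟩

lemma exists_indecCorresponds (hΦ : RestrictsToSimples Φ) {X : RightMod Λ}
    (hX : nonSimpleInjIndec Λ X) : ∃ Y, nonSimpleInjIndec Γ Y ∧ IndecCorresponds Φ X Y := by
  by_cases hinj : Injective X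
  · obtain ⟨J, S, T, h1, h2, h3, h4, h5, h6⟩ :=
      exists_corresponds_injective hΦ hX.1 hinj fun h => hX.2 ⟨h, hinj⟩
    exact ⟨J, ⟨h1, fun h => h3 h.1⟩, Or.inr ⟨hinj, h2, S, T, h4, h5, h6⟩⟩
  · obtain ⟨Y, hY, hXY⟩ := exists_corresponds Φ X
    obtain ⟨h1, h2⟩ := hXY.isIndec hX.1 hinj hY
    exact ⟨Y, ⟨h1, fun h => h2 h.2⟩, Or.inl ⟨hinj, h2, hXY⟩⟩

lemma IndecCorresponds.iso_right {X X' : RightMod Λ} {Y Y' : RightMod Γ}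
    (hY : nonSimpleInjIndec Γ Y) (hY' : nonSimpleInjIndec Γ Y') (h : IndecCorresponds Φ X Y)
    (h' : IndecCorresponds Φ X' Y') (α : X ≅ X') : Nonempty (Y ≅ Y') := by
  rcases h.congr α (Iso.refl _) with ⟨h1, h2, h3⟩ | ⟨h1, h2, S, T, ⟨h3⟩, ⟨h4⟩, h5⟩ <;>
  rcases h' with ⟨h1', h2', h3'⟩ | ⟨h1', h2', S', T', ⟨h3'⟩, ⟨h4'⟩, h5'⟩
  · exact h3.iso_right h3' (hY.1.noInjSummand h2) (hY'.1.noInjSummand h2')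
  · exact absurd h1' h1
  · exact absurd h1 h1'
  · exact iso_of_corresponds_socle h3 h3' h4 h4' h2 h2' h5 h5'
      (hY.1.not_injective_of_socle h2 (fun h => hY.2 ⟨h, h2⟩) h4).noInjSummand
      (hY'.1.not_injective_of_socle h2' (fun h => hY'.2 ⟨h, h2'⟩) h4').noInjSummand (Iso.refl _)

/-- A stable equivalence preserving simple modules induces a unique isomorphism between the groups
generated by the indecomposable modules that are not simple injective. -/
theorem existsUnique_inducedIso (hΦ : RestrictsToSimples Φ) :
    ∃! φ : nonSimpleInjSubgroup Λ ≃+ nonSimpleInjSubgroup Γ, IsInducedIso Φ φ := by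
  obtain ⟨e, he⟩ := exists_isoClasses_equiv (P := nonSimpleInjIndec Λ) (P' := nonSimpleInjIndec Γ)
    (IndecCorresponds Φ) (fun X hX => exists_indecCorresponds hΦ hX)
    (fun Y hY => (exists_indecCorresponds hΦ.symm hY).imp fun X h => ⟨h.1, h.2.symm⟩)
    (fun X X' Y Y' hX hX' hY hY' h h' => ⟨fun ⟨α⟩ => h.iso_right hY hY' h' α,
      fun ⟨β⟩ => h.symm.iso_right hX hX' h'.symm β⟩)
    (fun X X' Y _ _ _ ⟨α⟩ h => h.congr α (Iso.refl _))
    (fun X Y Y' _ _ _ ⟨β⟩ h => h.congr (Iso.refl _) β)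
  obtain ⟨φ, hφ⟩ := exists_subgroup_addEquiv e
  have hrep : ∀ (X : RightMod Λ) (hX : nonSimpleInjIndec Λ X), ∃ Y, nonSimpleInjIndec Γ Y ∧
      IndecCorresponds Φ X Y ∧
        (φ ⟨cls X, cls_mem_of_indec hX⟩ : SplitK₀ (RightMod Γ)) = cls Y := by
    intro X hX
    obtain ⟨Y, hY, hXY⟩ := (e (IsoClasses.mk X hX)).exists_rep
    exact ⟨Y, hY, (he X Y hX hY).1 hXY, hφ X Y hX hY hXY⟩
  refine ⟨φ, ⟨?_, ?_⟩, fun φ' h => ?_⟩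
  · intro M hM h1 h2
    obtain ⟨N, hN, hMN, hcls⟩ := hrep M ⟨h1, fun h => h2 h.2⟩
    rcases hMN with ⟨-, h3, h4⟩ | h
    · exact ⟨N, hN.1, h3, h4, hcls⟩
    · exact absurd h.1 h2
  · intro I hI h1 h2 h3
    obtain ⟨J, hJ, hIJ, hcls⟩ := hrep I ⟨h1, fun h => h3 h.1⟩
    rcases hIJ with h | ⟨-, h4, S, T, h5, h6, h7⟩
    · exact absurd h2 h.1
    · exact ⟨J, S, T, hJ.1, h4, h5, h6, h7, hcls⟩
  · refine AddEquiv.toAddMonoidHom_injective (eqOn_nonSimpleInjSubgroup fun X hX => Subtype.ext ?_)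
    obtain ⟨Y, hY, hXY, hcls⟩ := hrep X hX
    refine Eq.trans ?_ hcls.symm
    rcases hXY with ⟨h1, h2, h3⟩ | ⟨h1, h2, S, T, ⟨h3⟩, ⟨h4⟩, h5⟩
    · exact (h.apply_of_corresponds hX.1 h1 (hY.1.noInjSummand h2) h3).2
    · exact (h.apply_of_injective hX.1 h1 (fun hs => hX.2 ⟨hs, h1⟩) h2 h3 h4 h5
        (hY.1.not_injective_of_socle h2 (fun h => hY.2 ⟨h, h2⟩) h4).noInjSummand).2

end Groups

end

end QuiverMono

namespace QuiverMono

noncomputable section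

set_option linter.unusedSectionVars false

/-! ### Joint kernels with respect to a class of objects -/

section JointKernel

variable {D : Type*} [Category D] [Preadditive D] {D' : Type*} [Category D'] [Preadditive D']
  {A : Type*} [Fintype A]

/-- `K` is a joint kernel of the family `m` among the objects that satisfy `𝒮`. -/
structure IsJointKernel (𝒮 : D → Prop) {B : A → D} {T : D} (m : ∀ a, B a ⟶ T) (K : D)
    (ι : ∀ a, K ⟶ B a) : Prop where
  mem : 𝒮 K
  sum_eq_zero : ∑ a, ι a ≫ m a = 0
  exists_lift : ∀ L, 𝒮 L → ∀ f : ∀ a, L ⟶ B a, ∑ a, f a ≫ m a = 0 →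
    ∃ g : L ⟶ K, ∀ a, g ≫ ι a = f a
  hom_ext : ∀ L, 𝒮 L → ∀ g g' : L ⟶ K, (∀ a, g ≫ ι a = g' ≫ ι a) → g = g'

/-- Fully faithful functors that preserve the class of test objects preserve joint kernels. -/
lemma IsJointKernel.nonempty_iso {𝒮 : D → Prop} {𝒮' : D' → Prop} (F : D ⥤ D') [F.Additive]
    [F.Full] [F.Faithful] (h𝒮 : ∀ L, 𝒮 L → 𝒮' (F.obj L))
    (h𝒮' : ∀ L', 𝒮' L' → ∃ L, 𝒮 L ∧ Nonempty (F.obj L ≅ L'))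
    {B : A → D} {T : D} {m : ∀ a, B a ⟶ T} {K : D} {ι : ∀ a, K ⟶ B a}
    {B' : A → D'} {T' : D'} {m' : ∀ a, B' a ⟶ T'} {K' : D'} {ι' : ∀ a, K' ⟶ B' a}
    (h : IsJointKernel 𝒮 m K ι) (h' : IsJointKernel 𝒮' m' K' ι')
    (β : ∀ a, F.obj (B a) ≅ B' a) (τ : F.obj T ≅ T')
    (hm : ∀ a, F.map (m a) ≫ τ.hom = (β a).hom ≫ m' a) : Nonempty (F.obj K ≅ K') := by
  obtain ⟨u, hu⟩ := h'.exists_lift _ (h𝒮 K h.mem) (fun a => F.map (ι a) ≫ (β a).hom) (by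
    simp only [Category.assoc, ← hm]
    simp only [← Category.assoc, ← F.map_comp]
    rw [← Preadditive.sum_comp, ← F.map_sum, h.sum_eq_zero, F.map_zero, zero_comp])
  -- The universal property of `K` can be applied to `K'` only after replacing `K'` by the image of
  -- a test object `L`.
  obtain ⟨L, hL, ⟨θ⟩⟩ := h𝒮' K' h'.mem
  choose f hf using fun a => F.map_surjective (θ.hom ≫ ι' a ≫ (β a).inv)
  obtain ⟨g, hg⟩ := h.exists_lift L hL f (by
    apply F.map_injective
    rw [F.map_sum, F.map_zero, ← cancel_mono τ.hom, zero_comp, Preadditive.sum_comp]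
    simp only [F.map_comp, Category.assoc, hm, hf, Iso.inv_hom_id_assoc]
    rw [← Preadditive.comp_sum, h'.sum_eq_zero, comp_zero])
  let w := θ.inv ≫ F.map g
  have hw : ∀ a, w ≫ F.map (ι a) = ι' a ≫ (β a).inv := fun a => by
    rw [Category.assoc, ← F.map_comp, hg, hf, Iso.inv_hom_id_assoc]
  refine ⟨⟨u, w, ?_, ?_⟩⟩
  · obtain ⟨t, ht⟩ := F.map_surjective (u ≫ w)
    rw [← ht, ← F.map_id]
    congr 1
    refine h.hom_ext K h.mem _ _ fun a => F.map_injective ?_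
    rw [F.map_comp, ht, Category.assoc, hw, ← Category.assoc, hu, Category.assoc,
      Iso.hom_inv_id, Category.comp_id, Category.id_comp]
  · refine h'.hom_ext K' h'.mem _ _ fun a => ?_
    rw [Category.assoc, hu, ← Category.assoc, hw, Category.assoc, Iso.inv_hom_id,
      Category.comp_id, Category.id_comp]

end JointKernel

/-! ### Socles of kernels in the stable category -/

section StableSocle

variable {R : Type u} [Ring R] [IsArtinAlg R]

/-- The objects of the stable category given by semisimple modules without injective summands. -/
def IsSemisimpleStable (X : StableCat (RightMod R)) : Prop :=
  ∃ S : RightMod R, IsSemisimpleModule Rᵐᵒᵖ S ∧ NoInjSummand S ∧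
    Nonempty (X ≅ (toStable (RightMod R)).obj S)

/-- An injective summand of `S` is semisimple, and its maps to the `B a` are stably zero, hence
zero. Joint injectivity then makes the summand zero. -/
lemma noInjSummand_of_jointly_injective {A : Type*} {B : A → RightMod R}
    (hB : ∀ a, NoInjSummand (B a)) {S : RightMod R} [IsSemisimpleModule Rᵐᵒᵖ S]
    (ι : ∀ a, S →ₗ[Rᵐᵒᵖ] B a) (hι : ∀ x, (∀ a, ι a x = 0) → x = 0) : NoInjSummand S := by
  rintro I hI ⟨r⟩
  have hinj : Function.Injective (linOf r.i) := fun x y h => by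
    have h2 := LinearMap.congr_fun (congrArg linOf r.retract)
    exact (h2 x).symm.trans ((congrArg (linOf r.r) h).trans (h2 y))
  have : IsSemisimpleModule Rᵐᵒᵖ I := IsSemisimpleModule.of_injective _ hinj
  rw [isZero_iff_subsingleton]
  have key : ∀ x : I, x = 0 := fun x => by
    apply hinj
    rw [map_zero]
    refine hι _ fun a => ?_
    have := eq_zero_of_toStable_map_eq_zero (hB a) (r.i ≫ homOf (ι a))
      (toStable_map_eq_zero_of_injective _ (Or.inl hI))
    exact LinearMap.congr_fun (congrArg linOf this) x
  exact ⟨fun x y => (key x).trans (key y).symm⟩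

variable {Q : Type w} [Quiver.{v + 1} Q]

lemma linOf_sum {M N : RightMod R} {A : Type*} (s : Finset A) (f : A → (M ⟶ N)) (x : M) :
    linOf (∑ a ∈ s, f a) x = ∑ a ∈ s, linOf (f a) x := by
  classical
  induction s using Finset.induction_on with
  | empty => rfl
  | insert a s ha ih =>
    rw [Finset.sum_insert ha, Finset.sum_insert ha, linOf_add, LinearMap.add_apply, ih]

open Classical in
lemma sum_lof_eq {B : Rep Q (RightMod R)} {k : Q} [Fintype (Σ j : Q, (j ⟶ k))] (x : B.InSum k) :
    ∑ a : (Σ j : Q, (j ⟶ k)), DirectSum.lof Rᵐᵒᵖ (Σ j : Q, (j ⟶ k)) (fun a => B.at a.1) a (x a) =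
      x :=
  DirectSum.sum_univ_of x

lemma inMap_eq_sum {B : Rep Q (RightMod R)} {k : Q} [Fintype (Σ j : Q, (j ⟶ k))]
    (x : B.InSum k) : B.inMap k x = ∑ a : (Σ j : Q, (j ⟶ k)), B.arrow a.2 (x a) := by
  classical
  conv_lhs => rw [← sum_lof_eq x, map_sum]
  exact Finset.sum_congr rfl fun a _ => inMap_lof B a.2 _

/-- The socle of the kernel of `B.inMap k` can be recovered from the stable category. -/
lemma isJointKernel_socle {B : Rep Q (RightMod R)} (hB : ∀ k : Q, NoInjSummand (B.at k)) (k : Q)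
    [Fintype (Σ j : Q, (j ⟶ k))] {S : RightMod R}
    (e : S ≃ₗ[Rᵐᵒᵖ] socle Rᵐᵒᵖ (LinearMap.ker (B.inMap k))) :
    NoInjSummand S ∧ ∃ ι : ∀ a : (Σ j : Q, (j ⟶ k)),
      (toStable (RightMod R)).obj S ⟶ (toStable (RightMod R)).obj (B.at a.1),
      IsJointKernel (IsSemisimpleStable (R := R))
        (fun a : (Σ j : Q, (j ⟶ k)) =>
          (toStable (RightMod R)).map (B.map ((Paths.of Q).map a.2)))
        ((toStable (RightMod R)).obj S) ι := by
  classical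
  have hS : IsSemisimpleModule Rᵐᵒᵖ S :=
    IsSemisimpleModule.congr (M := socle Rᵐᵒᵖ (LinearMap.ker (B.inMap k))) e
  let i : S →ₗ[Rᵐᵒᵖ] B.InSum k := (LinearMap.ker (B.inMap k)).subtype ∘ₗ
    (socle Rᵐᵒᵖ (LinearMap.ker (B.inMap k))).subtype ∘ₗ e.toLinearMap
  have hi : Function.Injective i :=
    Subtype.val_injective.comp (Subtype.val_injective.comp e.injective)
  have hik : ∀ x, B.inMap k (i x) = 0 := fun x => (e x).1.2
  let ι : ∀ a : (Σ j : Q, (j ⟶ k)), S →ₗ[Rᵐᵒᵖ] B.at a.1 := fun a =>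
    DirectSum.component Rᵐᵒᵖ (Σ j : Q, (j ⟶ k)) (fun a => B.at a.1) a ∘ₗ i
  have hι : ∀ x y, (∀ a, ι a x = ι a y) → x = y := fun x y h => hi (DFinsupp.ext h)
  have hN : NoInjSummand S := noInjSummand_of_jointly_injective (fun a => hB a.1) ι
    fun x h => hι x 0 fun a => (h a).trans (map_zero _).symm
  refine ⟨hN, fun a => (toStable (RightMod R)).map (homOf (ι a)),
    ⟨⟨S, hS, hN, ⟨Iso.refl _⟩⟩, ?_, ?_, ?_⟩⟩
  · have : ∑ a : (Σ j : Q, (j ⟶ k)), homOf (ι a) ≫ B.map ((Paths.of Q).map a.2) = 0 := by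
      refine linOf_injective (LinearMap.ext fun x => ?_)
      rw [linOf_sum]
      exact (inMap_eq_sum (i x)).symm.trans (hik x)
    simp only [← Functor.map_comp]
    rw [← Functor.map_sum, this, Functor.map_zero]
  · rintro L ⟨S', hS', -, ⟨θ⟩⟩ f hf
    choose g hg using fun a => (toStable (RightMod R)).map_surjective (θ.inv ≫ f a)
    -- The relation is known only stably, but `S'` is semisimple and `B_k` has no injective summand,
    -- so it holds between the modules themselves.
    have h0 : ∑ a : (Σ j : Q, (j ⟶ k)), g a ≫ B.map ((Paths.of Q).map a.2) = 0 := by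
      refine eq_zero_of_toStable_map_eq_zero (hB k) _ ?_
      rw [Functor.map_sum]
      simp only [Functor.map_comp, hg, Category.assoc]
      rw [← Preadditive.comp_sum, hf, comp_zero]
    let G : S' →ₗ[Rᵐᵒᵖ] B.InSum k := ∑ a : (Σ j : Q, (j ⟶ k)),
      DirectSum.lof Rᵐᵒᵖ (Σ j : Q, (j ⟶ k)) (fun a => B.at a.1) a ∘ₗ linOf (g a)
    have hG : ∀ x a, G x a = linOf (g a) x := by
      intro x a
      rw [LinearMap.sum_apply, DirectSum.sum_apply, Finset.sum_eq_single a]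
      · exact DirectSum.lof_apply Rᵐᵒᵖ a _
      · intro b _ hb
        exact DirectSum.of_eq_of_ne _ _ _ hb.symm
      · exact fun h => absurd (Finset.mem_univ a) h
    have hker : ∀ x, B.inMap k (G x) = 0 := by
      intro x
      have := LinearMap.congr_fun (congrArg linOf h0) x
      rw [linOf_sum] at this
      rw [inMap_eq_sum]
      refine Eq.trans (Finset.sum_congr rfl fun a _ => ?_) this
      rw [hG]
      rfl
    let G' : S' →ₗ[Rᵐᵒᵖ] LinearMap.ker (B.inMap k) := G.codRestrict _ hker
    -- A map from a semisimple module to the kernel automatically lands in the socle of the kernel.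
    let G'' : S' →ₗ[Rᵐᵒᵖ] S := e.symm.toLinearMap ∘ₗ G'.codRestrict _ fun x =>
      range_le_socle_of_semisimple G' ⟨x, rfl⟩
    refine ⟨θ.hom ≫ (toStable (RightMod R)).map (homOf G''), fun a => ?_⟩
    have : homOf G'' ≫ homOf (ι a) = g a := by
      refine linOf_injective (LinearMap.ext fun x => ?_)
      change (e (e.symm _)).1.1 a = _
      rw [e.apply_symm_apply]
      exact hG x a
    rw [Category.assoc, ← Functor.map_comp, this, hg, Iso.hom_inv_id_assoc]
  · rintro L ⟨S', hS', -, ⟨θ⟩⟩ g g' h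
    obtain ⟨t, ht⟩ := (toStable (RightMod R)).map_surjective (θ.inv ≫ g)
    obtain ⟨t', ht'⟩ := (toStable (RightMod R)).map_surjective (θ.inv ≫ g')
    have : t = t' := by
      refine linOf_injective (LinearMap.ext fun x => hι _ _ fun a => ?_)
      have h1 : t ≫ homOf (ι a) = t' ≫ homOf (ι a) := by
        refine eq_of_toStable_map_eq (hB a.1) _ _ ?_
        rw [Functor.map_comp, Functor.map_comp, ht, ht', Category.assoc, Category.assoc, h a]
      exact LinearMap.congr_fun (congrArg linOf h1) x
    rw [← cancel_epi θ.inv, ← ht, ← ht', this]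

end StableSocle

end

end QuiverMono

namespace QuiverMono

noncomputable section

set_option linter.unusedSectionVars false

/-! ### The induced isomorphism on modules without injective summands and on injective modules -/

section Values

variable {A : Type*} [Ring A] {M N : Type*} [AddCommGroup M] [Module A M] [AddCommGroup N]
  [Module A N]

lemma isSemisimpleModule_of_subsingleton [Subsingleton M] : IsSemisimpleModule A M :=
  IsSemisimpleModule.congr (LinearEquiv.ofSubsingleton M (socle A M))

lemma isSemisimpleModule_prod [IsSemisimpleModule A M] [IsSemisimpleModule A N] :
    IsSemisimpleModule A (M × N) :=
  IsSemisimpleModule.congr (((LinearEquiv.ofTop _ socle_eq_top).prodCongr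
    (LinearEquiv.ofTop _ socle_eq_top)).symm ≪≫ₗ (socleProdEquiv (A := A) (M := M) (N := N)).symm)

variable {Λ : Type u₁} {Γ : Type u₂} [Ring Λ] [Ring Γ] [IsArtinAlg Λ] [IsArtinAlg Γ]
  {Φ : StableCat (RightMod Λ) ≌ StableCat (RightMod Γ)}
  {φ : nonSimpleInjSubgroup Λ ≃+ nonSimpleInjSubgroup Γ}

/-- `x` is mapped to `y` by `φ`. -/
def MapsTo (φ : nonSimpleInjSubgroup Λ ≃+ nonSimpleInjSubgroup Γ) (x : SplitK₀ (RightMod Λ))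
    (y : SplitK₀ (RightMod Γ)) : Prop :=
  ∃ hx : x ∈ nonSimpleInjSubgroup Λ, (φ ⟨x, hx⟩ : SplitK₀ (RightMod Γ)) = y

lemma MapsTo.zero : MapsTo φ 0 0 :=
  ⟨zero_mem _, congrArg Subtype.val (map_zero φ)⟩

lemma MapsTo.add {x x' : SplitK₀ (RightMod Λ)} {y y' : SplitK₀ (RightMod Γ)} (h : MapsTo φ x y)
    (h' : MapsTo φ x' y') : MapsTo φ (x + x') (y + y') := by
  obtain ⟨hx, rfl⟩ := h
  obtain ⟨hx', rfl⟩ := h'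
  exact ⟨add_mem hx hx', congrArg Subtype.val (map_add φ ⟨x, hx⟩ ⟨x', hx'⟩)⟩

lemma MapsTo.finsum {ι : Type*} [Finite ι] {x : ι → SplitK₀ (RightMod Λ)}
    {y : ι → SplitK₀ (RightMod Γ)} (h : ∀ i, MapsTo φ (x i) (y i)) :
    MapsTo φ (∑ᶠ i, x i) (∑ᶠ i, y i) := by
  classical
  have : Fintype ι := Fintype.ofFinite ι
  rw [finsum_eq_sum_of_fintype, finsum_eq_sum_of_fintype]
  induction (Finset.univ : Finset ι) using Finset.induction_on with
  | empty => exact MapsTo.zero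
  | insert a s ha ih =>
    rw [Finset.sum_insert ha, Finset.sum_insert ha]
    exact (h a).add ih

lemma NoInjSummand.of_biprod {X Y : RightMod Λ} (h : NoInjSummand (X ⊞ Y)) :
    NoInjSummand X ∧ NoInjSummand Y := by
  rw [noInjSummand_iff] at h
  exact ⟨noInjSummand_iff.2 (h.of_retract ⟨biprod.inl, biprod.fst, by simp⟩),
    noInjSummand_iff.2 (h.of_retract ⟨biprod.inr, biprod.snd, by simp⟩)⟩

lemma NoInjSummand.not_injective {X : RightMod Λ} (h : NoInjSummand X) (hX : IsIndec X) :
    ¬ Injective X :=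
  fun hinj => hX.1 (h X hinj ⟨Retract.refl X⟩)

lemma NoInjSummand.isZero {X : RightMod Λ} (h : NoInjSummand X) (hX : Injective X) : IsZero X :=
  h X hX ⟨Retract.refl X⟩

lemma injective_of_isZero {X : RightMod Λ} (h : IsZero X) : Injective X :=
  ⟨fun _ _ _ => ⟨0, h.eq_of_tgt _ _⟩⟩

/-- The biproduct of two modules as a product. -/
def biprodEquiv (X Y : RightMod Λ) : (X ⊞ Y : RightMod Λ) ≃ₗ[Λᵐᵒᵖ] X × Y :=
  equivOfBicone (BinaryBiproduct.bicone X Y) (BinaryBiproduct.isBilimit X Y)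

lemma IsInducedIso.mapsTo_of_noInjSummand (h : IsInducedIso Φ φ) {M : RightMod Λ} {N : RightMod Γ}
    (hM : NoInjSummand M) (hN : NoInjSummand N) (hMN : Corresponds Φ M N) :
    MapsTo φ (cls M) (cls N) := by
  -- Asking for just one correspondent `N` makes the claim accessible to induction over direct sums;
  -- uniqueness of correspondents restores the given `N`.
  suffices key : NoInjSummand M → ∃ N, NoInjSummand N ∧ Corresponds Φ M N ∧
      MapsTo φ (cls M) (cls N) by
    obtain ⟨N', h1, h2, h3⟩ := key hM
    obtain ⟨ψ⟩ := hMN.iso_right h2 hN h1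
    rwa [cls_iso ψ]
  refine indec_induction (P := fun M => NoInjSummand M → ∃ N, NoInjSummand N ∧ Corresponds Φ M N ∧
      MapsTo φ (cls M) (cls N)) ?_ ?_ ?_ ?_ M
  · intro X Y α hX hY
    obtain ⟨N, h1, h2, h3⟩ := hX (hY.of_iso α.symm)
    exact ⟨N, h1, h2.congr α (Iso.refl _), by rwa [← cls_iso α]⟩
  · intro Z hZ _
    obtain ⟨N, h1, h2⟩ := exists_corresponds Φ Z
    refine ⟨N, h1, h2, ?_⟩
    rw [cls_zero hZ, cls_zero (h1.isZero (h2.injective (injective_of_isZero hZ)))]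
    exact MapsTo.zero
  · intro X hX hX'
    obtain ⟨N, h1, h2⟩ := exists_corresponds Φ X
    exact ⟨N, h1, h2, h.apply_of_corresponds hX (hX'.not_injective hX) h1 h2⟩
  · intro X Y hX hY hXY
    obtain ⟨N, h1, h2, h3⟩ := hX hXY.of_biprod.1
    obtain ⟨N', h1', h2', h3'⟩ := hY hXY.of_biprod.2
    refine ⟨N ⊞ N', h1.biprod h1', h2.biprod h2', ?_⟩
    rw [cls_biprod, cls_biprod]
    exact h3.add h3'

/-- Every semisimple module without injective summands corresponds to such a module, and `φ`
maps the injective modules with these socles to each other. -/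
lemma IsInducedIso.exists_semisimple (hΦ : RestrictsToSimples Φ) (h : IsInducedIso Φ φ)
    {S : RightMod Λ} (hS : IsSemisimpleModule Λᵐᵒᵖ S) (hS' : NoInjSummand S) :
    ∃ T : RightMod Γ, IsSemisimpleModule Γᵐᵒᵖ T ∧ NoInjSummand T ∧ Corresponds Φ S T ∧
      ∀ (J : RightMod Λ) (J' : RightMod Γ), Injective J → Injective J' →
        Nonempty (S ≃ₗ[Λᵐᵒᵖ] socle Λᵐᵒᵖ J) → Nonempty (T ≃ₗ[Γᵐᵒᵖ] socle Γᵐᵒᵖ J') →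
          MapsTo φ (cls J) (cls J') := by
  -- Again one choice of `J` and `J'` suffices, because injective modules are determined by their
  -- socles. The induction then reduces to simple modules.
  suffices key : IsSemisimpleModule Λᵐᵒᵖ S → NoInjSummand S → ∃ (T J' : RightMod Γ)
      (J : RightMod Λ), IsSemisimpleModule Γᵐᵒᵖ T ∧ NoInjSummand T ∧ Corresponds Φ S T ∧
      Injective J ∧ Injective J' ∧ Nonempty (S ≃ₗ[Λᵐᵒᵖ] socle Λᵐᵒᵖ J) ∧
        Nonempty (T ≃ₗ[Γᵐᵒᵖ] socle Γᵐᵒᵖ J') ∧ MapsTo φ (cls J) (cls J') by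
    obtain ⟨T, J', J, h1, h2, h3, h4, h5, ⟨h6⟩, ⟨h7⟩, h8⟩ := key hS hS'
    refine ⟨T, h1, h2, h3, fun I I' hI hI' ⟨e⟩ ⟨e'⟩ => ?_⟩
    obtain ⟨α⟩ := nonempty_iso_of_socle hI h4 (e.symm ≪≫ₗ h6)
    obtain ⟨β⟩ := nonempty_iso_of_socle hI' h5 (e'.symm ≪≫ₗ h7)
    rwa [cls_iso α, cls_iso β]
  refine indec_induction (P := fun S : RightMod Λ => IsSemisimpleModule Λᵐᵒᵖ S → NoInjSummand S →
    ∃ (T J' : RightMod Γ)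
      (J : RightMod Λ), IsSemisimpleModule Γᵐᵒᵖ T ∧ NoInjSummand T ∧ Corresponds Φ S T ∧
      Injective J ∧ Injective J' ∧ Nonempty (S ≃ₗ[Λᵐᵒᵖ] socle Λᵐᵒᵖ J) ∧
        Nonempty (T ≃ₗ[Γᵐᵒᵖ] socle Γᵐᵒᵖ J') ∧ MapsTo φ (cls J) (cls J')) ?_ ?_ ?_ ?_ S
  · intro X Y α hX hY hY'
    obtain ⟨T, J', J, h1, h2, h3, h4, h5, ⟨h6⟩, h7, h8⟩ :=
      hX (IsSemisimpleModule.congr (equivOf α)) (hY'.of_iso α.symm)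
    exact ⟨T, J', J, h1, h2, h3.congr α (Iso.refl _), h4, h5, ⟨(equivOf α).symm ≪≫ₗ h6⟩, h7, h8⟩
  · intro Z hZ _ _
    obtain ⟨T, h1, h2⟩ := exists_corresponds Φ Z
    have hZ' := injective_of_isZero hZ
    have hT' := h2.injective hZ'
    have hT := h1.isZero hT'
    have := (isZero_iff_subsingleton Z).1 hZ
    have := (isZero_iff_subsingleton T).1 hT
    refine ⟨T, T, Z, isSemisimpleModule_of_subsingleton, h1, h2, hZ', hT',
      ⟨LinearEquiv.ofSubsingleton _ _⟩, ⟨LinearEquiv.ofSubsingleton _ _⟩, ?_⟩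
    rw [cls_zero hZ, cls_zero hT]
    exact MapsTo.zero
  · intro X hX hXs hXn
    have hs := hX.isSimpleModule_of_semisimple
    have hX' : simpleNonInj Λ X := ⟨hs, hXn.not_injective hX⟩
    obtain ⟨T, hT, hXT⟩ := hΦ.1 X hX'
    have := hT.1
    obtain ⟨J, hJ, hJ', ⟨e⟩⟩ := exists_injective_with_socle (R := Λ) X
    obtain ⟨J', -, hJ₁', ⟨e'⟩⟩ := exists_injective_with_socle (R := Γ) T
    exact ⟨T, J', J, inferInstance, hT.noInjSummand, hXT, hJ', hJ₁', ⟨e⟩, ⟨e'⟩,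
      h.apply_of_injective hJ hJ' (not_isSimpleModule_of_socle hX' hJ' e) hJ₁' e e' hXT
        hT.noInjSummand⟩
  · intro X Y hX hY hXY hXY'
    have hinl : Function.Injective (linOf (biprod.inl : X ⟶ X ⊞ Y)) :=
      (injective_linOf_iff_mono _).2 inferInstance
    have hinr : Function.Injective (linOf (biprod.inr : Y ⟶ X ⊞ Y)) :=
      (injective_linOf_iff_mono _).2 inferInstance
    obtain ⟨T₁, J₁', J₁, h1, h2, h3, h4, h5, ⟨h6⟩, ⟨h7⟩, h8⟩ :=
      hX (IsSemisimpleModule.of_injective _ hinl) hXY'.of_biprod.1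
    obtain ⟨T₂, J₂', J₂, k1, k2, k3, k4, k5, ⟨k6⟩, ⟨k7⟩, k8⟩ :=
      hY (IsSemisimpleModule.of_injective _ hinr) hXY'.of_biprod.2
    refine ⟨T₁ ⊞ T₂, J₁' ⊞ J₂', J₁ ⊞ J₂, ?_, h2.biprod k2, h3.biprod k3, injective_biprod h4 k4,
      injective_biprod h5 k5, ⟨?_⟩, ⟨?_⟩, ?_⟩
    · have := isSemisimpleModule_prod (A := Γᵐᵒᵖ) (M := T₁) (N := T₂)
      exact IsSemisimpleModule.congr (biprodEquiv T₁ T₂)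
    · exact biprodEquiv X Y ≪≫ₗ h6.prodCongr k6 ≪≫ₗ socleProdEquiv.symm ≪≫ₗ
        socleEquiv (biprodEquiv J₁ J₂).symm
    · exact biprodEquiv T₁ T₂ ≪≫ₗ h7.prodCongr k7 ≪≫ₗ socleProdEquiv.symm ≪≫ₗ
        socleEquiv (biprodEquiv J₁' J₂').symm
    · rw [cls_biprod, cls_biprod]
      exact h8.add k8

lemma IsInducedIso.symm (hΦ : RestrictsToSimples Φ) (h : IsInducedIso Φ φ) :
    IsInducedIso Φ.symm φ.symm := by
  constructor
  · intro N hN hN1 hN2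
    obtain ⟨M, hM, hMN⟩ := exists_corresponds Φ.symm N
    obtain ⟨h1, h2⟩ := hMN.isIndec hN1 hN2 hM
    obtain ⟨h3, h4⟩ := h.apply_of_corresponds h1 h2 (hN1.noInjSummand hN2) hMN.symm
    refine ⟨M, h1, h2, hMN, ?_⟩
    have : φ ⟨cls M, h3⟩ = ⟨cls N, hN⟩ := Subtype.ext h4
    rw [← this, φ.symm_apply_apply]
  · intro J hJ hJ1 hJ2 hJ3
    obtain ⟨I, T, S, h1, h2, h3, ⟨h4⟩, ⟨h5⟩, h6⟩ :=
      exists_corresponds_injective hΦ.symm hJ1 hJ2 hJ3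
    have hT := hJ1.not_injective_of_socle hJ2 hJ3 h4
    obtain ⟨h7, h8⟩ := h.apply_of_injective h1 h2 h3 hJ2 h5 h4 h6.symm hT.noInjSummand
    refine ⟨I, T, S, h1, h2, ⟨h4⟩, ⟨h5⟩, h6, ?_⟩
    have : φ ⟨cls I, h7⟩ = ⟨cls J, hJ⟩ := Subtype.ext h8
    rw [← this, φ.symm_apply_apply]

end Values

/-! ### Compatibility of the bijection with the isomorphism at the vertices -/

section Pointwise

variable {Q : Type w} [Quiver.{v + 1} Q] [Finite Q] [∀ i j : Q, Finite (i ⟶ j)]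
  {Λ : Type u₁} {Γ : Type u₂} [Ring Λ] [Ring Γ] [IsArtinAlg Λ] [IsArtinAlg Γ]
  {Φ : StableCat (RightMod Λ) ≌ StableCat (RightMod Γ)}
  {φ : nonSimpleInjSubgroup Λ ≃+ nonSimpleInjSubgroup Γ}

/-- The injective modules in the Mimo-constructions of stably corresponding representations
correspond to each other. -/
lemma IsInducedIso.mapsTo_envelope (hΦ : RestrictsToSimples Φ) (h : IsInducedIso Φ φ)
    {B : Rep Q (RightMod Λ)} {B' : Rep Q (RightMod Γ)} (hB : ∀ k : Q, NoInjSummand (B.at k))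
    (hB' : ∀ k : Q, NoInjSummand (B'.at k))
    (Ψ : B ⋙ toStable (RightMod Λ) ⋙ Φ.functor ≅ B' ⋙ toStable (RightMod Γ)) (k : Q)
    {J : RightMod Λ} {J' : RightMod Γ} {j : LinearMap.ker (B.inMap k) →ₗ[Λᵐᵒᵖ] J}
    {j' : LinearMap.ker (B'.inMap k) →ₗ[Γᵐᵒᵖ] J'} (hj : IsInjEnvelope j)
    (hj' : IsInjEnvelope j') : MapsTo φ (cls J) (cls J') := by
  have : Fintype (Σ j : Q, (j ⟶ k)) := Fintype.ofFinite _
  have := additive_of_isEquivalence Φ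
  obtain ⟨e⟩ := hj.nonempty_socleEquiv
  obtain ⟨e'⟩ := hj'.nonempty_socleEquiv
  let S : RightMod Λ := modOf (socle Λᵐᵒᵖ J)
  let S' : RightMod Γ := modOf (socle Γᵐᵒᵖ J')
  obtain ⟨hS, ι, hι⟩ := isJointKernel_socle hB k (S := S) e.symm
  obtain ⟨hS', ι', hι'⟩ := isJointKernel_socle hB' k (S := S') e'.symm
  have hss : IsSemisimpleModule Λᵐᵒᵖ S :=
    inferInstanceAs (IsSemisimpleModule Λᵐᵒᵖ (socle Λᵐᵒᵖ J))
  obtain ⟨T, hT1, hT2, hT3, hT4⟩ := h.exists_semisimple hΦ hss hS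
  -- By `hΦ` the semisimple test objects on the two sides correspond, so `Φ` identifies the two
  -- joint kernels. The socles of `J` and `J'` therefore correspond to each other.
  obtain ⟨θ⟩ := hι.nonempty_iso Φ.functor (by
      rintro L ⟨U, hU, hU', ⟨α⟩⟩
      obtain ⟨V, h1, h2, ⟨β⟩, -⟩ := h.exists_semisimple hΦ hU hU'
      exact ⟨V, h1, h2, ⟨Φ.functor.mapIso α ≪≫ β⟩⟩) (by
      rintro L ⟨U, hU, hU', ⟨α⟩⟩
      obtain ⟨V, h1, h2, h3, -⟩ := (h.symm hΦ).exists_semisimple hΦ.symm hU hU'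
      obtain ⟨β⟩ := h3.symm
      exact ⟨_, ⟨V, h1, h2, ⟨Iso.refl _⟩⟩, ⟨β ≪≫ α.symm⟩⟩) hι'
    (fun a => Ψ.app ((Paths.of Q).obj a.1)) (Ψ.app ((Paths.of Q).obj k))
    (fun a => Ψ.hom.naturality ((Paths.of Q).map a.2))
  obtain ⟨ψ⟩ := hT3.iso_right ⟨θ⟩ hT2 hS'
  exact hT4 J J' hj.2.1 hj'.2.1 ⟨LinearEquiv.refl _ _⟩ ⟨equivOf ψ⟩

/-- The bijection induced by a stable equivalence is given by the induced isomorphism at the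
vertices. -/
theorem mapsTo_of_stableIso (hQ : IsAcyclicQuiver Q) (hΦ : RestrictsToSimples Φ)
    (h : IsInducedIso Φ φ) {X : MonoRep Q Λ} {Y : MonoRep Q Γ} (hX : nonInjIndecMono Q Λ X)
    (hY : nonInjIndecMono Q Γ Y)
    (Ψ : (monoToStable Q Λ ⋙ repFunctor Φ Q).obj X ≅ (monoToStable Q Γ).obj Y) (k : Q) :
    MapsTo φ (cls (X.obj.at k)) (cls (Y.obj.at k)) := by
  have := fun j k => hQ.finite_path j k
  rw [nonInjIndecMono_iff hQ] at hX hY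
  -- Both objects are Mimo-constructions of lifts of stably corresponding representations, so their
  -- modules at `k` are compared summand by summand.
  obtain ⟨B, hB, ⟨α⟩, J, e, he, θ, hθ⟩ :=
    (hX.1.isMinimal _ hX.2).isStableMimo hQ (Iso.refl _)
  obtain ⟨B', hB', ⟨α'⟩, J', e', he', θ', hθ'⟩ :=
    (hY.1.isMinimal _ hY.2).isStableMimo hQ (Iso.refl _)
  let Ψ' : B ⋙ toStable (RightMod Λ) ⋙ Φ.functor ≅ B' ⋙ toStable (RightMod Γ) :=
    (repFunctor Φ Q).mapIso α ≪≫ Ψ ≪≫ α'.symm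
  rw [IsMimo.cls_eq (θ k), IsMimo.cls_eq (θ' k)]
  refine (h.mapsTo_of_noInjSummand (hB k) (hB' k) ⟨Ψ'.app _⟩).add (MapsTo.finsum fun p => ?_)
  exact h.mapsTo_envelope hΦ hB hB' Ψ' p.1 (he p.1) (he' p.1)

end Pointwise

end

end QuiverMono

namespace QuiverMono

noncomputable section

set_option linter.unusedSectionVars false

/-! ### Extension to the simple injective modules -/

section Extension

variable {Λ : Type u₁} {Γ : Type u₂} [Ring Λ] [Ring Γ] [IsArtinAlg Λ] [IsArtinAlg Γ]

lemma simpleInj.of_iso {S T : RightMod Λ} (h : simpleInj Λ S) (φ : S ≅ T) : simpleInj Λ T := by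
  have := h.1
  exact ⟨IsSimpleModule.congr (equivOf φ.symm), Injective.of_iso φ h.2⟩

lemma simpleInj.isIndec {S : RightMod Λ} (h : simpleInj Λ S) : IsIndec S := by
  have := h.1
  exact isIndec_of_simple

/-- Each indecomposable class is either simple injective, where `ψ` prescribes the value, or lies in
the subgroup, where `φ` does. Krull-Schmidt makes these prescriptions independent. -/
lemma exists_extension_hom (φ : nonSimpleInjSubgroup Λ →+ nonSimpleInjSubgroup Γ)
    (ψ : IsoClasses (simpleInj Λ) → IsoClasses (simpleInj Γ)) :
    ∃ T : SplitK₀ (RightMod Λ) →+ SplitK₀ (RightMod Γ),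
      (∀ x : nonSimpleInjSubgroup Λ, T x = φ x) ∧
      ∀ (X : RightMod Λ) (Y : RightMod Γ) (hX : simpleInj Λ X) (hY : simpleInj Γ Y),
        ψ (IsoClasses.mk X hX) = IsoClasses.mk Y hY → T (cls X) = cls Y := by
  have key : ∀ a : IsoClasses (indecProp (RightMod Λ)), ∃ y : SplitK₀ (RightMod Γ),
      ∀ (X : RightMod Λ) (hi : IsIndec X), a = indecClass X hi →
        (∀ hX : nonSimpleInjIndec Λ X, y = φ ⟨cls X, cls_mem_of_indec hX⟩) ∧
        ∀ (Y : RightMod Γ) (hX : simpleInj Λ X) (hY : simpleInj Γ Y),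
          ψ (IsoClasses.mk X hX) = IsoClasses.mk Y hY → y = cls Y := by
    intro a
    obtain ⟨X, hX, rfl⟩ := a.exists_rep
    by_cases hs : simpleInj Λ X
    · obtain ⟨Y, hY, hXY⟩ := (ψ (IsoClasses.mk X hs)).exists_rep
      refine ⟨cls Y, fun X' hi' h => ?_⟩
      obtain ⟨α⟩ := (indecClass_eq_iff hX hi').1 h
      refine ⟨fun hX' => absurd (hs.of_iso α) hX'.2, fun Y' hX' hY' h' => ?_⟩
      rw [← (isoClasses_mk_eq_iff hs hX').2 ⟨α⟩, hXY, isoClasses_mk_eq_iff] at h'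
      exact cls_iso h'.some
    · refine ⟨φ ⟨cls X, cls_mem_of_indec ⟨hX, hs⟩⟩, fun X' hi' h => ?_⟩
      obtain ⟨α⟩ := (indecClass_eq_iff hX hi').1 h
      refine ⟨fun hX' => ?_, fun Y' hX' _ _ => absurd (hX'.of_iso α.symm) hs⟩
      exact congrArg (fun x => (φ x : SplitK₀ (RightMod Γ))) (Subtype.ext (cls_iso α))
  choose f hf using key
  obtain ⟨T, hT⟩ := exists_lift_of_indec f
  refine ⟨T, fun x => ?_, fun X Y hX hY h => ?_⟩
  · have : T.comp (nonSimpleInjSubgroup Λ).subtype =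
        (nonSimpleInjSubgroup Γ).subtype.comp φ :=
      eqOn_nonSimpleInjSubgroup fun X hX => (hT X hX.1).trans ((hf _ X hX.1 rfl).1 hX)
    exact DFunLike.congr_fun this x
  · exact (hT X hX.isIndec).trans ((hf _ X hX.isIndec rfl).2 Y hX hY h)

variable {φ : nonSimpleInjSubgroup Λ ≃+ nonSimpleInjSubgroup Γ}
  {ψ : IsoClasses (simpleInj Λ) ≃ IsoClasses (simpleInj Γ)}
  {φ' : SplitK₀ (RightMod Λ) ≃+ SplitK₀ (RightMod Γ)}

lemma comp_extension_eq_id {T : SplitK₀ (RightMod Λ) →+ SplitK₀ (RightMod Γ)}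
    {T' : SplitK₀ (RightMod Γ) →+ SplitK₀ (RightMod Λ)}
    (h1 : ∀ x : nonSimpleInjSubgroup Λ, T x = φ x)
    (h2 : ∀ (X : RightMod Λ) (Y : RightMod Γ) (hX : simpleInj Λ X) (hY : simpleInj Γ Y),
      ψ (IsoClasses.mk X hX) = IsoClasses.mk Y hY → T (cls X) = cls Y)
    (h1' : ∀ x : nonSimpleInjSubgroup Γ, T' x = φ.symm x)
    (h2' : ∀ (X : RightMod Γ) (Y : RightMod Λ) (hX : simpleInj Γ X) (hY : simpleInj Λ Y),
      ψ.symm (IsoClasses.mk X hX) = IsoClasses.mk Y hY → T' (cls X) = cls Y) :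
    T'.comp T = AddMonoidHom.id _ := by
  refine cls_hom_ext_indec fun X hX => ?_
  change T' (T (cls X)) = cls X
  by_cases hs : simpleInj Λ X
  · obtain ⟨Y, hY, hXY⟩ := (ψ (IsoClasses.mk X hs)).exists_rep
    rw [h2 X Y hs hY hXY, h2' Y X hY hs (by rw [← hXY, ψ.symm_apply_apply])]
  · rw [h1 ⟨cls X, cls_mem_of_indec ⟨hX, hs⟩⟩, h1', φ.symm_apply_apply]

lemma IsExtensionBy.symm (h : IsExtensionBy φ ψ φ') :
    IsExtensionBy φ.symm ψ.symm φ'.symm := by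
  refine ⟨fun x => ?_, fun S T hS hT hST => ?_⟩
  · rw [AddEquiv.symm_apply_eq, h.1, φ.apply_symm_apply]
  · rw [AddEquiv.symm_apply_eq]
    exact (h.2 T S hT hS (by rw [← hST, ψ.apply_symm_apply])).symm

/-- The induced isomorphism extends uniquely along a bijection between the simple injective
modules. -/
theorem existsUnique_extension (φ : nonSimpleInjSubgroup Λ ≃+ nonSimpleInjSubgroup Γ)
    (ψ : IsoClasses (simpleInj Λ) ≃ IsoClasses (simpleInj Γ)) :
    ∃! φ' : SplitK₀ (RightMod Λ) ≃+ SplitK₀ (RightMod Γ), IsExtensionBy φ ψ φ' := by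
  obtain ⟨T, h1, h2⟩ := exists_extension_hom φ.toAddMonoidHom ψ
  obtain ⟨T', h1', h2'⟩ := exists_extension_hom φ.symm.toAddMonoidHom ψ.symm
  refine ⟨AddMonoidHom.toAddEquiv T T' (comp_extension_eq_id h1 h2 h1' h2')
    (comp_extension_eq_id (φ := φ.symm) (ψ := ψ.symm) h1' h2' h1 h2), ⟨h1, h2⟩, fun φ' h => ?_⟩
  refine AddEquiv.toAddMonoidHom_injective (cls_hom_ext_indec fun X hX => ?_)
  change φ' (cls X) = T (cls X)
  by_cases hs : simpleInj Λ X
  · obtain ⟨Y, hY, hXY⟩ := (ψ (IsoClasses.mk X hs)).exists_rep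
    rw [h.2 X Y hs hY hXY, h2 X Y hs hY hXY]
  · exact (h.1 ⟨cls X, cls_mem_of_indec ⟨hX, hs⟩⟩).trans
      (h1 ⟨cls X, cls_mem_of_indec ⟨hX, hs⟩⟩).symm

variable {Φ : StableCat (RightMod Λ) ≌ StableCat (RightMod Γ)}

lemma IsExtensionBy.exists_injective (hΦ : RestrictsToSimples Φ) (h : IsInducedIso Φ φ)
    (h' : IsExtensionBy φ ψ φ') {J : RightMod Λ} (hJ : IsIndec J) (hJ' : Injective J) :
    ∃ I : RightMod Γ, IsIndec I ∧ Injective I ∧ cls I = φ' (cls J) := by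
  by_cases hs : IsSimpleModule Λᵐᵒᵖ J
  · obtain ⟨Y, hY, hXY⟩ := (ψ (IsoClasses.mk J ⟨hs, hJ'⟩)).exists_rep
    exact ⟨Y, hY.isIndec, hY.2, (h'.2 J Y ⟨hs, hJ'⟩ hY hXY).symm⟩
  · obtain ⟨I, S, T, h1, h2, h3, ⟨h4⟩, ⟨h5⟩, h6⟩ := exists_corresponds_injective hΦ hJ hJ' hs
    obtain ⟨h7, h8⟩ := h.apply_of_injective hJ hJ' hs h2 h4 h5 h6
      (h1.not_injective_of_socle h2 h3 h5).noInjSummand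
    exact ⟨I, h1, h2, h8.symm.trans (h'.1 ⟨_, h7⟩).symm⟩

end Extension

/-! ### Extension of the bijection to the injective objects -/

section ExtendBijection

lemma IsIndec.cls_ne_zero {R : Type u} [Ring R] [IsArtinAlg R] {J : RightMod R} (hJ : IsIndec J) :
    cls J ≠ 0 := by
  intro h
  obtain ⟨T, hT, -⟩ := exists_multiplicity hJ
  rw [h, map_zero] at hT
  exact zero_ne_one hT

variable {Q : Type w} [Quiver.{v + 1} Q]

/-- Representations freely generated by isomorphic modules at the same vertex are isomorphic. -/
lemma FreeData.nonempty_iso {R : Type u} [Ring R] {X Y : Rep Q (RightMod R)} {j : Q}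
    {A B : RightMod R} (F : FreeData X j A) (G : FreeData Y j B) (u : A ≃ₗ[Rᵐᵒᵖ] B) :
    Nonempty (X ≅ Y) := by
  refine ⟨⟨F.map G u.toLinearMap, G.map F u.symm.toLinearMap, F.hom_ext fun x => ?_,
    G.hom_ext fun x => ?_⟩⟩
  · refine (congrArg (repLin (G.map F u.symm.toLinearMap) j)
      (F.map_gen G u.toLinearMap Quiver.Path.nil x)).trans ?_
    rw [G.map_gen]
    exact congrArg _ (u.symm_apply_apply x)
  · refine (congrArg (repLin (F.map G u.toLinearMap) j)
      (G.map_gen F u.symm.toLinearMap Quiver.Path.nil x)).trans ?_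
    rw [F.map_gen]
    exact congrArg _ (u.apply_symm_apply x)

variable [Finite Q] [∀ i j : Q, Finite (i ⟶ j)]

section

variable {R : Type u} [Ring R] [IsArtinAlg R]

lemma IsInjMono.of_iso (hQ : IsAcyclicQuiver Q) {X Y : MonoRep Q R} (hX : IsInjMono X)
    (φ : X ≅ Y) : IsInjMono Y := by
  rw [isInjMono_iff hQ] at hX ⊢
  rw [← φ.inv_hom_id, ← Category.id_comp φ.hom, Functor.map_comp, Functor.map_comp, hX, zero_comp,
    comp_zero]

lemma cls_at_eq {X Y : MonoRep Q R} (α : X ≅ Y) (i : Q) :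
    cls (X.obj.at i) = cls (Y.obj.at i) :=
  cls_iso (((isMonoRep Q R).ι.mapIso α).app _)

/-- Indecomposable injective objects of the monomorphism category are determined by their classes
at the vertices. -/
lemma nonempty_iso_of_cls_eq (hQ : IsAcyclicQuiver Q) {X Y : MonoRep Q R} (hX : IsIndec X)
    (hX' : IsInjMono X) (hY : IsIndec Y) (hY' : IsInjMono Y)
    (h : ∀ i : Q, cls (X.obj.at i) = cls (Y.obj.at i)) : Nonempty (X ≅ Y) := by
  have := fun j k => hQ.finite_path j k
  obtain ⟨j, J, hJ, -, ⟨F⟩⟩ := exists_freeData_of_injective hQ hX hX'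
  obtain ⟨i, I, hI, -, ⟨G⟩⟩ := exists_freeData_of_injective hQ hY hY'
  have hcard : ∀ j : Q, Nat.card (Quiver.Path j j) = 1 := fun j =>
    Nat.card_eq_one_iff_unique.2 ⟨⟨fun p q => (hQ j p).trans (hQ j q).symm⟩, ⟨Quiver.Path.nil⟩⟩
  -- At its generating vertex a free representation has the class of its generating module, since
  -- the trivial path is the only loop. Comparison at `j` and at `i` gives `J ≅ I` and paths in both
  -- directions, so `i = j` by acyclicity.
  have h1 := h j
  have h2 := h i
  rw [F.cls_eq, G.cls_eq, hcard] at h1 h2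
  obtain ⟨u⟩ := hJ.iso_of_cls_eq hI one_ne_zero h1
  have p : Nonempty (Quiver.Path i j) := by
    by_contra hp
    rw [not_nonempty_iff] at hp
    rw [Nat.card_of_isEmpty, zero_smul, one_smul] at h1
    exact hJ.cls_ne_zero h1
  have q : Nonempty (Quiver.Path j i) := by
    by_contra hq
    rw [not_nonempty_iff] at hq
    rw [Nat.card_of_isEmpty, zero_smul, one_smul] at h2
    exact hI.cls_ne_zero h2.symm
  obtain ⟨p⟩ := p
  obtain ⟨q⟩ := q
  have hlen := congrArg Quiver.Path.length (hQ i (p.comp q))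
  rw [Quiver.Path.length_comp, Quiver.Path.length_nil] at hlen
  obtain rfl := Quiver.Path.eq_of_length_zero p (by omega)
  obtain ⟨α⟩ := F.nonempty_iso G (equivOf u)
  exact ⟨(isMonoRep Q R).isoMk α⟩

end

variable {Λ : Type u₁} {Γ : Type u₂} [Ring Λ] [Ring Γ] [IsArtinAlg Λ] [IsArtinAlg Γ]
  {Φ : StableCat (RightMod Λ) ≌ StableCat (RightMod Γ)}
  {φ : nonSimpleInjSubgroup Λ ≃+ nonSimpleInjSubgroup Γ}
  {ψ : IsoClasses (simpleInj Λ) ≃ IsoClasses (simpleInj Γ)}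
  {φ' : SplitK₀ (RightMod Λ) ≃+ SplitK₀ (RightMod Γ)}

/-- Replace the generating module of the free representation by its image under `φ'`; the path
multiplicities at all vertices stay the same. -/
lemma IsExtensionBy.exists_injMono (hQ : IsAcyclicQuiver Q) (hΦ : RestrictsToSimples Φ)
    (h : IsInducedIso Φ φ) (h' : IsExtensionBy φ ψ φ') {X : MonoRep Q Λ} (hX : IsIndec X)
    (hX' : IsInjMono X) : ∃ Y : MonoRep Q Γ, IsIndec Y ∧ IsInjMono Y ∧
      ∀ i : Q, cls (Y.obj.at i) = φ' (cls (X.obj.at i)) := by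
  have := fun j k => hQ.finite_path j k
  obtain ⟨j, J, hJ, hJ', ⟨F⟩⟩ := exists_freeData_of_injective hQ hX hX'
  obtain ⟨I, hI, hI', hIJ⟩ := h'.exists_injective hΦ h hJ hJ'
  obtain ⟨Y, ⟨G⟩⟩ := exists_freeRep hQ j I
  obtain ⟨h1, h2⟩ := FreeData.isIndec_and_isInjMono hQ (X := ⟨Y, G.isMonoRep⟩) G hI hI'
  refine ⟨⟨Y, G.isMonoRep⟩, h1, h2, fun i => ?_⟩
  rw [F.cls_eq, map_nsmul, ← hIJ]
  exact G.cls_eq i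

/-- The induced bijection extends uniquely to all indecomposable objects of the monomorphism
categories, compatibly with the classes at the vertices. -/
theorem existsUnique_extendsBijection (hQ : IsAcyclicQuiver Q) (hΦ : RestrictsToSimples Φ)
    {φQ : IsoClasses (nonInjIndecMono Q Λ) ≃ IsoClasses (nonInjIndecMono Q Γ)}
    (hφQ : IsInducedBijection Φ φQ) (h : IsInducedIso Φ φ) (h' : IsExtensionBy φ ψ φ') :
    ∃! φQ' : IsoClasses (indecMono Q Λ) ≃ IsoClasses (indecMono Q Γ),
      ExtendsBijection φQ φQ' ∧
      ∀ (X : MonoRep Q Λ) (Y : MonoRep Q Γ) (hX : indecMono Q Λ X) (hY : indecMono Q Γ Y),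
        φQ' (IsoClasses.mk X hX) = IsoClasses.mk Y hY →
        ∀ i : Q, cls (Y.obj.at i) = φ' (cls (X.obj.at i)) := by
  -- Non-injective objects are matched by `φQ`. Injective ones are matched by their classes at the
  -- vertices, which determine them.
  let R : MonoRep Q Λ → MonoRep Q Γ → Prop := fun X Y =>
    (∃ (hX : nonInjIndecMono Q Λ X) (hY : nonInjIndecMono Q Γ Y),
      φQ (IsoClasses.mk X hX) = IsoClasses.mk Y hY) ∨
    (IsInjMono X ∧ IsInjMono Y ∧ ∀ i : Q, cls (Y.obj.at i) = φ' (cls (X.obj.at i)))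
  obtain ⟨e, he⟩ := exists_isoClasses_equiv (P := indecMono Q Λ) (P' := indecMono Q Γ) R
    (fun X hX => by
      by_cases hinj : IsInjMono X
      · obtain ⟨Y, h1, h2, h3⟩ := h'.exists_injMono hQ hΦ h hX hinj
        exact ⟨Y, h1, Or.inr ⟨hinj, h2, h3⟩⟩
      · obtain ⟨Y, hY, hXY⟩ := (φQ (IsoClasses.mk X ⟨hX, hinj⟩)).exists_rep
        exact ⟨Y, hY.1, Or.inl ⟨⟨hX, hinj⟩, hY, hXY⟩⟩)
    (fun Y hY => by
      by_cases hinj : IsInjMono Y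
      · obtain ⟨X, h1, h2, h3⟩ := h'.symm.exists_injMono hQ hΦ.symm (h.symm hΦ) hY hinj
        exact ⟨X, h1, Or.inr ⟨h2, hinj, fun i => by rw [h3, φ'.apply_symm_apply]⟩⟩
      · obtain ⟨X, hX, hXY⟩ := (φQ.symm (IsoClasses.mk Y ⟨hY, hinj⟩)).exists_rep
        exact ⟨X, hX.1, Or.inl ⟨hX, ⟨hY, hinj⟩, by rw [← hXY, φQ.apply_symm_apply]⟩⟩)
    (fun X X' Y Y' hX hX' hY hY' hR hR' => by
      rcases hR with ⟨h1, h2, h3⟩ | ⟨h1, h2, h3⟩ <;> rcases hR' with ⟨k1, k2, k3⟩ | ⟨k1, k2, k3⟩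
      · rw [← isoClasses_mk_eq_iff h1 k1, ← isoClasses_mk_eq_iff h2 k2, ← h3, ← k3,
          φQ.injective.eq_iff]
      · exact ⟨fun ⟨α⟩ => absurd (k1.of_iso hQ α.symm) h1.2,
          fun ⟨α⟩ => absurd (k2.of_iso hQ α.symm) h2.2⟩
      · exact ⟨fun ⟨α⟩ => absurd (h1.of_iso hQ α) k1.2,
          fun ⟨α⟩ => absurd (h2.of_iso hQ α) k2.2⟩
      · constructor
        · rintro ⟨α⟩
          refine nonempty_iso_of_cls_eq hQ hY h2 hY' k2 fun i => ?_
          rw [h3, k3, cls_at_eq α]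
        · rintro ⟨α⟩
          refine nonempty_iso_of_cls_eq hQ hX h1 hX' k1 fun i => φ'.injective ?_
          rw [← h3, ← k3, cls_at_eq α])
    (fun X X' Y hX hX' hY ⟨α⟩ hR => by
      rcases hR with ⟨h1, h2, h3⟩ | ⟨h1, h2, h3⟩
      · have k1 : nonInjIndecMono Q Λ X' := ⟨hX', fun k => h1.2 (k.of_iso hQ α.symm)⟩
        exact Or.inl ⟨k1, h2, by rw [← (isoClasses_mk_eq_iff h1 k1).2 ⟨α⟩, h3]⟩
      · exact Or.inr ⟨h1.of_iso hQ α, h2, fun i => by rw [h3, cls_at_eq α]⟩)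
    (fun X Y Y' hX hY hY' ⟨α⟩ hR => by
      rcases hR with ⟨h1, h2, h3⟩ | ⟨h1, h2, h3⟩
      · have k2 : nonInjIndecMono Q Γ Y' := ⟨hY', fun k => h2.2 (k.of_iso hQ α.symm)⟩
        exact Or.inl ⟨h1, k2, by rw [h3, (isoClasses_mk_eq_iff h2 k2).2 ⟨α⟩]⟩
      · exact Or.inr ⟨h1, h2.of_iso hQ α, fun i => by rw [← cls_at_eq α, h3]⟩)
  refine ⟨e, ⟨fun X Y hX hY hXY => (he X Y hX.1 hY.1).2 (Or.inl ⟨hX, hY, hXY⟩), ?_⟩, ?_⟩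
  · intro X Y hX hY hXY i
    rcases (he X Y hX hY).1 hXY with ⟨h1, h2, h3⟩ | ⟨-, -, h3⟩
    · obtain ⟨Ψ⟩ := hφQ.nonempty_iso hQ h1 h2 h3
      obtain ⟨h4, h5⟩ := mapsTo_of_stableIso hQ hΦ h h1 h2 Ψ i
      exact h5.symm.trans (h'.1 ⟨_, h4⟩).symm
    · exact h3 i
  · rintro φQ' ⟨h1, h2⟩
    refine Equiv.ext fun a => ?_
    obtain ⟨X, hX, rfl⟩ := a.exists_rep
    obtain ⟨Y, hY, hXY⟩ := (φQ' (IsoClasses.mk X hX)).exists_rep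
    rw [hXY, eq_comm, he X Y hX hY]
    by_cases hinj : IsInjMono X
    · refine Or.inr ⟨hinj, ?_, h2 X Y hX hY hXY⟩
      -- An extension sends injective objects to injective ones: a non-injective `Y` is already the
      -- image under `φQ` of a non-injective object.
      by_contra hY'
      obtain ⟨X', hX', hXY'⟩ := (φQ.symm (IsoClasses.mk Y ⟨hY, hY'⟩)).exists_rep
      have h3 := h1 X' Y hX' ⟨hY, hY'⟩ (by rw [← hXY', φQ.apply_symm_apply])
      obtain ⟨α⟩ := (isoClasses_mk_eq_iff (P := indecMono Q Λ) hX'.1 hX).1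
        (φQ'.injective (h3.trans hXY.symm))
      exact hX'.2 (hinj.of_iso hQ α.symm)
    · obtain ⟨Y', hY', hXY'⟩ := (φQ (IsoClasses.mk X ⟨hX, hinj⟩)).exists_rep
      have h3 := h1 X Y' ⟨hX, hinj⟩ hY' hXY'
      obtain ⟨α⟩ := (isoClasses_mk_eq_iff (P := indecMono Q Γ) hY hY'.1).1 (hXY.symm.trans h3)
      have hY'' : nonInjIndecMono Q Γ Y := ⟨hY, fun k => hY'.2 (k.of_iso hQ α)⟩
      exact Or.inl ⟨⟨hX, hinj⟩, hY'', by rw [hXY', (isoClasses_mk_eq_iff hY'' hY').2 ⟨α⟩]⟩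

end ExtendBijection

end

end QuiverMono

theorem mainTheorem5 {k : Type*} [CommRing k] [IsArtinianRing k]
    {Λ : Type*} [Ring Λ] [Algebra k Λ] [Module.Finite k Λ]
    {Γ : Type*} [Ring Γ] [Algebra k Γ] [Module.Finite k Γ]
    {Q : Type*} [Quiver.{v + 1} Q] [Finite Q] [∀ i j : Q, Finite (i ⟶ j)]
    (hQ : IsAcyclicQuiver Q)
    (Φ : StableCat (RightMod Λ) ≌ StableCat (RightMod Γ)) (hΦ : RestrictsToSimples Φ) :
    (∃! φQ : IsoClasses (nonInjIndecMono Q Λ) ≃ IsoClasses (nonInjIndecMono Q Γ),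
      IsInducedBijection Φ φQ) ∧
    (∃! φ : nonSimpleInjSubgroup Λ ≃+ nonSimpleInjSubgroup Γ, IsInducedIso Φ φ) ∧
    ∀ (φQ : IsoClasses (nonInjIndecMono Q Λ) ≃ IsoClasses (nonInjIndecMono Q Γ))
      (φ : nonSimpleInjSubgroup Λ ≃+ nonSimpleInjSubgroup Γ),
      IsInducedBijection Φ φQ → IsInducedIso Φ φ →
      -- `φQ` commutes pointwise with `φ`
      (∀ (X : MonoRep Q Λ) (Y : MonoRep Q Γ) (hX : nonInjIndecMono Q Λ X)
        (hY : nonInjIndecMono Q Γ Y), φQ (IsoClasses.mk X hX) = IsoClasses.mk Y hY →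
        ∀ i : Q, ∃ hi : cls (X.obj.at i) ∈ nonSimpleInjSubgroup Λ,
          cls (Y.obj.at i) = (φ ⟨cls (X.obj.at i), hi⟩ : SplitK₀ (RightMod Γ))) ∧
      -- the unique extension to all indecomposable objects
      (∀ ψ : IsoClasses (simpleInj Λ) ≃ IsoClasses (simpleInj Γ),
        (∃! φ' : SplitK₀ (RightMod Λ) ≃+ SplitK₀ (RightMod Γ), IsExtensionBy φ ψ φ') ∧
        ∀ φ' : SplitK₀ (RightMod Λ) ≃+ SplitK₀ (RightMod Γ), IsExtensionBy φ ψ φ' →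
          ∃! φQ' : IsoClasses (indecMono Q Λ) ≃ IsoClasses (indecMono Q Γ),
            ExtendsBijection φQ φQ' ∧
            ∀ (X : MonoRep Q Λ) (Y : MonoRep Q Γ) (hX : indecMono Q Λ X) (hY : indecMono Q Γ Y),
              φQ' (IsoClasses.mk X hX) = IsoClasses.mk Y hY →
              ∀ i : Q, cls (Y.obj.at i) = φ' (cls (X.obj.at i))) := by
  have hΛ : IsArtinAlg Λ := isArtinAlg_of_finite k Λ
  have hΓ : IsArtinAlg Γ := isArtinAlg_of_finite k Γ
  refine ⟨existsUnique_inducedBijection hQ, existsUnique_inducedIso hΦ, fun φQ φ hφQ hφ =>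
    ⟨fun X Y hX hY hXY i => ?_, fun ψ => ⟨existsUnique_extension φ ψ, fun φ' hφ' =>
      existsUnique_extendsBijection hQ hΦ hφQ hφ hφ'⟩⟩⟩
  obtain ⟨Ψ⟩ := hφQ.nonempty_iso hQ hX hY hXY
  obtain ⟨hi, h⟩ := mapsTo_of_stableIso hQ hΦ hφ hX hY Ψ i
  exact ⟨hi, h.symm⟩
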